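/- Setting. Let $G$ be a finite group (for example $G=\mathbb Z_N$), $d\ge 1$, and let $\mu$ be a unitary representation of $G$ on $\mathbb C^d$. For each $L\ge 1$ consider the periodic chain of $L$ sites, each with Hilbert space $\mathbb C^d$ and on-site symmetry $\mu_g$; for a set $S$ of sites put $U_{g,S}=\prod_{i\in S}\mu_{g,i}$ and let $U_g$ be the global symmetry operator. A *$G$-symmetric 1D QCA* $U$ is a family of unitaries, one for each $L$, commuting with all $U_g$, such that, for some $\xi$ independent of $L$, $U^\dagger A\,U$ is supported on $[i-\xi,i+\xi]$ whenever $A$ is supported on the site $i$. A *$G$-symmetric finite-depth circuit* is a family of unitaries which, for all large $L$, is a product of at most $D$ layers, each layer being a product of unitary gates that individually commute with all $U_g$ and are supported on disjoint intervals of at most $\ell$ sites, with $D,\ell$ independent of $L$. Two $G$-symmetric QCA $U,U'$ are *strongly equivalent* if, for some $k\ge 0$, after adding to each site $k$ ancillas carrying the representation $\mu$, one has $U\otimes \mathbb 1=W\,(U'\otimes\mathbb 1)$ for all large $L$, with $W$ a $G$-symmetric finite-depth circuit (for the on-site representation $\mu^{\otimes(1+k)}$). Let $U$ be a $G$-symmetric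 QCA with spreading length $\xi$ and let $I$ be an interval of $2n$ sites, $n>\xi$. Write $$U^\dagger U_{g,I}\,U=L_g\otimes R_g ,$$ with $L_g$ and $R_g$ supported to the left and to the right of the midpoint of $I$. The operators $U^\dagger A\,U$ ($A$ supported on $I$) that are supported to the right of the midpoint form a $*$-algebra isomorphic to a full matrix algebra $M_r(\mathbb C)$ which contains $R_g$, and $R_g$ is regarded as an operator on $\mathbb C^r$ (so that $r$ need not equal $d^n$). The phases are assumed to be chosen such that $g\mapsto R_g$ is a linear unitary representation; it is then determined up to a one-dimensional representation of $G$. Theorem. (0) If $G$ is cyclic, such a representation $R_g$ exists for all large $L$ and every position of $I$. (1) Let $U,U'$ be $G$-symmetric QCA with spreading lengths $\xi,\xi'$, and, for all large $L$, let $R_g$ and $R'_g$ be such representations obtained from intervals of $2n$ and $2n'$ sites, where $n>\xi$ and $n'>\xi'$ do not depend on $L$. Then $U$ and $U'$ are strongly equivalent if and only if, for all large $L$, $R_g$ and $R'_g$ differ only by a one-dimensional representation and by tensoring with copies of $\mu_g$, the numbers of copies matching the lengths of the intervals: there are a one-dimensional unitary representation $u_g$ of $G$ and integers $a,b\ge 0$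 with $n+a=n'+b$ such that $$R_g\otimes\mu_g^{\otimes a}\;\cong\;u_g\,R'_g\otimes\mu_g^{\otimes b}.$$ (2) In particular, $U$ is (for all large $L$) a $G$-symmetric finite-depth circuit if and only if, for all large $L$, $R_g\cong u_g\,\mu_g^{\otimes n}$ for some one-dimensional unitary representation $u_g$ of $G$, where $n$ is the number of sites of half of the interval $I$. -/

import Mathlib

open scoped Kronecker Matrix

noncomputable section

namespace QCA

/-- Operators on a periodic chain of `L` sites (labelled by `ZMod L`), where the Hilbert space of
one site has an orthonormal basis labelled by `s`: matrices in the product basis, which is labelled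
by the configurations `ZMod L → s`. -/
abbrev Op (L : ℕ) (s : Type) : Type := Matrix (ZMod L → s) (ZMod L → s) ℂ

/-- The operator `⨂ i, A i` on the tensor product of the one-site spaces. -/
def tensorOp {ι s : Type} [Fintype ι] (A : ι → Matrix s s ℂ) : Matrix (ι → s) (ι → s) ℂ :=
  Matrix.of fun x y => ∏ i, A i (x i) (y i)

/-- The interval `c, c + 1, …, c + m - 1` of the periodic chain (the whole chain if `L ≤ m`). -/
def arc {L : ℕ} (c : ZMod L) (m : ℕ) : Set (ZMod L) :=
  {x | ∃ j : ℕ, j < m ∧ x = c + (j : ZMod L)}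

open Classical in
/-- `A` is supported on the set `S` of sites: `A = B ⊗ 1` with `B` an operator on the sites
in `S`. -/
def SupportedOn {L : ℕ} {s : Type} (S : Set (ZMod L)) (A : Op L s) : Prop :=
  ∃ B : Matrix (S → s) (S → s) ℂ, ∀ x y : ZMod L → s,
    A x y = if ∀ i, i ∉ S → x i = y i then B (fun i => x i) (fun i => y i) else 0

/-- Heisenberg evolution `A ↦ U† A U`. -/
def evolve {L : ℕ} [NeZero L] {s : Type} [Fintype s] (U A : Op L s) : Op L s :=
  Uᴴ * A * U

/-- `U` is a QCA with operator spreading length (at most) `ξ`: a unitary that takes each operator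
on site `i` to an operator supported on `[i - ξ, i + ξ]`. -/
def IsQCA {L : ℕ} [NeZero L] {s : Type} [Fintype s] [DecidableEq s] (ξ : ℕ) (U : Op L s) : Prop :=
  U ∈ Matrix.unitaryGroup (ZMod L → s) ℂ ∧
    ∀ (i : ZMod L) (A : Op L s), SupportedOn {i} A →
      SupportedOn (arc (i - (ξ : ZMod L)) (2 * ξ + 1)) (evolve U A)

open Classical in
/-- The restriction `U_{g,S} = ∏_{i ∈ S} μ_{g,i}` to a set `S` of sites of the global symmetry
operator, where `ν = μ g` is the on-site symmetry operator. -/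
def symOn {L : ℕ} [NeZero L] {s : Type} [DecidableEq s] (ν : Matrix s s ℂ) (S : Set (ZMod L)) :
    Op L s :=
  tensorOp fun i => if i ∈ S then ν else 1

/-- `A` commutes with all global symmetry operators `U_g = ∏_i μ_{g,i}`, where `μ` is the on-site
representation. -/
def IsSymmetric {G : Type*} {L : ℕ} [NeZero L] {s : Type} [Fintype s] [DecidableEq s]
    (μ : G → Matrix s s ℂ) (A : Op L s) : Prop :=
  ∀ g, A * symOn (μ g) Set.univ = symOn (μ g) Set.univ * A

/-- One layer of a symmetric circuit: a product of unitary gates, each commuting with the global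
symmetry, supported on pairwise disjoint intervals with at most `ℓ` sites. -/
def IsSymmetricLayer {G : Type*} {L : ℕ} [NeZero L] {s : Type} [Fintype s] [DecidableEq s]
    (μ : G → Matrix s s ℂ) (ℓ : ℕ) (V : Op L s) : Prop :=
  ∃ (m : ℕ) (start : Fin m → ZMod L) (len : Fin m → ℕ) (gate : Fin m → Op L s),
    (∀ j, len j ≤ ℓ) ∧
    (∀ i j, i ≠ j → Disjoint (arc (start i) (len i)) (arc (start j) (len j))) ∧
    (∀ j, gate j ∈ Matrix.unitaryGroup (ZMod L → s) ℂ ∧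
      SupportedOn (arc (start j) (len j)) (gate j) ∧ IsSymmetric μ (gate j)) ∧
    V = (List.ofFn gate).prod

/-- A symmetric circuit of depth `D` with gates on intervals of at most `ℓ` sites. -/
def IsSymmetricCircuit {G : Type*} {L : ℕ} [NeZero L] {s : Type} [Fintype s] [DecidableEq s]
    (μ : G → Matrix s s ℂ) (D ℓ : ℕ) (V : Op L s) : Prop :=
  ∃ layer : Fin D → Op L s, (∀ t, IsSymmetricLayer μ ℓ (layer t)) ∧ V = (List.ofFn layer).prod

/-- A family `W L` of operators on the periodic chains of `L` sites is a symmetric finite-depth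
quantum circuit: depth and gate size are bounded independently of the (large) system size `L`. -/
def IsSymmetricFDQC {G : Type*} {s : Type} [Fintype s] [DecidableEq s]
    (μ : G → Matrix s s ℂ) (W : ∀ L : ℕ+, Op L s) : Prop :=
  ∃ D ℓ : ℕ, ∀ᶠ L : ℕ+ in Filter.atTop, IsSymmetricCircuit μ D ℓ (W L)

/-- `U ⊗ 1_a`: an ancilla with basis `t` is added to each site and evolves trivially. -/
def withAncilla {L : ℕ} [NeZero L] {s : Type} (t : Type) [DecidableEq t] (U : Op L s) :
    Op L (s × t) :=
  Matrix.of fun x y =>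
    U (fun i => (x i).1) (fun i => (y i).1) * if (fun i => (x i).2) = fun i => (y i).2 then 1 else 0

/-- The representation `ρ ⊗ μ^{⊗ k}`. -/
def tensorCopies {G : Type*} {q s : Type} (ρ : G → Matrix q q ℂ) (μ : G → Matrix s s ℂ) (k : ℕ) :
    G → Matrix (q × (Fin k → s)) (q × (Fin k → s)) ℂ :=
  fun g => ρ g ⊗ₖ tensorOp fun _ : Fin k => μ g

/-- Strong equivalence: after adding to each site some number `k` of ancillas that carry the on-site
representation `μ`, the two families differ by a symmetric finite-depth quantum circuit. -/
def StronglyEquivalent {G : Type*} {s : Type} [Fintype s] [DecidableEq s]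
    (μ : G → Matrix s s ℂ) (U U' : ∀ L : ℕ+, Op L s) : Prop :=
  ∃ (k : ℕ) (W : ∀ L : ℕ+, Op L (s × (Fin k → s))),
    IsSymmetricFDQC (tensorCopies μ μ k) W ∧
    ∀ᶠ L : ℕ+ in Filter.atTop,
      withAncilla (Fin k → s) (U L) = W L * withAncilla (Fin k → s) (U' L)

/-- Let `I` be the interval of `2 n` sites whose right half starts at `c`. `IsRightRep μ ξ n U c ρ`
says that `ρ` is the representation `R_g` in `U† U_{g,I} U = L_g ⊗ R_g`, where `L_g` and `R_g` are
supported to the left and to the right of the midpoint of `I`. The operators `U† A U`, `A` supported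
on `I`, that are supported to the right of the midpoint form a full matrix algebra `M_r(ℂ)`; the
operator `R_g` belongs to it, and it is seen through `φ` as an operator `ρ g` on `ℂ^r`. -/
def IsRightRep {G : Type*} [Group G] {L : ℕ} [NeZero L] {s : Type} [Fintype s] [DecidableEq s]
    (μ : G → Matrix s s ℂ) (ξ n : ℕ) (U : Op L s) (c : ZMod L) {r : ℕ}
    (ρ : G →* Matrix.unitaryGroup (Fin r) ℂ) : Prop :=
  ∃ φ : Matrix (Fin r) (Fin r) ℂ →⋆ₐ[ℂ] Op L s,
    Set.range φ =
      {B | (∃ A : Op L s, SupportedOn (arc (c - (n : ZMod L)) (2 * n)) A ∧ B = evolve U A) ∧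
        SupportedOn (arc c (n + ξ)) B} ∧
    ∃ lam : G → Op L s, ∀ g,
      SupportedOn (arc (c - ((n + ξ : ℕ) : ZMod L)) (n + ξ)) (lam g) ∧
      evolve U (symOn (μ g) (arc (c - (n : ZMod L)) (2 * n))) = lam g * φ (ρ g)

/-- Unitary equivalence `A ≅ u ⊗ B` of two (matrix) representations up to the one-dimensional
representation `u`. -/
def EquivUpTo {G : Type*} [Group G] {p q : Type} [Fintype p] [Fintype q] [DecidableEq p]
    [DecidableEq q] (u : G →* Circle) (A : G → Matrix p p ℂ) (B : G → Matrix q q ℂ) : Prop :=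
  ∃ T : Matrix p q ℂ, T * Tᴴ = 1 ∧ Tᴴ * T = 1 ∧ ∀ g, A g * T = (u g : ℂ) • (T * B g)

/-- `ρ` (obtained from an interval of `2 n` sites) and `ρ'` (obtained from one of `2 n'` sites)
differ only by a one-dimensional representation and by tensoring with copies of `μ`; the copies
compensate the difference of the lengths, so that both sides describe `n + a = n' + b` sites. -/
def DifferByOnsite {G : Type*} [Group G] {s : Type} [Fintype s] [DecidableEq s]
    (μ : G → Matrix s s ℂ) (n n' : ℕ) {r r' : ℕ}
    (ρ : G → Matrix (Fin r) (Fin r) ℂ) (ρ' : G → Matrix (Fin r') (Fin r') ℂ) : Prop :=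
  ∃ (u : G →* Circle) (a b : ℕ), n + a = n' + b ∧
    EquivUpTo u (tensorCopies ρ μ a) (tensorCopies ρ' μ b)

end QCA

end

/-! The invariant lives on boundary algebras. `right ξ U b c` consists of the operators evolved from
sites left of `b` and supported right of `c`; `left` is its mirror image. They factor two kinds of
interval algebra. The evolved operators on `[a, b)` are the tensor product of the left algebra for
`(a, c)` and the right algebra for `(b, c)`. The operators on `[c, e)` are the tensor product of the
right algebra for `(b, c)` and the left algebra for `(b, e)`. Both splittings are commutant
computations (`mem_supp_of_commute_bal`, `FactorRep.commutant`).

The global symmetry acts on a boundary algebra by conjugation. A representation implementing this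
action is unique up to a one-dimensional one (`FactorRep.unique`), and `R_g` is such a
representation. Characters determine unitary representations of a finite group
(`exists_unitary_intertwiner`), so the data are a dimension and a normalized character. Normalized
traces multiply over commuting factors. The two splittings therefore show that these data do not
change under translation of the cuts (`right_shift`, `right_translate`), and that widening by `k`
sites multiplies the character by the `k`-th power of that of `μ` (`right_widen`). Where the
character of `μ` vanishes one cannot divide by it, but there the character of any boundary algebra
containing a whole site vanishes too (`ntr_eq_zero_of_site`).

Circuits preserve the data: a layer preserves the operators on an interval whose ends no gate
crosses, so the cut is translated to such a place and back (`right_layer`, `right_circuit`).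
Ancillas contribute only powers of the character of `μ` (`right_ancL`).

Conversely, let `U` and `U'` have the same data (`isSymmetricCircuit_of_ntr_eq`). Cut the ring into
blocks. On each block a symmetric unitary carries the right and left boundary algebras of `U` to
those of `U'`; let `Y` be the product of these. Then `T = U Y† U'†` preserves the operators on each
shifted block, so it is a scalar times a product of block gates. Since `U U'† = T (U' Y U'†)` and
`U' Y U'†` is a product of local gates on slightly enlarged blocks, `U U'†` is a symmetric circuit
of depth four.

For cyclic groups the implementing representation exists because the projective phase of a generator
can be removed by a root (`exists_rep_of_isCyclic`). -/

section

open scoped ComplexOrder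

namespace QCA

/-! ### Rank reduction for matrices -/

section MinimalRank

variable {p q : Type*} [Fintype q]

theorem rank_lt_rank_of_mulVec (A B : Matrix p q ℂ) (h : ∀ v, A *ᵥ v = 0 → B *ᵥ v = 0)
    (w : q → ℂ) (hw : B *ᵥ w = 0) (hw' : A *ᵥ w ≠ 0) : B.rank < A.rank := by
  classical
  have hlt : LinearMap.ker A.mulVecLin < LinearMap.ker B.mulVecLin := by
    refine lt_of_le_of_ne (fun v hv => ?_) (fun heq => ?_)
    · simpa using h v (by simpa using hv)
    · have : w ∈ LinearMap.ker A.mulVecLin := by rw [heq]; simpa using hw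
      exact hw' (by simpa using this)
  have h1 := Submodule.finrank_lt_finrank_of_lt hlt
  have h2 := LinearMap.finrank_range_add_finrank_ker A.mulVecLin
  have h3 := LinearMap.finrank_range_add_finrank_ker B.mulVecLin
  unfold Matrix.rank
  omega

/-- The number `a` is a positive eigenvalue of `Sᴴ * S`: the difference kills its eigenvector and
everything in the kernel of `S`. In a space closed under this operation, an element of minimal
nonzero rank hence satisfies `S * Sᴴ * S = a • S` and is a multiple of a partial isometry. -/
theorem exists_rank_lt_of_ne_zero [Fintype p] [DecidableEq q] (S : Matrix p q ℂ) (hS : S ≠ 0) :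
    ∃ a : ℝ, 0 < a ∧ (S * Sᴴ * S - (a : ℂ) • S).rank < S.rank := by
  have hpsd : (Sᴴ * S).PosSemidef := Matrix.posSemidef_conjTranspose_mul_self S
  have hne : hpsd.1.eigenvalues ≠ 0 := by
    intro h0
    have := (hpsd.1.eigenvalues_eq_zero_iff).1 h0
    exact hS (Matrix.conjTranspose_mul_self_eq_zero.1 this)
  obtain ⟨i, hi⟩ := Function.ne_iff.1 hne
  have hpos : 0 < hpsd.1.eigenvalues i := lt_of_le_of_ne (hpsd.eigenvalues_nonneg i) (Ne.symm hi)
  refine ⟨hpsd.1.eigenvalues i, hpos, ?_⟩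
  have hev := hpsd.1.mulVec_eigenvectorBasis i
  have hv0 : (⇑(hpsd.1.eigenvectorBasis i) : q → ℂ) ≠ 0 := by
    intro h
    have := hpsd.1.eigenvectorBasis.orthonormal.ne_zero i
    apply this
    ext j
    exact congrFun h j
  refine rank_lt_rank_of_mulVec _ _ (fun v hv => ?_) (⇑(hpsd.1.eigenvectorBasis i)) ?_ ?_
  · simp [Matrix.sub_mulVec, ← Matrix.mulVec_mulVec, hv, Matrix.smul_mulVec]
  · rw [Matrix.sub_mulVec, Matrix.mul_assoc, ← Matrix.mulVec_mulVec, hev, Matrix.smul_mulVec]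
    simp [Matrix.mulVec_smul]
  · intro h0
    rw [← Matrix.mulVec_mulVec, h0, Matrix.mulVec_zero] at hev
    rcases smul_eq_zero.1 hev.symm with h | h
    · exact hpos.ne' h
    · exact hv0 h

/-- The compression of `z` to the range of `e` has an eigenvalue `a` over `ℂ`, and subtracting it
kills an eigenvector. For `e` of minimal rank in an algebra this forces `e * z * e = a • e`. -/
theorem exists_rank_lt_of_idempotent [Fintype p] (e z : Matrix p p ℂ) (he : e * e = e) (h0 : e ≠ 0) :
    ∃ a : ℂ, (e * z * e - a • e).rank < e.rank := by
  classical
  let W := LinearMap.range e.mulVecLin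
  have hW : ∀ v ∈ W, e *ᵥ v = v := by
    rintro _ ⟨u, rfl⟩
    simp [Matrix.mulVec_mulVec, he]
  have hmaps : ∀ v ∈ W, (e * z * e).mulVecLin v ∈ W := by
    intro v _
    refine ⟨(z * e) *ᵥ v, ?_⟩
    simp [Matrix.mul_assoc]
  have hnt : Nontrivial W := by
    rw [Submodule.nontrivial_iff_ne_bot]
    intro hbot
    apply h0
    have : e.mulVecLin = 0 := LinearMap.range_eq_bot.1 hbot
    ext i j
    have := congrFun (LinearMap.congr_fun this (Pi.single j 1)) i
    simpa using this
  obtain ⟨a, ha⟩ := Module.End.exists_eigenvalue (((e * z * e).mulVecLin).restrict hmaps)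
  obtain ⟨w, hw⟩ := ha.exists_hasEigenvector
  have hw1 := congrArg Subtype.val hw.apply_eq_smul
  have hw2 : (w : p → ℂ) ≠ 0 := fun h => hw.2 (Subtype.ext h)
  refine ⟨a, rank_lt_rank_of_mulVec _ _ (fun v hv => ?_) w ?_ ?_⟩
  · simp [Matrix.sub_mulVec, ← Matrix.mulVec_mulVec, hv, Matrix.smul_mulVec]
  · rw [Matrix.sub_mulVec, Matrix.smul_mulVec, hW _ w.2]
    have : (e * z * e) *ᵥ (w : p → ℂ) = a • (w : p → ℂ) := by simpa [Matrix.mul_assoc] using hw1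
    rw [this, sub_self]
  · rw [hW _ w.2]; exact hw2

end MinimalRank

/-! ### Unitary representations of finite groups and their characters -/

section PartialIsometry

variable {p q : Type*} [Fintype p] [Fintype q] [DecidableEq p] [DecidableEq q]

theorem mul_eq_self_of_conjTranspose_mul {T : Matrix p q ℂ} {e : Matrix q q ℂ} (he : eᴴ = e)
    (hee : e * e = e) (h : Tᴴ * T = e) : T * e = T := by
  have : (T - T * e)ᴴ * (T - T * e) = 0 := by
    simp only [Matrix.conjTranspose_sub, Matrix.conjTranspose_mul, he, Matrix.sub_mul,
      Matrix.mul_sub]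
    rw [← Matrix.mul_assoc, h, Matrix.mul_assoc e, h, ← Matrix.mul_assoc (e * Tᴴ), 
      Matrix.mul_assoc e, h]
    simp [hee]
  exact (sub_eq_zero.1 (Matrix.conjTranspose_mul_self_eq_zero.1 this)).symm

theorem mul_eq_self_of_mul_conjTranspose {T : Matrix p q ℂ} {f : Matrix p p ℂ} (hf : fᴴ = f)
    (hff : f * f = f) (h : T * Tᴴ = f) : f * T = T := by
  have := mul_eq_self_of_conjTranspose_mul (T := Tᴴ) hf hff (by simpa using h)
  simpa [hf] using congrArg Matrix.conjTranspose this

variable {G : Type*} [Group G]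

/-- A nonzero intertwiner between the subrepresentations cut out by `e` and `f`. -/
theorem exists_intertwiner_ne_zero [Finite G] (ρ : G →* Matrix.unitaryGroup p ℂ)
    (σ : G →* Matrix.unitaryGroup q ℂ) (f : Matrix p p ℂ) (e : Matrix q q ℂ)
    (he : eᴴ = e) (hee : e * e = e)
    (hfρ : ∀ g, f * (ρ g).val = (ρ g).val * f) (heσ : ∀ g, e * (σ g).val = (σ g).val * e)
    (htr : ∀ g, (f * (ρ g).val).trace = (e * (σ g).val).trace) (h0 : e ≠ 0) :
    ∃ X : Matrix p q ℂ, X ≠ 0 ∧ (∃ X' : Matrix p q ℂ, X = f * X' * e) ∧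
      ∀ g, (ρ g).val * X = X * (σ g).val := by
  classical
  have := Fintype.ofFinite G
  -- Averaging over the group turns any matrix into an intertwiner.
  let avg : Matrix p q ℂ → Matrix p q ℂ := fun X => ∑ g, (ρ g).val * X * ((σ g).val)ᴴ
  have havg : ∀ X g, (ρ g).val * avg X = avg X * (σ g).val := by
    intro X g
    simp only [avg, Matrix.mul_sum, Matrix.sum_mul]
    refine (Fintype.sum_equiv (Equiv.mulLeft g) _ _ fun h => ?_)
    have hg : ((σ g).val)ᴴ * (σ g).val = 1 := Matrix.mem_unitaryGroup_iff'.1 (σ g).2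
    simp only [Equiv.coe_mulLeft, map_mul, Submonoid.coe_mul, Matrix.conjTranspose_mul,
      Matrix.mul_assoc, hg, Matrix.mul_one]
  by_contra! hcon
  have hz : ∀ X, f * avg X * e = 0 := by
    intro X
    by_contra hX
    obtain ⟨g, hg⟩ := hcon _ hX ⟨avg X, rfl⟩
    apply hg
    rw [← Matrix.mul_assoc, ← Matrix.mul_assoc, ← hfρ, Matrix.mul_assoc f, havg, Matrix.mul_assoc,
      Matrix.mul_assoc, ← heσ]
    simp only [Matrix.mul_assoc]
  -- Testing on the matrix unit at `(i, j)` and reading off the same entry leaves products of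
  -- diagonal entries; their sum over `i` and `j` is the inner product of the two characters.
  have hentry : ∀ i j, ∑ g, (f * (ρ g).val) i i * ((σ g).valᴴ * e) j j = 0 := by
    intro i j
    have h1 := congrFun (congrFun (hz (Matrix.single i j (1 : ℂ))) i) j
    have h2 : f * avg (Matrix.single i j (1 : ℂ)) * e
        = ∑ g, (f * (ρ g).val) * Matrix.single i j (1 : ℂ) * ((σ g).valᴴ * e) := by
      simp only [avg, Matrix.mul_sum, Matrix.sum_mul, Matrix.mul_assoc]
    rw [h2, Matrix.sum_apply] at h1
    simpa [Matrix.mul_apply, Matrix.single_apply, Finset.sum_mul, ite_and] using h1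
  have hsum : ∑ g, (f * (ρ g).val).trace * star (e * (σ g).val).trace = 0 := by
    have : ∀ g, star (e * (σ g).val).trace = ((σ g).valᴴ * e).trace := by
      intro g
      rw [← Matrix.trace_conjTranspose, Matrix.conjTranspose_mul, he]
    simp only [this]
    simp only [Matrix.trace, Matrix.diag_apply, Finset.sum_mul_sum]
    rw [Finset.sum_comm]
    refine Finset.sum_eq_zero fun i _ => ?_
    rw [Finset.sum_comm]
    exact Finset.sum_eq_zero fun j _ => hentry i j
  -- As the characters agree, the inner product is a sum of squared moduli; its term at the identity
  -- is that of the trace of `e`.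
  have hnn : ∀ g, (f * (ρ g).val).trace * star (e * (σ g).val).trace
      = ((Complex.normSq (e * (σ g).val).trace : ℝ) : ℂ) := by
    intro g
    rw [htr, Complex.star_def, Complex.mul_conj]
  simp only [hnn] at hsum
  rw [← Complex.ofReal_sum, Complex.ofReal_eq_zero,
    Finset.sum_eq_zero_iff_of_nonneg (fun _ _ => Complex.normSq_nonneg _)] at hsum
  have h1 := hsum 1 (Finset.mem_univ _)
  rw [Complex.normSq_eq_zero] at h1
  apply h0
  have h3 : (eᴴ * e).trace = 0 := by
    rw [he, hee]; simpa using h1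
  exact Matrix.trace_conjTranspose_mul_self_eq_zero_iff.1 h3

/-- Unitary representations of a finite group are determined by their characters: here for the
subrepresentations cut out by commuting projections `f` and `e`. -/
theorem exists_partialIsometry [Finite G] (ρ : G →* Matrix.unitaryGroup p ℂ)
    (σ : G →* Matrix.unitaryGroup q ℂ) (f : Matrix p p ℂ) (e : Matrix q q ℂ)
    (hf : fᴴ = f) (hff : f * f = f) (he : eᴴ = e) (hee : e * e = e)
    (hfρ : ∀ g, f * (ρ g).val = (ρ g).val * f) (heσ : ∀ g, e * (σ g).val = (σ g).val * e)
    (htr : ∀ g, (f * (ρ g).val).trace = (e * (σ g).val).trace) :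
    ∃ T : Matrix p q ℂ, Tᴴ * T = e ∧ T * Tᴴ = f ∧ ∀ g, (ρ g).val * T = T * (σ g).val := by
  classical
  induction hn : e.rank using Nat.strong_induction_on generalizing e f with
  | _ n ih =>
  by_cases h0 : e = 0
  · subst h0
    have h1 := htr 1
    have h2 : (fᴴ * f).trace = 0 := by rw [hf, hff]; simpa using h1
    have h3 := Matrix.trace_conjTranspose_mul_self_eq_zero_iff.1 h2
    subst h3
    exact ⟨0, by simp⟩
  -- an intertwiner of minimal rank
  let 𝒮 : Set (Matrix p q ℂ) := {X | X ≠ 0 ∧ f * X = X ∧ X * e = X ∧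
      ∀ g, (ρ g).val * X = X * (σ g).val}
  have hne : 𝒮.Nonempty := by
    obtain ⟨X, hX0, ⟨X', rfl⟩, hX⟩ := exists_intertwiner_ne_zero ρ σ f e he hee hfρ heσ htr h0
    refine ⟨_, hX0, ?_, ?_, hX⟩
    · rw [← Matrix.mul_assoc, ← Matrix.mul_assoc, hff]
    · rw [Matrix.mul_assoc, hee]
  obtain ⟨X, hXmem, hXmin⟩ :=
    WellFounded.has_min (InvImage.wf (fun X : Matrix p q ℂ => X.rank) wellFounded_lt) 𝒮 hne
  obtain ⟨hX0, hfX, hXe, hX⟩ := hXmem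
  obtain ⟨a, ha, hrank⟩ := exists_rank_lt_of_ne_zero X hX0
  have hXadj : ∀ g, (σ g).val * Xᴴ = Xᴴ * (ρ g).val := by
    intro g
    have h1 := congrArg Matrix.conjTranspose (hX g⁻¹)
    simpa [Matrix.star_eq_conjTranspose] using h1.symm
  have hcub : X * Xᴴ * X = (a : ℂ) • X := by
    by_contra hne'
    refine hXmin _ ⟨sub_ne_zero.2 hne', ?_, ?_, fun g => ?_⟩ hrank
    · rw [Matrix.mul_sub, ← Matrix.mul_assoc, ← Matrix.mul_assoc, hfX, Matrix.mul_smul, hfX]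
    · rw [Matrix.sub_mul, Matrix.mul_assoc, hXe, Matrix.smul_mul, hXe]
    · rw [Matrix.mul_sub, Matrix.sub_mul, Matrix.mul_smul, Matrix.smul_mul, hX,
        ← Matrix.mul_assoc, ← Matrix.mul_assoc, hX, Matrix.mul_assoc X, hXadj, Matrix.mul_assoc,
        Matrix.mul_assoc, hX]
      simp only [Matrix.mul_assoc]
  -- Rescaling by `a^(-1/2)` makes `X` a partial isometry.
  let b : ℝ := (Real.sqrt a)⁻¹
  have hb : b * b * a = 1 := by
    have := Real.mul_self_sqrt ha.le
    have h' : Real.sqrt a ≠ 0 := (Real.sqrt_pos.2 ha).ne'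
    simp only [b]; field_simp; nlinarith
  have hbC : (b : ℂ) * b * a = 1 := by exact_mod_cast hb
  let V : Matrix p q ℂ := (b : ℂ) • X
  have hVH : Vᴴ = (b : ℂ) • Xᴴ := by simp [V, Matrix.conjTranspose_smul]
  have hV3 : V * Vᴴ * V = V := by
    rw [hVH]
    simp only [V, Matrix.smul_mul, Matrix.mul_smul, hcub, smul_smul]
    rw [hbC, mul_one]
  have hV0 : V ≠ 0 := by
    intro h
    have hb0 : (b : ℂ) ≠ 0 := by rintro h; simp [h] at hbC
    exact hX0 ((smul_eq_zero.1 h).resolve_left hb0)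
  have hfV : f * V = V := by simp [V, hfX]
  have hVe : V * e = V := by simp [V, hXe]
  have heV : e * Vᴴ = Vᴴ := by simpa [he] using congrArg Matrix.conjTranspose hVe
  have hVf : Vᴴ * f = Vᴴ := by simpa [hf] using congrArg Matrix.conjTranspose hfV
  have hV : ∀ g, (ρ g).val * V = V * (σ g).val := fun g => by simp [V, hX]
  have hVadj : ∀ g, (σ g).val * Vᴴ = Vᴴ * (ρ g).val := fun g => by rw [hVH]; simp [hXadj]
  have hVV3 : Vᴴ * (V * Vᴴ) = Vᴴ := by simpa using congrArg Matrix.conjTranspose hV3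
  have hV3' : V * (Vᴴ * V) = V := by rw [← Matrix.mul_assoc, hV3]
  -- The initial and final projections of `V` are split off. The remaining projections still commute
  -- with the representations and have equal characters, and `e'` has smaller rank than `e`. The
  -- partial isometry given by induction is orthogonal to `V` on both sides.
  set e' := e - Vᴴ * V with he'
  set f' := f - V * Vᴴ with hf'
  have he'H : e'ᴴ = e' := by simp [he', he]
  have hf'H : f'ᴴ = f' := by simp [hf', hf]
  have he'e' : e' * e' = e' := by
    simp only [he', Matrix.sub_mul, Matrix.mul_sub, hee]
    rw [← Matrix.mul_assoc e, heV, Matrix.mul_assoc, hVe, Matrix.mul_assoc, hV3']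
    simp
  have hf'f' : f' * f' = f' := by
    simp only [hf', Matrix.sub_mul, Matrix.mul_sub, hff]
    rw [← Matrix.mul_assoc f, hfV, Matrix.mul_assoc, hVf, Matrix.mul_assoc, hVV3]
    simp
  obtain ⟨T, hT1, hT2, hT3⟩ := ih e'.rank (by
      rw [← hn]
      obtain ⟨w, hw⟩ : ∃ w, V *ᵥ w ≠ 0 := by
        by_contra! hall
        refine hV0 (Matrix.ext fun i j => ?_)
        simpa using congrFun (hall (Pi.single j 1)) i
      refine rank_lt_rank_of_mulVec _ _ (fun v hv => ?_) ((Vᴴ * V) *ᵥ w) ?_ ?_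
      · rw [he', Matrix.sub_mulVec, hv, ← hVe, ← Matrix.mul_assoc, ← Matrix.mulVec_mulVec, hv]
        simp
      · rw [he', Matrix.mulVec_mulVec, Matrix.sub_mul, ← Matrix.mul_assoc, heV, Matrix.mul_assoc,
          hV3']
        simp
      · intro h
        rw [Matrix.mulVec_mulVec, ← Matrix.mul_assoc, heV] at h
        apply hw
        rw [← hV3', ← Matrix.mulVec_mulVec, h, Matrix.mulVec_zero]) f' e' hf'H hf'f' he'H he'e'
    (fun g => by
      rw [hf', Matrix.sub_mul, Matrix.mul_sub, hfρ, Matrix.mul_assoc, ← hVadj,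
        ← Matrix.mul_assoc, ← hV, Matrix.mul_assoc])
    (fun g => by
      rw [he', Matrix.sub_mul, Matrix.mul_sub, heσ, Matrix.mul_assoc, ← hV,
        ← Matrix.mul_assoc, ← hVadj, Matrix.mul_assoc])
    (fun g => by
      rw [he', hf', Matrix.sub_mul, Matrix.sub_mul, Matrix.trace_sub, Matrix.trace_sub, htr,
        Matrix.mul_assoc V, ← hVadj, Matrix.trace_mul_comm V, Matrix.mul_assoc,
        Matrix.trace_mul_comm (σ g).val]) rfl
  have hTe : T * e' = T := mul_eq_self_of_conjTranspose_mul he'H he'e' hT1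
  have hfT : f' * T = T := mul_eq_self_of_mul_conjTranspose hf'H hf'f' hT2
  have hTVa : T * Vᴴ = 0 := by
    rw [← hTe, Matrix.mul_assoc, he', Matrix.sub_mul, heV, Matrix.mul_assoc, hVV3]
    simp
  have hVT : Vᴴ * T = 0 := by
    rw [← hfT, ← Matrix.mul_assoc, hf', Matrix.mul_sub, hVf, hVV3]
    simp
  have hVTa : V * Tᴴ = 0 := by simpa using congrArg Matrix.conjTranspose hTVa
  have hTV : Tᴴ * V = 0 := by simpa using congrArg Matrix.conjTranspose hVT
  refine ⟨T + V, ?_, ?_, fun g => ?_⟩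
  · simp [Matrix.add_mul, Matrix.mul_add, hT1, hTV, hVT, he']
  · simp [Matrix.add_mul, Matrix.mul_add, hT2, hTVa, hVTa, hf']
  · rw [Matrix.mul_add, Matrix.add_mul, hT3, hV]

/-- Unitary representations of a finite group with the same character are unitarily equivalent. -/
theorem exists_unitary_intertwiner [Finite G] (ρ : G →* Matrix.unitaryGroup p ℂ)
    (σ : G →* Matrix.unitaryGroup q ℂ) (htr : ∀ g, (ρ g).val.trace = (σ g).val.trace) :
    ∃ T : Matrix p q ℂ, Tᴴ * T = 1 ∧ T * Tᴴ = 1 ∧ ∀ g, (ρ g).val * T = T * (σ g).val :=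
  exists_partialIsometry ρ σ 1 1 (by simp) (by simp) (by simp) (by simp) (by simp) (by simp)
    (by simpa using htr)

end PartialIsometry

end QCA

namespace QCA

/-! ### The normalized trace -/

section Trace

variable {r m : Type*} [Fintype r] [DecidableEq r] [Fintype m] [DecidableEq m]

/-- The normalized trace. -/
noncomputable def ntr (A : Matrix m m ℂ) : ℂ := A.trace / Fintype.card m

theorem ntr_mul_comm (A B : Matrix m m ℂ) : ntr (A * B) = ntr (B * A) := by
  rw [ntr, Matrix.trace_mul_comm, ntr]

theorem ntr_one [Nonempty m] : ntr (1 : Matrix m m ℂ) = 1 := by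
  simp [ntr, Matrix.trace_one]

theorem ntr_smul (a : ℂ) (A : Matrix m m ℂ) : ntr (a • A) = a * ntr A := by
  simp [ntr, Matrix.trace_smul, mul_div_assoc]

/-- A linear functional on matrices that vanishes on commutators is a multiple of the trace. -/
theorem tracial_eq [Nonempty r] (t : Matrix r r ℂ →ₗ[ℂ] ℂ) (ht : ∀ X Y, t (X * Y) = t (Y * X))
    (X : Matrix r r ℂ) : t X = ntr X * t 1 := by
  have hoff : ∀ i j, i ≠ j → t (Matrix.single i j 1) = 0 := by
    intro i j hij
    have h1 := ht (Matrix.single i i 1) (Matrix.single i j 1)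
    rw [Matrix.single_mul_single_same, Matrix.single_mul_single_of_ne (h := hij.symm)] at h1
    simpa using h1
  have hdiag : ∀ i j, t (Matrix.single i i 1) = t (Matrix.single j j 1) := by
    intro i j
    have h1 := ht (Matrix.single i j 1) (Matrix.single j i 1)
    simpa using h1
  obtain ⟨i₀⟩ := ‹Nonempty r›
  have hX : ∀ Y : Matrix r r ℂ, t Y = Y.trace * t (Matrix.single i₀ i₀ 1) := by
    intro Y
    conv_lhs => rw [Matrix.matrix_eq_sum_single Y]
    simp only [map_sum]
    rw [Matrix.trace, Finset.sum_mul]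
    refine Finset.sum_congr rfl fun i _ => ?_
    rw [Finset.sum_eq_single i]
    · rw [← hdiag i i₀, show Matrix.single i i (Y i i) = Y i i • Matrix.single i i (1 : ℂ) by
        simp, map_smul]
      simp
    · intro j _ hj
      rw [show Matrix.single i j (Y i j) = Y i j • Matrix.single i j (1 : ℂ) by simp, map_smul,
        hoff i j hj.symm, smul_zero]
    · simp
  rw [hX X, hX 1, Matrix.trace_one, ntr]
  have : (Fintype.card r : ℂ) ≠ 0 := by
    have : 0 < Fintype.card r := Fintype.card_pos_iff.2 ⟨i₀⟩
    exact_mod_cast this.ne'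
  field_simp

theorem nonempty_of_starAlgHom [Nonempty m] (φ : Matrix r r ℂ →⋆ₐ[ℂ] Matrix m m ℂ) :
    Nonempty r := by
  by_contra h
  rw [not_nonempty_iff] at h
  have h1 : φ 1 = φ 0 := congrArg φ (Subsingleton.elim _ _)
  rw [map_one, map_zero] at h1
  exact one_ne_zero h1

theorem starAlgHom_injective [Nonempty m] (φ : Matrix r r ℂ →⋆ₐ[ℂ] Matrix m m ℂ) :
    Function.Injective φ := by
  have := nonempty_of_starAlgHom φ
  exact RingHom.injective (φ : Matrix r r ℂ →+* Matrix m m ℂ)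

/-- For `K` in the commutant, `X ↦ ntr (φ X * K)` vanishes on commutators and is therefore a
multiple of the trace. This is the multiplicativity of normalized characters over commuting factors.
-/
theorem ntr_map_mul_of_commute [Nonempty m] (φ : Matrix r r ℂ →⋆ₐ[ℂ] Matrix m m ℂ)
    (K : Matrix m m ℂ) (hK : ∀ X, φ X * K = K * φ X) (X : Matrix r r ℂ) :
    ntr (φ X * K) = ntr X * ntr K := by
  have := nonempty_of_starAlgHom φ
  let t : Matrix r r ℂ →ₗ[ℂ] ℂ :=
    { toFun := fun X => ntr (φ X * K)
      map_add' := fun X Y => by simp [ntr, add_mul, add_div]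
      map_smul' := fun a X => by simp [ntr, mul_div_assoc] }
  have ht : ∀ X Y, t (X * Y) = t (Y * X) := by
    intro X Y
    change ntr (φ (X * Y) * K) = ntr (φ (Y * X) * K)
    rw [map_mul, map_mul, mul_assoc, hK, ← mul_assoc, ntr_mul_comm, mul_assoc]
  have h1 := tracial_eq t ht X
  change ntr (φ X * K) = ntr X * ntr (φ 1 * K) at h1
  rwa [map_one, one_mul] at h1

theorem ntr_map [Nonempty m] (φ : Matrix r r ℂ →⋆ₐ[ℂ] Matrix m m ℂ) (X : Matrix r r ℂ) :
    ntr (φ X) = ntr X := by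
  simpa [ntr_one] using ntr_map_mul_of_commute φ 1 (by simp) X

end Trace

/-! ### Representations of full matrix algebras -/

section Homs

variable {p q m : Type*} [Fintype p] [DecidableEq p] [Fintype q] [DecidableEq q]
  [Fintype m] [DecidableEq m]

theorem kronecker_induction {P : Matrix (p × q) (p × q) ℂ → Prop}
    (hadd : ∀ X Y, P X → P Y → P (X + Y)) (hk : ∀ X Y, P (X ⊗ₖ Y)) (X) : P X := by
  obtain ⟨t, rfl⟩ := (kroneckerLinearEquiv p p q q ℂ).surjective X
  induction t using TensorProduct.induction_on with
  | zero => simpa using hk 0 0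
  | tmul x y => simpa using hk x y
  | add x y hx hy => simpa using hadd _ _ hx hy

theorem exists_kroneckerLift (φ : Matrix p p ℂ →⋆ₐ[ℂ] Matrix m m ℂ)
    (ψ : Matrix q q ℂ →⋆ₐ[ℂ] Matrix m m ℂ) (h : ∀ X Y, φ X * ψ Y = ψ Y * φ X) :
    ∃ Φ : Matrix (p × q) (p × q) ℂ →⋆ₐ[ℂ] Matrix m m ℂ, ∀ X Y, Φ (X ⊗ₖ Y) = φ X * ψ Y := by
  let Φ₀ : Matrix (p × q) (p × q) ℂ →ₐ[ℂ] Matrix m m ℂ :=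
    (Algebra.TensorProduct.lift φ.toAlgHom ψ.toAlgHom h).comp
      (Matrix.kroneckerAlgEquiv p q ℂ).symm.toAlgHom
  have hΦ : ∀ X Y, Φ₀ (X ⊗ₖ Y) = φ X * ψ Y := by
    intro X Y
    have : (Matrix.kroneckerAlgEquiv p q ℂ).symm (X ⊗ₖ Y) = X ⊗ₜ[ℂ] Y := by
      rw [AlgEquiv.symm_apply_eq]; simp
    change Algebra.TensorProduct.lift φ.toAlgHom ψ.toAlgHom h
      ((Matrix.kroneckerAlgEquiv p q ℂ).symm (X ⊗ₖ Y)) = _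
    rw [this]
    exact Algebra.TensorProduct.lift_tmul _ _ _ _ _
  refine ⟨{ Φ₀ with map_star' := fun X => ?_ }, hΦ⟩
  change Φ₀ (star X) = star (Φ₀ X)
  induction X using kronecker_induction with
  | hadd X Y hX hY => simp only [star_add, map_add, hX, hY]
  | hk X Y =>
    rw [Matrix.star_eq_conjTranspose, Matrix.conjTranspose_kronecker, hΦ, hΦ,
      ← Matrix.star_eq_conjTranspose, ← Matrix.star_eq_conjTranspose, map_star, map_star,
      star_mul, ← map_star, ← map_star, h]

/-- With `ι` an embedding of operators on part of the chain, this restricts a homomorphism to the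
algebra in which it takes its values. -/
theorem exists_starAlgHom_lift {A B C : Type*} [Ring A] [StarRing A] [Algebra ℂ A] [Ring B]
    [StarRing B] [Algebra ℂ B] [StarModule ℂ B] [Ring C] [StarRing C]
    [Algebra ℂ C] (ι : A →⋆ₐ[ℂ] B) (hι : Function.Injective ι) (β : C →⋆ₐ[ℂ] B)
    (h : ∀ x, ∃ y, ι y = β x) : ∃ β' : C →⋆ₐ[ℂ] A, ∀ x, ι (β' x) = β x := by
  choose f hf using h
  refine ⟨{
    toFun := f
    map_one' := hι ?_
    map_mul' := fun x y => hι ?_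
    map_zero' := hι ?_
    map_add' := fun x y => hι ?_
    commutes' := fun a => hι ?_
    map_star' := fun x => hι ?_ }, hf⟩
  · rw [hf]; simp
  · rw [hf]; simp [hf]
  · rw [hf]; simp
  · rw [hf]; simp [hf]
  · rw [hf, AlgHomClass.commutes, AlgHomClass.commutes]
  · rw [hf]; simp [map_star, hf]

/-- Two representations of a full matrix algebra on the same space are unitarily equivalent. -/
theorem exists_unitary_conj (Φ Ψ : Matrix q q ℂ →⋆ₐ[ℂ] Matrix m m ℂ) :
    ∃ Y : Matrix m m ℂ, Yᴴ * Y = 1 ∧ Y * Yᴴ = 1 ∧ ∀ X, Y * Φ X = Ψ X * Y := by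
  rcases isEmpty_or_nonempty m with hm | hm
  · exact ⟨1, by simp, by simp, fun X => Subsingleton.elim _ _⟩
  obtain ⟨i₀⟩ := nonempty_of_starAlgHom Φ
  have hstar : ∀ (Ω : Matrix q q ℂ →⋆ₐ[ℂ] Matrix m m ℂ) i j,
      (Ω (Matrix.single i j 1))ᴴ = Ω (Matrix.single j i 1) := by
    intro Ω i j
    rw [← Matrix.star_eq_conjTranspose, ← map_star, Matrix.star_eq_conjTranspose,
      Matrix.conjTranspose_single, star_one]
  have hmul : ∀ (Ω : Matrix q q ℂ →⋆ₐ[ℂ] Matrix m m ℂ) i j k,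
      Ω (Matrix.single i j 1) * Ω (Matrix.single j k 1) = Ω (Matrix.single i k 1) := by
    intro Ω i j k
    rw [← map_mul, Matrix.single_mul_single_same, one_mul]
  have hmul0 : ∀ (Ω : Matrix q q ℂ →⋆ₐ[ℂ] Matrix m m ℂ) i j k l, j ≠ k →
      Ω (Matrix.single i j 1) * Ω (Matrix.single k l 1) = 0 := by
    intro Ω i j k l hjk
    rw [← map_mul, Matrix.single_mul_single_of_ne (h := hjk), map_zero]
  have hsum : ∀ (Ω : Matrix q q ℂ →⋆ₐ[ℂ] Matrix m m ℂ), ∑ i, Ω (Matrix.single i i 1) = 1 := by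
    intro Ω
    rw [← map_sum, Matrix.sum_single_one, map_one]
  have htr : (Ψ (Matrix.single i₀ i₀ 1)).trace = (Φ (Matrix.single i₀ i₀ 1)).trace := by
    have h1 := (ntr_map Ψ (Matrix.single i₀ i₀ 1)).trans (ntr_map Φ (Matrix.single i₀ i₀ 1)).symm
    have : (Fintype.card m : ℂ) ≠ 0 := by exact_mod_cast Fintype.card_ne_zero
    exact (div_left_inj' this).1 h1
  -- For the trivial group the statement says that projections of equal trace are equivalent.
  obtain ⟨T, hT1, hT2, -⟩ := exists_partialIsometry (G := Unit) (1 : Unit →* Matrix.unitaryGroup m ℂ)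
    (1 : Unit →* Matrix.unitaryGroup m ℂ) (Ψ (Matrix.single i₀ i₀ 1)) (Φ (Matrix.single i₀ i₀ 1))
    (hstar _ _ _) (hmul _ _ _ _) (hstar _ _ _) (hmul _ _ _ _) (by simp) (by simp)
    (by simpa using htr)
  have hTe : T * Φ (Matrix.single i₀ i₀ 1) = T :=
    mul_eq_self_of_conjTranspose_mul (hstar _ _ _) (hmul _ _ _ _) hT1
  have hfT : Ψ (Matrix.single i₀ i₀ 1) * T = T :=
    mul_eq_self_of_mul_conjTranspose (hstar _ _ _) (hmul _ _ _ _) hT2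
  -- The partial isometry between two corner projections is transported to all diagonal corners by
  -- the matrix units.
  let Y : Matrix m m ℂ := ∑ i, Ψ (Matrix.single i i₀ 1) * T * Φ (Matrix.single i₀ i 1)
  have hYH : Yᴴ = ∑ i, Φ (Matrix.single i i₀ 1) * Tᴴ * Ψ (Matrix.single i₀ i 1) := by
    simp only [Y, Matrix.conjTranspose_sum, Matrix.conjTranspose_mul, hstar, Matrix.mul_assoc]
  have hYΦ : ∀ k l, Y * Φ (Matrix.single k l 1)
      = Ψ (Matrix.single k i₀ 1) * T * Φ (Matrix.single i₀ l 1) := by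
    intro k l
    rw [Finset.sum_mul, Finset.sum_eq_single k]
    · rw [mul_assoc, hmul]
    · intro i _ hi
      rw [mul_assoc, hmul0 _ _ _ _ _ hi, mul_zero]
    · simp
  have hΨY : ∀ k l, Ψ (Matrix.single k l 1) * Y
      = Ψ (Matrix.single k i₀ 1) * T * Φ (Matrix.single i₀ l 1) := by
    intro k l
    rw [Finset.mul_sum, Finset.sum_eq_single l]
    · rw [← mul_assoc, ← mul_assoc, hmul]
    · intro i _ hi
      rw [← mul_assoc, ← mul_assoc, hmul0 _ _ _ _ _ hi.symm, zero_mul, zero_mul]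
    · simp
  have h1 : Yᴴ * Y = 1 := by
    rw [hYH, Finset.sum_mul, ← hsum Φ]
    refine Finset.sum_congr rfl fun i _ => ?_
    rw [mul_assoc, hΨY, ← mul_assoc, ← mul_assoc, mul_assoc (Φ _), mul_assoc (Φ _), mul_assoc Tᴴ,
      hfT, hT1, hmul, hmul]
  refine ⟨Y, h1, mul_eq_one_comm.1 h1, fun X => ?_⟩
  rw [Matrix.matrix_eq_sum_single X]
  simp only [map_sum, Finset.sum_mul, Finset.mul_sum]
  refine Finset.sum_congr rfl fun i _ => Finset.sum_congr rfl fun j _ => ?_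
  rw [show Matrix.single i j (X i j) = X i j • Matrix.single i j (1 : ℂ) by simp, map_smul,
    map_smul, mul_smul_comm, smul_mul_assoc, hYΦ, hΨY]

end Homs

/-! ### Matrix `*`-algebras with trivial centre -/

section Classification

variable {m : Type*} [Fintype m] [DecidableEq m]

/-- A nonzero projection `p` of the algebra that is minimal in the sense that `p 𝓑 p = ℂ p`. -/
theorem exists_minimal_projection [Nonempty m] (𝓑 : StarSubalgebra ℂ (Matrix m m ℂ)) :
    ∃ p ∈ 𝓑, p ≠ 0 ∧ pᴴ = p ∧ p * p = p ∧ ∀ z ∈ 𝓑, ∃ a : ℂ, p * z * p = a • p := by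
  have hne : {X : Matrix m m ℂ | X ∈ 𝓑 ∧ X ≠ 0}.Nonempty := ⟨1, one_mem 𝓑, one_ne_zero⟩
  obtain ⟨X, ⟨hX, hX0⟩, hmin⟩ :=
    WellFounded.has_min (InvImage.wf (fun X : Matrix m m ℂ => X.rank) wellFounded_lt) _ hne
  obtain ⟨a, ha, hrank⟩ := exists_rank_lt_of_ne_zero X hX0
  have hXs : Xᴴ ∈ 𝓑 := star_mem hX
  have hcub : X * Xᴴ * X = (a : ℂ) • X := by
    by_contra hne'
    exact hmin _ ⟨sub_mem (mul_mem (mul_mem hX hXs) hX) (SMulMemClass.smul_mem _ hX),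
      sub_ne_zero.2 hne'⟩ hrank
  have haC : (a : ℂ) ≠ 0 := by exact_mod_cast ha.ne'
  -- By minimality of the rank of `X`, this multiple of `Xᴴ * X` is a projection; its rank is at
  -- most that of `X`, so it is minimal as well.
  let p : Matrix m m ℂ := (a : ℂ)⁻¹ • (Xᴴ * X)
  have hp : p ∈ 𝓑 := SMulMemClass.smul_mem _ (mul_mem hXs hX)
  have hp0 : p ≠ 0 := by
    intro h
    rcases smul_eq_zero.1 h with h | h
    · exact inv_ne_zero haC h
    · exact hX0 (Matrix.conjTranspose_mul_self_eq_zero.1 h)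
  have hpp : p * p = p := by
    simp only [p, smul_mul_assoc, mul_smul_comm]
    rw [mul_assoc, ← mul_assoc X, hcub, mul_smul_comm, smul_smul (a : ℂ)⁻¹ (a : ℂ),
      inv_mul_cancel₀ haC, one_smul]
  refine ⟨p, hp, hp0, by simp [p, Matrix.conjTranspose_smul], hpp, fun z hz => ?_⟩
  obtain ⟨b, hb⟩ := exists_rank_lt_of_idempotent p z hpp hp0
  refine ⟨b, ?_⟩
  by_contra hne'
  refine hmin _ ⟨sub_mem (mul_mem (mul_mem hp hz) hp) (SMulMemClass.smul_mem _ hp),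
      sub_ne_zero.2 hne'⟩ (lt_of_lt_of_le hb ?_)
  simp only [p]
  calc ((a : ℂ)⁻¹ • (Xᴴ * X)).rank = (((a : ℂ)⁻¹ • Xᴴ) * X).rank := by rw [smul_mul_assoc]
    _ ≤ X.rank := Matrix.rank_mul_le_right _ _

/-- A `*`-algebra of matrices with trivial centre is a full matrix algebra. -/
theorem exists_starAlgHom_range_eq [Nonempty m] (𝓑 : StarSubalgebra ℂ (Matrix m m ℂ))
    (hc : ∀ X ∈ 𝓑, (∀ Y ∈ 𝓑, X * Y = Y * X) → ∃ a : ℂ, X = a • 1) :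
    ∃ (r : ℕ) (φ : Matrix (Fin r) (Fin r) ℂ →⋆ₐ[ℂ] Matrix m m ℂ),
      Set.range φ = (𝓑 : Set (Matrix m m ℂ)) := by
  classical
  obtain ⟨p, hp, hp0, hpH, hpp, hmin⟩ := exists_minimal_projection 𝓑
  -- systems of partial isometries with initial projection `p` and orthogonal ranges
  let Sys : ℕ → Prop := fun r => ∃ v : Fin r → Matrix m m ℂ, (∀ i, v i ∈ 𝓑) ∧
    ∀ i j, (v i)ᴴ * v j = if i = j then p else 0
  -- Applied to one vector that `p` does not kill, the partial isometries of a system give linearly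
  -- independent vectors. A system of maximal size thus exists.
  have hbound : ∀ r, Sys r → r ≤ Fintype.card m := by
    rintro r ⟨v, -, hv⟩
    obtain ⟨w, hw⟩ : ∃ w, p *ᵥ w ≠ 0 := by
      by_contra! hall
      refine hp0 (Matrix.ext fun i j => ?_)
      simpa using congrFun (hall (Pi.single j 1)) i
    have hli : LinearIndependent ℂ (fun i => v i *ᵥ w) := by
      rw [Fintype.linearIndependent_iff]
      intro c hcz i
      have h1 := congrArg (fun x => (v i)ᴴ *ᵥ x) hcz
      simp only [Matrix.mulVec_sum, Matrix.mulVec_smul, Matrix.mulVec_mulVec, hv,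
        Matrix.mulVec_zero] at h1
      rw [Finset.sum_eq_single i] at h1
      · simpa [hw] using h1
      · intro j _ hj
        simp [hj.symm]
      · simp
    simpa using hli.fintype_card_le_finrank
  have hS0 : Sys 0 := ⟨Fin.elim0, fun i => i.elim0, fun i => i.elim0⟩
  let r := Nat.findGreatest Sys (Fintype.card m)
  have hSr : Sys r := Nat.findGreatest_spec (P := Sys) (Nat.zero_le _) hS0
  have hSr1 : ¬ Sys (r + 1) := by
    intro h
    exact absurd (Nat.le_findGreatest (hbound _ h) h) (by simp [r])
  obtain ⟨v, hvB, hv⟩ := hSr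
  have hvp : ∀ i, v i * p = v i := fun i =>
    mul_eq_self_of_conjTranspose_mul hpH hpp (by simpa using hv i i)
  have hvs : ∀ i, (v i)ᴴ ∈ 𝓑 := fun i => star_mem (hvB i)
  -- This is the projection onto the sum of the ranges. Maximality of the system makes it central,
  -- so it equals `1`, and the `v i * (v j)ᴴ` form a complete set of matrix units.
  let Q : Matrix m m ℂ := ∑ i, v i * (v i)ᴴ
  have hQB : Q ∈ 𝓑 := sum_mem fun i _ => mul_mem (hvB i) (hvs i)
  have hQv : ∀ j, Q * v j = v j := by
    intro j
    rw [Finset.sum_mul, Finset.sum_eq_single j]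
    · rw [mul_assoc, hv, if_pos rfl, hvp]
    · intro i _ hi
      rw [mul_assoc, hv, if_neg hi, mul_zero]
    · simp
  have hQH : Qᴴ = Q := by simp [Q, Matrix.conjTranspose_sum]
  have hvQ : ∀ j, (v j)ᴴ * Q = (v j)ᴴ := by
    intro j
    simpa [hQH] using congrArg Matrix.conjTranspose (hQv j)
  -- maximality
  have hmax : ∀ y ∈ 𝓑, Q * (y * p) = y * p := by
    intro y hy
    by_contra hne
    set x := y * p - Q * (y * p) with hx
    have hx0 : x ≠ 0 := fun h => hne (sub_eq_zero.1 h).symm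
    have hxB : x ∈ 𝓑 := sub_mem (mul_mem hy hp) (mul_mem hQB (mul_mem hy hp))
    have hxp : x * p = x := by simp only [hx, sub_mul, mul_assoc, hpp]
    obtain ⟨a, ha⟩ := hmin _ (mul_mem (star_mem hxB) hxB)
    have hpx : p * xᴴ = xᴴ := by simpa [hpH] using congrArg Matrix.conjTranspose hxp
    have hxx : xᴴ * x = a • p := by
      rw [← ha, Matrix.star_eq_conjTranspose, ← mul_assoc p, hpx, mul_assoc, hxp]
    have hapos : 0 < a := by
      have h1 : 0 < (xᴴ * x).trace := by
        refine lt_of_le_of_ne (Matrix.posSemidef_conjTranspose_mul_self x).trace_nonneg ?_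
        intro h
        exact hx0 (Matrix.trace_conjTranspose_mul_self_eq_zero_iff.1 h.symm)
      have h2 : 0 < p.trace := by
        rw [← hpp]; nth_rw 1 [← hpH]
        refine lt_of_le_of_ne (Matrix.posSemidef_conjTranspose_mul_self p).trace_nonneg ?_
        intro h
        exact hp0 (Matrix.trace_conjTranspose_mul_self_eq_zero_iff.1 h.symm)
      rw [hxx, Matrix.trace_smul, smul_eq_mul] at h1
      exact (pos_iff_pos_of_mul_pos h1).2 h2
    obtain ⟨b, hb⟩ : ∃ b : ℝ, (b : ℂ) * b * a = 1 := by
      refine ⟨(Real.sqrt a.re)⁻¹, ?_⟩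
      have hre : 0 < a.re := (Complex.pos_iff.1 hapos).1
      have him : a = (a.re : ℂ) := Complex.ext rfl (by simpa using (Complex.pos_iff.1 hapos).2.symm)
      rw [him]
      have := Real.mul_self_sqrt hre.le
      have h' : Real.sqrt a.re ≠ 0 := (Real.sqrt_pos.2 hre).ne'
      norm_cast
      field_simp
      nlinarith
    have hvx : ∀ i, (v i)ᴴ * x = 0 := by
      intro i
      rw [hx, mul_sub, ← mul_assoc _ Q, hvQ, sub_self]
    have hxv : ∀ i, xᴴ * v i = 0 := by
      intro i
      simpa using congrArg Matrix.conjTranspose (hvx i)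
    apply hSr1
    refine ⟨Fin.cons ((b : ℂ) • x) v, fun i => ?_, fun i j => ?_⟩
    · refine Fin.cases ?_ (fun i => ?_) i
      · exact SMulMemClass.smul_mem _ hxB
      · simpa using hvB i
    · refine Fin.cases ?_ (fun i => ?_) i <;> refine Fin.cases ?_ (fun j => ?_) j
      · rw [if_pos rfl]
        simp only [Fin.cons_zero, Matrix.conjTranspose_smul, Complex.star_def, Complex.conj_ofReal,
          smul_mul_assoc, mul_smul_comm, hxx, smul_smul]
        rw [← mul_assoc, hb, one_smul]
      · simp [Matrix.conjTranspose_smul, hxv, (Fin.succ_ne_zero j).symm]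
      · simp [hvx]
      · simp [hv]
  have hQyv : ∀ y ∈ 𝓑, ∀ i, Q * (y * v i) = y * v i := by
    intro y hy i
    have := hmax _ (mul_mem hy (hvB i))
    rwa [mul_assoc, hvp] at this
  have hQyQ : ∀ y ∈ 𝓑, Q * (y * Q) = y * Q := by
    intro y hy
    simp only [Q, Finset.mul_sum]
    refine Finset.sum_congr rfl fun i _ => ?_
    have := congrArg (· * (v i)ᴴ) (hQyv y hy i)
    simpa only [mul_assoc] using this
  have hcomm : ∀ y ∈ 𝓑, Q * y = y * Q := by
    intro y hy
    have h1 := congrArg Matrix.conjTranspose (hQyQ _ (star_mem hy))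
    simp only [Matrix.conjTranspose_mul, hQH, Matrix.star_eq_conjTranspose,
      Matrix.conjTranspose_conjTranspose] at h1
    rw [← h1, mul_assoc, hQyQ y hy]
  have hQ1 : Q = 1 := by
    obtain ⟨a, ha⟩ := hc Q hQB hcomm
    have h1 := hmax 1 (one_mem _)
    rw [one_mul, ha, smul_mul_assoc, one_mul] at h1
    have : (a - 1) • p = 0 := by rw [sub_smul, one_smul, h1, sub_self]
    rcases smul_eq_zero.1 this with h | h
    · rw [ha, sub_eq_zero.1 h, one_smul]
    · exact absurd h hp0
  let f : Matrix (Fin r) (Fin r) ℂ → Matrix m m ℂ := fun X => ∑ i, ∑ j, X i j • (v i * (v j)ᴴ)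
  have hf1 : f 1 = 1 := by
    rw [← hQ1]
    simp only [f, Q]
    refine Finset.sum_congr rfl fun i _ => ?_
    rw [Finset.sum_eq_single i] <;> simp +contextual [Matrix.one_apply]
    intro j hj hji
    exact absurd hji.symm hj
  have hfmul : ∀ X Y, f (X * Y) = f X * f Y := by
    intro X Y
    simp only [f, Matrix.mul_apply, Finset.sum_smul, Finset.sum_mul]
    simp only [Finset.mul_sum]
    have : ∀ i k l j, X i k • (v i * (v k)ᴴ) * (Y l j • (v l * (v j)ᴴ))
        = if k = l then (X i k * Y k j) • (v i * (v j)ᴴ) else 0 := by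
      intro i k l j
      rw [smul_mul_assoc, mul_smul_comm, smul_smul, mul_assoc, ← mul_assoc _ (v l), hv]
      split_ifs with h
      · subst h
        rw [← mul_assoc, hvp]
      · simp
    simp only [this]
    refine Finset.sum_congr rfl fun i _ => ?_
    rw [Finset.sum_comm]
    refine Finset.sum_congr rfl fun k _ => ?_
    simp
  refine ⟨r, {
    toFun := f
    map_one' := hf1
    map_mul' := hfmul
    map_zero' := by simp [f]
    map_add' := fun X Y => by simp [f, add_smul, Finset.sum_add_distrib]
    commutes' := fun a => ?_
    map_star' := fun X => ?_ }, ?_⟩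
  · have : f (a • 1) = a • f 1 := by
      simp only [f, Finset.smul_sum, Matrix.smul_apply, smul_smul, smul_eq_mul]
    change f (algebraMap ℂ _ a) = _
    rw [Algebra.algebraMap_eq_smul_one, this, hf1, Algebra.algebraMap_eq_smul_one]
  · change f (star X) = star (f X)
    simp only [f, Matrix.star_eq_conjTranspose, Matrix.conjTranspose_sum,
      Matrix.conjTranspose_smul, Matrix.conjTranspose_mul, Matrix.conjTranspose_conjTranspose]
    rw [Finset.sum_comm]
    rfl
  · ext z
    change (∃ X, f X = z) ↔ z ∈ 𝓑
    constructor
    · rintro ⟨X, rfl⟩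
      exact sum_mem fun i _ => sum_mem fun j _ => 
        SMulMemClass.smul_mem _ (mul_mem (hvB i) (hvs j))
    · intro hz
      have hpv : ∀ i, p * (v i)ᴴ = (v i)ᴴ := fun i => by
        simpa [hpH] using congrArg Matrix.conjTranspose (hvp i)
      have hent : ∀ i j, ∃ a : ℂ, (v i)ᴴ * z * v j = a • p := by
        intro i j
        obtain ⟨a, ha⟩ := hmin _ (mul_mem (mul_mem (hvs i) hz) (hvB j))
        refine ⟨a, ?_⟩
        rw [← ha]
        simp only [mul_assoc, hvp]
        rw [← mul_assoc p, hpv]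
      choose X hX using hent
      refine ⟨Matrix.of X, ?_⟩
      have : z = Q * z * Q := by rw [hQ1, one_mul, mul_one]
      rw [this]
      simp only [f, Q, Finset.sum_mul, Matrix.of_apply]
      simp only [Finset.mul_sum]
      refine Finset.sum_congr rfl fun i _ => ?_
      refine Finset.sum_congr rfl fun j _ => ?_
      rw [show v i * (v i)ᴴ * z * (v j * (v j)ᴴ) = v i * ((v i)ᴴ * z * v j) * (v j)ᴴ by
        simp only [mul_assoc], hX, mul_smul_comm, hvp, smul_mul_assoc]

end Classification

end QCA

namespace QCA

/-! ### Matrix algebras with an implemented group action, and their commutants -/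

section FactorRep

variable {G : Type*} [Group G] {m : Type*} [Fintype m] [DecidableEq m]

theorem exists_circle_hom (c : G → ℂ) (hmul : ∀ g h, c (g * h) = c g * c h)
    (hnorm : ∀ g, ‖c g‖ = 1) : ∃ u : G →* Circle, ∀ g, (u g : ℂ) = c g := by
  let f : G → Circle := fun g => ⟨c g, mem_sphere_zero_iff_norm.2 (hnorm g)⟩
  exact ⟨MonoidHom.mk' f fun g h => Circle.ext (hmul g h), fun g => rfl⟩

theorem norm_eq_one_of_smul_unitary [Nonempty m] {c : ℂ} {A B : Matrix m m ℂ} (hA : Aᴴ * A = 1)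
    (hB : Bᴴ * B = 1) (h : A = c • B) : ‖c‖ = 1 := by
  subst h
  rw [Matrix.conjTranspose_smul, smul_mul_assoc, mul_smul_comm, hB, smul_smul] at hA
  have h1 := congrArg ntr hA
  rw [ntr_smul, ntr_one, mul_one, Complex.star_def, Complex.conj_mul'] at h1
  have h2 : ‖c‖ ^ 2 = 1 := by exact_mod_cast h1
  nlinarith [norm_nonneg c]

theorem exists_rep_of_mem_range [Nonempty m] {r : Type*} [Fintype r] [DecidableEq r]
    (ψ : Matrix r r ℂ →⋆ₐ[ℂ] Matrix m m ℂ) (K : G → Matrix m m ℂ)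
    (hK : ∀ g, K g ∈ Set.range ψ) (hu : ∀ g, (K g)ᴴ * K g = 1)
    (hmul : ∀ g h, K (g * h) = K g * K h) :
    ∃ ρ : G →* Matrix.unitaryGroup r ℂ, ∀ g, K g = ψ (ρ g).val := by
  have hinj := starAlgHom_injective ψ
  choose f hf using hK
  refine ⟨MonoidHom.mk' (fun g => ⟨f g, Matrix.mem_unitaryGroup_iff'.2 (hinj ?_)⟩)
    fun g h => Subtype.ext (hinj ?_), fun g => (hf g).symm⟩
  · rw [map_mul, map_star, hf, map_one, Matrix.star_eq_conjTranspose, hu]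
  · simp only [Submonoid.coe_mul, map_mul, hf, hmul]

/-- The set `𝓑` of operators is a full matrix algebra `M_r(ℂ)`, on which conjugation with the
operators `V g` is implemented by the unitary representation `R` of `G` in `𝓑`. -/
def FactorRep (V : G → Matrix m m ℂ) (𝓑 : Set (Matrix m m ℂ)) (r : ℕ)
    (R : G → Matrix m m ℂ) : Prop :=
  ∃ (φ : Matrix (Fin r) (Fin r) ℂ →⋆ₐ[ℂ] Matrix m m ℂ)
    (ρ : G →* Matrix.unitaryGroup (Fin r) ℂ), Set.range φ = 𝓑 ∧ (∀ g, R g = φ (ρ g).val) ∧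
    ∀ g, ∀ X ∈ 𝓑, V g * X * (V g)ᴴ = R g * X * (R g)ᴴ

namespace FactorRep

variable {V : G → Matrix m m ℂ} {𝓑 : Set (Matrix m m ℂ)} {r : ℕ} {R : G → Matrix m m ℂ}

theorem mem (h : FactorRep V 𝓑 r R) (g : G) : R g ∈ 𝓑 := by
  obtain ⟨φ, ρ, hφ, hR, -⟩ := h
  rw [hR, ← hφ]; exact ⟨_, rfl⟩

theorem unitary (h : FactorRep V 𝓑 r R) (g : G) : (R g)ᴴ * R g = 1 := by
  obtain ⟨φ, ρ, hφ, hR, -⟩ := h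
  rw [hR, ← Matrix.star_eq_conjTranspose, ← map_star, ← map_mul,
    Matrix.mem_unitaryGroup_iff'.1 (ρ g).2, map_one]

theorem unitary' (h : FactorRep V 𝓑 r R) (g : G) : R g * (R g)ᴴ = 1 :=
  mul_eq_one_comm.1 (h.unitary g)

theorem map_mul (h : FactorRep V 𝓑 r R) (g k : G) : R (g * k) = R g * R k := by
  obtain ⟨φ, ρ, hφ, hR, -⟩ := h
  rw [hR, hR, hR, ← _root_.map_mul]; simp

theorem conj_mem (h : FactorRep V 𝓑 r R) (g : G) {X : Matrix m m ℂ} (hX : X ∈ 𝓑) :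
    R g * X * (R g)ᴴ ∈ 𝓑 ∧ (R g)ᴴ * X * R g ∈ 𝓑 := by
  obtain ⟨φ, ρ, hφ, hR, -⟩ := h
  rw [← hφ] at hX ⊢
  obtain ⟨x, rfl⟩ := hX
  rw [hR, ← Matrix.star_eq_conjTranspose, ← map_star]
  exact ⟨⟨(ρ g).val * x * star (ρ g).val, by rw [_root_.map_mul, _root_.map_mul]⟩,
    ⟨star (ρ g).val * x * (ρ g).val, by rw [_root_.map_mul, _root_.map_mul]⟩⟩

theorem rank_pos [Nonempty m] (h : FactorRep V 𝓑 r R) : 0 < r := by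
  obtain ⟨φ, -⟩ := h
  exact Fin.pos_iff_nonempty.2 (nonempty_of_starAlgHom φ)

theorem finrank_eq [Nonempty m] {k k' : Type*} [Fintype k] [DecidableEq k] [Fintype k']
    [DecidableEq k'] (φ : Matrix k k ℂ →⋆ₐ[ℂ] Matrix m m ℂ)
    (φ' : Matrix k' k' ℂ →⋆ₐ[ℂ] Matrix m m ℂ) (h : Set.range φ = Set.range φ') :
    Fintype.card k = Fintype.card k' := by
  have h1 := LinearMap.finrank_range_of_inj (f := (φ : Matrix k k ℂ →ₗ[ℂ] Matrix m m ℂ))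
    (starAlgHom_injective φ)
  have h2 := LinearMap.finrank_range_of_inj (f := (φ' : Matrix k' k' ℂ →ₗ[ℂ] Matrix m m ℂ))
    (starAlgHom_injective φ')
  have h3 : LinearMap.range (φ : Matrix k k ℂ →ₗ[ℂ] Matrix m m ℂ)
      = LinearMap.range (φ' : Matrix k' k' ℂ →ₗ[ℂ] Matrix m m ℂ) := SetLike.coe_injective h
  rw [h3, h2] at h1
  simp only [Module.finrank_matrix, Module.finrank_self, mul_one] at h1
  exact (Nat.mul_self_inj.1 h1).symm

/-- The implementing representation is unique up to a one-dimensional representation. -/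
theorem unique [Nonempty m] (h : FactorRep V 𝓑 r R) {r' : ℕ} {R' : G → Matrix m m ℂ}
    (h' : FactorRep V 𝓑 r' R') :
    r = r' ∧ ∃ u : G →* Circle, ∀ g, R g = (u g : ℂ) • R' g := by
  have hr : r = r' := by
    obtain ⟨φ, ρ, hφ, -⟩ := h
    obtain ⟨φ', ρ', hφ', -⟩ := h'
    simpa using finrank_eq φ φ' (hφ.trans hφ'.symm)
  refine ⟨hr, ?_⟩
  -- Both representations implement the same automorphism, so `(R' g)ᴴ * R g` is central in the
  -- matrix algebra and hence a scalar.
  have hsc : ∀ g, ∃ c : ℂ, R g = c • R' g := by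
    intro g
    have hcomm : ∀ X ∈ 𝓑, (R' g)ᴴ * R g * X = X * ((R' g)ᴴ * R g) := by
      intro X hX
      obtain ⟨φ, ρ, hφ, hR, hV⟩ := id h
      obtain ⟨φ', ρ', hφ', hR', hV'⟩ := id h'
      have h1 := (hV g X hX).symm.trans (hV' g X hX)
      calc (R' g)ᴴ * R g * X = (R' g)ᴴ * (R g * X * (R g)ᴴ) * R g := by
            simp only [mul_assoc, h.unitary, mul_one]
        _ = ((R' g)ᴴ * R' g) * X * ((R' g)ᴴ * R g) := by rw [h1]; simp only [mul_assoc]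
        _ = _ := by rw [h'.unitary, one_mul]
    obtain ⟨φ, ρ, hφ, -⟩ := id h
    have hmem : (R' g)ᴴ * R g ∈ Set.range φ := by
      have h1 := h.mem g
      have h2 := h'.mem g
      rw [← hφ] at h1 h2
      obtain ⟨x, hx⟩ := h1
      obtain ⟨y, hy⟩ := h2
      exact ⟨star y * x, by rw [_root_.map_mul, map_star, hx, hy, Matrix.star_eq_conjTranspose]⟩
    obtain ⟨x, hx⟩ := hmem
    have hsx : x ∈ Set.range (Matrix.scalar (Fin r)) := by
      rw [Matrix.mem_range_scalar_iff_commute_single']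
      intro i j
      refine starAlgHom_injective φ ?_
      rw [_root_.map_mul, _root_.map_mul, hx, hcomm _ (by rw [← hφ]; exact ⟨_, rfl⟩)]
    obtain ⟨c, rfl⟩ := hsx
    refine ⟨c, ?_⟩
    have : φ (Matrix.scalar (Fin r) c) = c • 1 := by
      rw [← map_one φ, ← map_smul]
      congr 1
      ext i j; simp [Matrix.scalar_apply, Matrix.diagonal_apply, Matrix.one_apply]
    rw [this] at hx
    calc R g = R' g * ((R' g)ᴴ * R g) := by rw [← mul_assoc, h'.unitary', one_mul]
      _ = c • R' g := by rw [← hx, mul_smul_comm, mul_one]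
  choose c hc using hsc
  refine (exists_circle_hom c (fun g k => ?_) fun g => ?_).imp fun u hu g => by rw [hu, hc]
  · have h1 := hc (g * k)
    rw [h.map_mul, hc g, hc k, smul_mul_assoc, mul_smul_comm, smul_smul, ← h'.map_mul] at h1
    have h2 := congrArg (fun X => ntr (X * (R' (g * k))ᴴ)) h1
    simpa [smul_mul_assoc, h'.unitary', ntr_smul, ntr_one] using h2.symm
  · exact norm_eq_one_of_smul_unitary (h.unitary g) (h'.unitary g) (hc g)

theorem twist (h : FactorRep V 𝓑 r R) (u : G →* Circle) :
    FactorRep V 𝓑 r (fun g => (u g : ℂ) • R g) := by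
  obtain ⟨φ, ρ, hφ, hR, hV⟩ := h
  have hu : ∀ g, (starRingEnd ℂ) (u g : ℂ) * (u g : ℂ) = 1 := by
    intro g
    rw [Complex.conj_mul', Circle.norm_coe]; simp
  refine ⟨φ, MonoidHom.mk' (fun g => ⟨(u g : ℂ) • (ρ g).val, Matrix.mem_unitaryGroup_iff'.2 ?_⟩)
    fun g k => Subtype.ext ?_, hφ, fun g => ?_, fun g X hX => ?_⟩
  · rw [star_smul, smul_mul_assoc, mul_smul_comm, Matrix.mem_unitaryGroup_iff'.1 (ρ g).2,
      smul_smul, Complex.star_def, hu, one_smul]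
  · simp [smul_smul, mul_comm]
  · simp [hR]
  · rw [hV g X hX, Matrix.conjTranspose_smul, smul_mul_assoc, smul_mul_assoc, mul_smul_comm,
      smul_smul, Complex.star_def, mul_comm, hu, one_smul]

theorem congr_set {𝓒 : Set (Matrix m m ℂ)} (h : FactorRep V 𝓑 r R) (hBC : 𝓑 = 𝓒) :
    FactorRep V 𝓒 r R := hBC ▸ h

theorem congr_rep {R' : G → Matrix m m ℂ} (h : FactorRep V 𝓑 r R) (hR : ∀ g, R g = R' g) :
    FactorRep V 𝓑 r R' := (funext hR : R = R') ▸ h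

theorem ntr_mul_of_commute [Nonempty m] (h : FactorRep V 𝓑 r R) (g : G) (K : Matrix m m ℂ)
    (hK : ∀ X ∈ 𝓑, X * K = K * X) : ntr (R g * K) = ntr (R g) * ntr K := by
  obtain ⟨φ, ρ, hφ, hR, -⟩ := h
  rw [hR, ntr_map_mul_of_commute φ K (fun X => hK _ (by rw [← hφ]; exact ⟨X, rfl⟩)), ntr_map]

/-- Factors with the same character have a common parametrization by a matrix algebra. -/
theorem exists_common_param [Finite G] [Nonempty m] {V' : G → Matrix m m ℂ}
    {𝓑' : Set (Matrix m m ℂ)} {R' : G → Matrix m m ℂ} (h : FactorRep V 𝓑 r R)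
    (h' : FactorRep V' 𝓑' r R') (htr : ∀ g, ntr (R g) = ntr (R' g)) :
    ∃ (φ φ' : Matrix (Fin r) (Fin r) ℂ →⋆ₐ[ℂ] Matrix m m ℂ) (ρ : G → Matrix (Fin r) (Fin r) ℂ),
      Set.range φ = 𝓑 ∧ Set.range φ' = 𝓑' ∧ (∀ g, R g = φ (ρ g)) ∧ ∀ g, R' g = φ' (ρ g) := by
  obtain ⟨φ, ρ, hφ, hR, -⟩ := id h
  obtain ⟨φ', ρ', hφ', hR', -⟩ := id h'
  have hr : ((Fintype.card (Fin r) : ℕ) : ℂ) ≠ 0 := by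
    simpa using h.rank_pos.ne'
  -- The intertwiner is absorbed into the parametrization of the second algebra, after which both
  -- representations have the same matrices.
  obtain ⟨T, hT1, hT2, hT⟩ := exists_unitary_intertwiner ρ' ρ fun g => by
    have h1 := htr g
    rw [hR, hR', ntr_map, ntr_map, ntr, ntr] at h1
    exact ((div_left_inj' hr).1 h1).symm
  let w : _root_.unitary (Matrix (Fin r) (Fin r) ℂ) := ⟨T, Unitary.mem_iff.2 ⟨hT1, hT2⟩⟩
  let c := (Unitary.conjStarAlgAut ℂ (Matrix (Fin r) (Fin r) ℂ) w)
  have hc : ∀ X, c X = T * X * Tᴴ := fun X => by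
    simp [c, Unitary.conjStarAlgAut_apply, w, Matrix.star_eq_conjTranspose]
  refine ⟨φ, φ'.comp (c : _ →⋆ₐ[ℂ] _), fun g => (ρ g).val, hφ, ?_, hR, fun g => ?_⟩
  · rw [← hφ', StarAlgHom.coe_comp, Set.range_comp]
    have : Set.range (c : Matrix (Fin r) (Fin r) ℂ →⋆ₐ[ℂ] Matrix (Fin r) (Fin r) ℂ) = Set.univ :=
      Set.range_eq_univ.2 c.surjective
    rw [this, Set.image_univ]
  · rw [hR', StarAlgHom.comp_apply]
    congr 1
    change _ = c (ρ g).val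
    rw [hc, ← hT, mul_assoc, hT2, mul_one]

/-- Every operator is a combination of matrix units with coefficients in the commutant. -/
theorem exists_commutant_decomposition {r m : Type*} [Fintype r] [DecidableEq r] [Fintype m]
    [DecidableEq m] (φ : Matrix r r ℂ →⋆ₐ[ℂ] Matrix m m ℂ) (X : Matrix m m ℂ) :
    ∃ Z : r → r → Matrix m m ℂ, X = ∑ i, ∑ j, φ (Matrix.single i j 1) * Z i j ∧
      (∀ i j Y, φ Y * Z i j = Z i j * φ Y) ∧
      ∀ i j, Z i j = ∑ k, φ (Matrix.single k i 1) * X * φ (Matrix.single j k 1) := by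
  refine ⟨fun i j => ∑ k, φ (Matrix.single k i 1) * X * φ (Matrix.single j k 1), ?_,
    fun i j Y => ?_, fun i j => rfl⟩
  · have h1 : ∀ i j, φ (Matrix.single i j 1) *
        ∑ k, φ (Matrix.single k i 1) * X * φ (Matrix.single j k 1)
        = φ (Matrix.single i i 1) * X * φ (Matrix.single j j 1) := by
      intro i j
      rw [Finset.mul_sum, Finset.sum_eq_single j]
      · rw [← mul_assoc, ← mul_assoc, ← _root_.map_mul, Matrix.single_mul_single_same, one_mul]
      · intro k _ hk
        rw [← mul_assoc, ← mul_assoc, ← _root_.map_mul,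
          Matrix.single_mul_single_of_ne (h := hk.symm), map_zero, zero_mul, zero_mul]
      · simp
    simp only [h1]
    simp only [← Finset.mul_sum, ← Finset.sum_mul, ← map_sum, Matrix.sum_single_one, map_one]
    simp
  · have h1 : ∀ a b, φ (Matrix.single a b 1) *
        (∑ k, φ (Matrix.single k i 1) * X * φ (Matrix.single j k 1))
        = (∑ k, φ (Matrix.single k i 1) * X * φ (Matrix.single j k 1)) *
          φ (Matrix.single a b 1) := by
      intro a b
      rw [Finset.mul_sum, Finset.sum_mul, Finset.sum_eq_single b, Finset.sum_eq_single a]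
      · rw [← mul_assoc, ← mul_assoc, ← _root_.map_mul, mul_assoc _ _ (φ (Matrix.single a b 1)),
          ← _root_.map_mul, Matrix.single_mul_single_same, Matrix.single_mul_single_same, one_mul]
      · intro k _ hk
        rw [mul_assoc _ _ (φ (Matrix.single a b 1)), ← _root_.map_mul,
          Matrix.single_mul_single_of_ne (h := hk), map_zero, mul_zero]
      · simp
      · intro k _ hk
        rw [← mul_assoc, ← mul_assoc, ← _root_.map_mul,
          Matrix.single_mul_single_of_ne (h := hk.symm), map_zero, zero_mul, zero_mul]
      · simp
    beta_reduce
    generalize (∑ k, φ (Matrix.single k i 1) * X * φ (Matrix.single j k 1)) = Z at h1 ⊢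
    rw [Matrix.matrix_eq_sum_single Y]
    simp only [map_sum, Finset.sum_mul, Finset.mul_sum]
    refine Finset.sum_congr rfl fun a _ => Finset.sum_congr rfl fun b _ => ?_
    rw [show Matrix.single a b (Y a b) = Y a b • Matrix.single a b (1 : ℂ) by simp, map_smul,
      mul_smul_comm, smul_mul_assoc, h1]

/-- The commutant of a factor in a matrix algebra `M = range Ψ` on which `V` acts through `v`. -/
theorem commutant [Nonempty m] {k : Type*} [Fintype k] [DecidableEq k]
    (h : FactorRep V 𝓑 r R) (Ψ : Matrix k k ℂ →⋆ₐ[ℂ] Matrix m m ℂ) (hB : 𝓑 ⊆ Set.range Ψ)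
    (v : G → Matrix m m ℂ) (hv : ∀ g, v g ∈ Set.range Ψ) (hvu : ∀ g, (v g)ᴴ * v g = 1)
    (hvm : ∀ g h, v (g * h) = v g * v h)
    (hV : ∀ g, ∀ X ∈ Set.range Ψ, V g * X * (V g)ᴴ = v g * X * (v g)ᴴ) :
    ∃ l : ℕ, FactorRep V {X | X ∈ Set.range Ψ ∧ ∀ Y ∈ 𝓑, X * Y = Y * X} l
        (fun g => (R g)ᴴ * v g) ∧
      r * l = Fintype.card k ∧ ∀ g, ntr (R g) * ntr ((R g)ᴴ * v g) = ntr (v g) := by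
  obtain ⟨φ, ρ, hφ, hR, hRV⟩ := id h
  have hvu' : ∀ g, v g * (v g)ᴴ = 1 := fun g => mul_eq_one_comm.1 (hvu g)
  have hφB : ∀ X, φ X ∈ 𝓑 := fun X => hφ ▸ ⟨X, rfl⟩
  let M : StarSubalgebra ℂ (Matrix m m ℂ) := StarAlgHom.range Ψ
  have hM : ∀ X, X ∈ M ↔ X ∈ Set.range Ψ := fun X => Iff.rfl
  have hBM : ∀ X ∈ 𝓑, X ∈ M := hB
  let 𝓒 : StarSubalgebra ℂ (Matrix m m ℂ) :=
    M ⊓ StarSubalgebra.centralizer ℂ 𝓑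
  have hstarB : ∀ X ∈ 𝓑, star X ∈ 𝓑 := by
    intro X hX
    rw [← hφ] at hX ⊢
    obtain ⟨x, rfl⟩ := hX
    exact ⟨star x, map_star _ _⟩
  have h𝓒 : ∀ X, X ∈ 𝓒 ↔ X ∈ Set.range Ψ ∧ ∀ Y ∈ 𝓑, X * Y = Y * X := by
    intro X
    rw [StarSubalgebra.mem_inf, StarSubalgebra.mem_centralizer_iff]
    refine and_congr Iff.rfl ⟨fun hX Y hY => (hX Y hY).1.symm, fun hX Y hY =>
      ⟨(hX Y hY).symm, (hX _ (hstarB Y hY)).symm⟩⟩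
  -- conjugation with `v` on `𝓑`
  have hconj : ∀ g, ∀ X ∈ 𝓑, v g * X * (v g)ᴴ = R g * X * (R g)ᴴ := fun g X hX => by
    rw [← hV g X (hB hX), hRV g X hX]
  have hvX : ∀ g, ∀ X ∈ 𝓑, v g * X = R g * X * (R g)ᴴ * v g := fun g X hX => by
    rw [← hconj g X hX, mul_assoc _ (v g)ᴴ, hvu, mul_one]
  have hvR : ∀ g, v g * R g = R g * v g := fun g => by
    rw [hvX g _ (h.mem g), mul_assoc (R g), h.unitary', mul_one]
  have hvRH : ∀ g, v g * (R g)ᴴ = (R g)ᴴ * v g := fun g => by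
    have := hvX g _ (hstarB _ (h.mem g))
    rwa [Matrix.star_eq_conjTranspose, h.unitary', one_mul] at this
  -- `R g` and `v g` act alike on `𝓑`, so their quotient lies in the commutant.
  have hKB : ∀ g, ∀ X ∈ 𝓑, (R g)ᴴ * v g * X = X * ((R g)ᴴ * v g) := by
    intro g X hX
    rw [mul_assoc, hvX g X hX]
    simp only [← mul_assoc]
    rw [h.unitary, one_mul]
  have hKC : ∀ g, (R g)ᴴ * v g ∈ 𝓒 := fun g => (h𝓒 _).2
    ⟨(hM _).1 (mul_mem (star_mem (hBM _ (h.mem g))) ((hM _).2 (hv g))), hKB g⟩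
  -- A central element of the commutant commutes with both `𝓑` and the commutant. By the matrix-unit
  -- decomposition these generate `range Ψ`, whose centre consists of scalars.
  obtain ⟨l, ψ, hψ⟩ := exists_starAlgHom_range_eq 𝓒 (by
    intro X hX hXc
    have hXM : ∀ Y ∈ M, X * Y = Y * X := by
      intro Y hY
      obtain ⟨Z, hYZ, hZc, hZ⟩ := exists_commutant_decomposition φ Y
      have hZC : ∀ i j, Z i j ∈ 𝓒 := fun i j => (h𝓒 _).2 ⟨by
        rw [← hM, hZ]
        exact sum_mem fun k _ => mul_mem (mul_mem (hBM _ (hφB _)) hY) (hBM _ (hφB _)), fun W hW => by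
        rw [← hφ] at hW
        obtain ⟨w, rfl⟩ := hW
        exact (hZc i j w).symm⟩
      rw [hYZ]
      simp only [Finset.mul_sum, Finset.sum_mul]
      refine Finset.sum_congr rfl fun i _ => Finset.sum_congr rfl fun j _ => ?_
      rw [← mul_assoc, ((h𝓒 X).1 hX).2 _ (hφB _), mul_assoc, hXc _ (hZC i j), mul_assoc]
    obtain ⟨x, rfl⟩ := ((h𝓒 X).1 hX).1
    have hsx : x ∈ Set.range (Matrix.scalar k) := by
      rw [Matrix.mem_range_scalar_iff_commute_single']
      intro i j
      refine starAlgHom_injective Ψ ?_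
      rw [_root_.map_mul, _root_.map_mul, hXM (Ψ (Matrix.single i j 1)) ⟨_, rfl⟩]
    obtain ⟨c, rfl⟩ := hsx
    refine ⟨c, ?_⟩
    rw [← map_one Ψ, ← map_smul]
    congr 1
    ext i j; simp [Matrix.scalar_apply, Matrix.diagonal_apply, Matrix.one_apply])
  have hψC : ∀ X, ψ X ∈ 𝓒 := fun X => by
    have : ψ X ∈ Set.range ψ := ⟨X, rfl⟩
    rwa [hψ] at this
  have hset : Set.range ψ = {X | X ∈ Set.range Ψ ∧ ∀ Y ∈ 𝓑, X * Y = Y * X} := by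
    rw [hψ]; ext X; exact h𝓒 X
  have hKu : ∀ g, ((R g)ᴴ * v g)ᴴ * ((R g)ᴴ * v g) = 1 := fun g => by
    rw [Matrix.conjTranspose_mul, Matrix.conjTranspose_conjTranspose, mul_assoc,
      ← mul_assoc (R g), h.unitary', one_mul, hvu]
  obtain ⟨lam, hlam⟩ := exists_rep_of_mem_range ψ (fun g => (R g)ᴴ * v g)
    (fun g => by rw [hψ]; exact hKC g) hKu (fun g k => by
      have h1 := hKB g _ (hstarB _ (h.mem k))
      rw [Matrix.star_eq_conjTranspose] at h1
      simp only [h.map_mul, hvm, Matrix.conjTranspose_mul]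
      rw [← mul_assoc ((R g)ᴴ * v g), h1]
      simp only [mul_assoc])
  refine ⟨l, ⟨ψ, lam, hset, hlam, fun g X hX => ?_⟩, ?_, fun g => ?_⟩
  · have hvXB : ∀ Y ∈ 𝓑, v g * X * (v g)ᴴ * Y = Y * (v g * X * (v g)ᴴ) := by
      intro Y hY
      have h1 : v g * ((R g)ᴴ * Y * R g) * (v g)ᴴ = Y := by
        rw [hconj g _ (h.conj_mem g hY).2]
        simp only [← mul_assoc]
        rw [h.unitary', one_mul, mul_assoc, h.unitary', mul_one]
      have h2 := hX.2 _ (h.conj_mem g hY).2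
      rw [← h1]
      calc v g * X * (v g)ᴴ * (v g * ((R g)ᴴ * Y * R g) * (v g)ᴴ)
          = v g * (X * (((v g)ᴴ * v g) * ((R g)ᴴ * Y * R g))) * (v g)ᴴ := by
            simp only [mul_assoc]
        _ = v g * ((R g)ᴴ * Y * R g) * (((v g)ᴴ * v g) * X) * (v g)ᴴ := by
            rw [hvu, one_mul, h2, one_mul]; simp only [mul_assoc]
        _ = _ := by simp only [mul_assoc]
    rw [hV g X hX.1]
    have h3 := hvXB _ (h.mem g)
    rw [Matrix.conjTranspose_mul, Matrix.conjTranspose_conjTranspose]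
    calc v g * X * (v g)ᴴ = (R g)ᴴ * (R g * (v g * X * (v g)ᴴ)) := by
          rw [← mul_assoc, h.unitary, one_mul]
      _ = _ := by rw [← h3]; simp only [mul_assoc]
  -- Products of elements of `𝓑` and of its commutant parametrize `range Ψ` by a Kronecker product;
  -- the dimension formula follows by comparing matrix sizes.
  · obtain ⟨Φ, hΦ⟩ := exists_kroneckerLift φ ψ fun X Y =>
      (((h𝓒 _).1 (hψC Y)).2 _ (hφB X)).symm
    have hr : Set.range Φ = Set.range Ψ := by
      apply Set.Subset.antisymm
      · rintro _ ⟨X, rfl⟩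
        rw [← hM]
        induction X using kronecker_induction with
        | hadd X Y hX hY => rw [map_add]; exact add_mem hX hY
        | hk X Y => rw [hΦ]; exact mul_mem (hBM _ (hφB X)) ((h𝓒 _).1 (hψC Y)).1
      · intro Y hY
        obtain ⟨Z, hYZ, hZc, hZ⟩ := exists_commutant_decomposition φ Y
        have hZC : ∀ i j, Z i j ∈ Set.range ψ := fun i j => hset ▸ ⟨by
          rw [← hM, hZ]
          exact sum_mem fun k _ => mul_mem (mul_mem (hBM _ (hφB _)) hY) (hBM _ (hφB _)),
          fun W hW => by
            rw [← hφ] at hW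
            obtain ⟨w, rfl⟩ := hW
            exact (hZc i j w).symm⟩
        choose z hz using hZC
        refine ⟨∑ i, ∑ j, Matrix.single i j (1 : ℂ) ⊗ₖ z i j, ?_⟩
        rw [hYZ]
        simp only [map_sum, hΦ, hz]
    have := finrank_eq Φ Ψ hr
    simpa using this
  · rw [← h.ntr_mul_of_commute g _ fun X hX => (hKB g X hX).symm, ← mul_assoc, h.unitary', one_mul]

end FactorRep

end FactorRep

end QCA

namespace QCA

/-! ### Tensor products, supports and on-site symmetries -/

section TensorOp

variable {ι s : Type} [Fintype ι] [DecidableEq ι] [Fintype s] [DecidableEq s]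

theorem tensorOp_mul (A B : ι → Matrix s s ℂ) :
    tensorOp A * tensorOp B = tensorOp fun i => A i * B i := by
  ext x y
  simp only [tensorOp, Matrix.mul_apply, Matrix.of_apply]
  rw [Finset.prod_univ_sum]
  simp [Finset.prod_mul_distrib]

theorem tensorOp_one : tensorOp (fun _ : ι => (1 : Matrix s s ℂ)) = 1 := by
  ext x y
  simp only [tensorOp, Matrix.of_apply, Matrix.one_apply]
  by_cases h : x = y
  · simp [h]
  · obtain ⟨i, hi⟩ := Function.ne_iff.1 h
    rw [if_neg h]
    exact Finset.prod_eq_zero (Finset.mem_univ i) (by simp [hi])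

omit [DecidableEq ι] [Fintype s] [DecidableEq s] in
theorem tensorOp_conjTranspose (A : ι → Matrix s s ℂ) :
    (tensorOp A)ᴴ = tensorOp fun i => (A i)ᴴ := by
  ext x y
  simp [tensorOp, Matrix.conjTranspose_apply]

omit [DecidableEq s] in
theorem tensorOp_trace (A : ι → Matrix s s ℂ) : (tensorOp A).trace = ∏ i, (A i).trace := by
  simp only [Matrix.trace, Matrix.diag_apply, tensorOp, Matrix.of_apply]
  rw [Finset.prod_univ_sum]
  simp

theorem ntr_tensorOp (A : ι → Matrix s s ℂ) : ntr (tensorOp A) = ∏ i, ntr (A i) := by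
  simp only [ntr, tensorOp_trace, Finset.prod_div_distrib]
  simp

end TensorOp

section Support

open Classical

variable {L : ℕ} [NeZero L] {s : Type} [Fintype s] [DecidableEq s]

-- A criterion in terms of matrix entries on full configurations dispenses with the restricted
-- operator, so that supports on different sets can be compared. A state of `s` is needed to extend
-- configurations from `S` to the chain.
omit [NeZero L] [Fintype s] [DecidableEq s] in
theorem supportedOn_iff [Nonempty s] (S : Set (ZMod L)) (A : Op L s) :
    SupportedOn S A ↔ (∀ x y : ZMod L → s, (∃ i, i ∉ S ∧ x i ≠ y i) → A x y = 0) ∧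
      ∀ x y x' y' : ZMod L → s, (∀ i ∈ S, x i = x' i) → (∀ i ∈ S, y i = y' i) →
        (∀ i ∉ S, x i = y i) → (∀ i ∉ S, x' i = y' i) → A x y = A x' y' := by
  constructor
  · rintro ⟨B, hB⟩
    refine ⟨fun x y ⟨i, hi, hxy⟩ => ?_, fun x y x' y' h1 h2 h3 h4 => ?_⟩
    · rw [hB, if_neg fun h => hxy (h i hi)]
    · rw [hB, hB, if_pos h3, if_pos h4]
      congr 1
      · funext i; exact h1 i i.2
      · funext i; exact h2 i i.2
  · rintro ⟨h1, h2⟩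
    obtain ⟨p⟩ := ‹Nonempty s›
    refine ⟨fun u v => A (fun i => if h : i ∈ S then u ⟨i, h⟩ else p)
      (fun i => if h : i ∈ S then v ⟨i, h⟩ else p), fun x y => ?_⟩
    split_ifs with h
    · exact h2 _ _ _ _ (fun i hi => by simp [hi]) (fun i hi => by simp [hi]) h
        (fun i hi => by simp [hi])
    · push Not at h
      exact h1 x y h

/-- Embedding of the operators on the sites in `S`. -/
noncomputable def embOp (S : Set (ZMod L)) : Matrix (S → s) (S → s) ℂ →⋆ₐ[ℂ] Op L s where
  toFun B := (B ⊗ₖ (1 : Matrix ({i // i ∉ S} → s) ({i // i ∉ S} → s) ℂ)).submatrix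
    (Equiv.piEquivPiSubtypeProd (· ∈ S) fun _ => s) (Equiv.piEquivPiSubtypeProd (· ∈ S) fun _ => s)
  map_one' := by simp
  map_mul' A B := by
    rw [Matrix.submatrix_mul_equiv, ← Matrix.mul_kronecker_mul, one_mul]
  map_zero' := by simp
  map_add' A B := by rw [Matrix.add_kronecker]; rfl
  commutes' a := by
    rw [Algebra.algebraMap_eq_smul_one, Matrix.smul_kronecker, Algebra.algebraMap_eq_smul_one,
      Matrix.one_kronecker_one]
    exact congrArg (fun M : Op L s => a • M) (Matrix.submatrix_one_equiv _)
  map_star' A := by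
    simp [Matrix.star_eq_conjTranspose, Matrix.conjTranspose_submatrix,
      Matrix.conjTranspose_kronecker]

theorem embOp_apply (S : Set (ZMod L)) (B : Matrix (S → s) (S → s) ℂ) (x y : ZMod L → s) :
    embOp S B x y = if ∀ i, i ∉ S → x i = y i then B (fun i => x i) (fun i => y i) else 0 := by
  have : embOp S B x y = B (fun i => x i) (fun i => y i) *
      (1 : Matrix ({i // i ∉ S} → s) ({i // i ∉ S} → s) ℂ) (fun i => x i) (fun i => y i) := rfl
  rw [this, Matrix.one_apply]
  have h2 : ((fun i : {i // i ∉ S} => x i) = fun i : {i // i ∉ S} => y i) ↔ ∀ i, i ∉ S → x i = y i :=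
    ⟨fun h i hi => congrFun h ⟨i, hi⟩, fun h => funext fun i => h i i.2⟩
  simp only [h2]
  split_ifs <;> simp

/-- The algebra of operators supported on `S`. -/
noncomputable def supp (S : Set (ZMod L)) : StarSubalgebra ℂ (Op L s) := (embOp S).range

theorem mem_supp {S : Set (ZMod L)} {A : Op L s} : A ∈ supp S ↔ SupportedOn S A := by
  constructor
  · rintro ⟨B, rfl⟩
    exact ⟨B, fun x y => (embOp_apply S B x y).trans (by congr)⟩
  · rintro ⟨B, hB⟩
    refine ⟨B, ?_⟩
    ext x y
    rw [hB]
    exact (embOp_apply S B x y).trans (by congr)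

theorem embOp_mem (S : Set (ZMod L)) (B : Matrix (S → s) (S → s) ℂ) : embOp S B ∈ supp S :=
  ⟨B, rfl⟩

variable [Nonempty s]

theorem supp_mono {S T : Set (ZMod L)} (h : S ⊆ T) : (supp S : StarSubalgebra ℂ (Op L s)) ≤ supp T := by
  intro A hA
  rw [mem_supp, supportedOn_iff] at hA ⊢
  refine ⟨fun x y ⟨i, hi, hxy⟩ => hA.1 x y ⟨i, fun h' => hi (h h'), hxy⟩,
    fun x y x' y' h1 h2 h3 h4 => ?_⟩
  by_cases hd : ∃ i, i ∉ S ∧ x i ≠ y i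
  · rw [hA.1 x y hd, hA.1 x' y']
    obtain ⟨i, hi, hxy⟩ := hd
    have hiT : i ∈ T := by
      by_contra hiT
      exact hxy (h3 i hiT)
    exact ⟨i, hi, by rwa [← h1 i hiT, ← h2 i hiT]⟩
  · push Not at hd
    refine hA.2 _ _ _ _ (fun i hi => h1 i (h hi)) (fun i hi => h2 i (h hi)) hd fun i hi => ?_
    by_cases hiT : i ∈ T
    · rw [← h1 i hiT, ← h2 i hiT, hd i hi]
    · exact h4 i hiT

/-- The two pairs of configurations are compared through an intermediate pair that follows the first
on `S` and the second elsewhere: support on `S` gives one equality, support on `T` the other. -/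
theorem mem_supp_inter {S T : Set (ZMod L)} {A : Op L s} (hS : A ∈ supp S) (hT : A ∈ supp T) :
    A ∈ supp (S ∩ T) := by
  rw [mem_supp, supportedOn_iff] at hS hT ⊢
  refine ⟨fun x y ⟨i, hi, hxy⟩ => ?_, fun x y x' y' h1 h2 h3 h4 => ?_⟩
  · by_cases hiS : i ∈ S
    · exact hT.1 x y ⟨i, fun h => hi ⟨hiS, h⟩, hxy⟩
    · exact hS.1 x y ⟨i, hiS, hxy⟩
  · rw [hS.2 x y (fun i => if i ∈ S then x i else x' i) (fun i => if i ∈ S then y i else y' i)]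
    · apply hT.2
      · intro i hi
        by_cases hiS : i ∈ S
        · simp [hiS, h1 i ⟨hiS, hi⟩]
        · simp [hiS]
      · intro i hi
        by_cases hiS : i ∈ S
        · simp [hiS, h2 i ⟨hiS, hi⟩]
        · simp [hiS]
      · intro i hi
        by_cases hiS : i ∈ S
        · simp [hiS, h3 i fun h => hi h.2]
        · simp [hiS, h4 i fun h => hi h.2]
      · intro i hi
        exact h4 i fun h => hi h.2
    · intro i hi; simp [hi]
    · intro i hi; simp [hi]
    · intro i hi; exact h3 i fun h => hi h.1
    · intro i hi
      simp [hi, h4 i fun h => hi h.1]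

theorem supp_commute_compl {S : Set (ZMod L)} {A B : Op L s} (hA : A ∈ supp S)
    (hB : B ∈ supp Sᶜ) : A * B = B * A := by
  obtain ⟨A, rfl⟩ := hA
  obtain ⟨B', hB'⟩ := mem_supp.1 hB
  let B'' : Matrix ({i // i ∉ S} → s) ({i // i ∉ S} → s) ℂ := B'
  have : B = ((1 : Matrix (S → s) (S → s) ℂ) ⊗ₖ B'').submatrix
      (Equiv.piEquivPiSubtypeProd (· ∈ S) fun _ => s)
      (Equiv.piEquivPiSubtypeProd (· ∈ S) fun _ => s) := by
    ext x y
    rw [hB']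
    have h1 : ((1 : Matrix (S → s) (S → s) ℂ) ⊗ₖ B'').submatrix
        (Equiv.piEquivPiSubtypeProd (· ∈ S) fun _ => s)
        (Equiv.piEquivPiSubtypeProd (· ∈ S) fun _ => s) x y =
        (1 : Matrix (S → s) (S → s) ℂ) (fun i => x i) (fun i => y i) *
          B'' (fun i => x i) (fun i => y i) := rfl
    rw [h1, Matrix.one_apply]
    have h2 : ((fun i : S => x i) = fun i : S => y i) ↔ ∀ i, i ∉ Sᶜ → x i = y i :=
      ⟨fun h i hi => congrFun h ⟨i, not_not.1 hi⟩, fun h => funext fun i => h i (not_not.2 i.2)⟩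
    simp only [h2]
    split_ifs
    · rw [one_mul]; rfl
    · rw [zero_mul]
  rw [this]
  change (A ⊗ₖ (1 : Matrix ({i // i ∉ S} → s) ({i // i ∉ S} → s) ℂ)).submatrix _ _ *
    Matrix.submatrix _ _ _ = Matrix.submatrix _ _ _ * (A ⊗ₖ 1).submatrix _ _
  rw [Matrix.submatrix_mul_equiv, Matrix.submatrix_mul_equiv, ← Matrix.mul_kronecker_mul,
    ← Matrix.mul_kronecker_mul]
  simp

theorem supp_commute {S T : Set (ZMod L)} (h : Disjoint S T) {A B : Op L s} (hA : A ∈ supp S)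
    (hB : B ∈ supp T) : A * B = B * A :=
  supp_commute_compl hA (supp_mono (Set.subset_compl_iff_disjoint_left.2 h) hB)

/-- The operators `E p q` are the matrix units of the site `j`. Commuting with them forces `A` to be
diagonal in the state of `j` and independent of it. -/
theorem mem_supp_compl_singleton {j : ZMod L} {A : Op L s}
    (h : ∀ B ∈ (supp {j} : StarSubalgebra ℂ (Op L s)), A * B = B * A) : A ∈ supp {j}ᶜ := by
  let E : s → s → Op L s := fun p q => Matrix.of fun x y =>
    if x j = p ∧ y = Function.update x j q then 1 else 0
  have hE : ∀ p q, E p q ∈ (supp {j} : StarSubalgebra ℂ (Op L s)) := by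
    intro p q
    rw [mem_supp, supportedOn_iff]
    refine ⟨fun x y ⟨i, hi, hxy⟩ => ?_, fun x y x' y' h1 h2 h3 h4 => ?_⟩
    · simp only [E, Matrix.of_apply]
      rw [if_neg]
      rintro ⟨-, rfl⟩
      exact hxy (by rw [Function.update_of_ne (by simpa using hi)])
    · simp only [E, Matrix.of_apply]
      have hx := h1 j rfl
      have hy := h2 j rfl
      have key : ∀ z w : ZMod L → s, (∀ i ∉ ({j} : Set (ZMod L)), z i = w i) →
          (w = Function.update z j q ↔ w j = q) := by
        intro z w hzw
        constructor
        · intro h; rw [h]; simp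
        · intro h
          funext i
          by_cases hij : i = j
          · subst hij; simp [h]
          · rw [Function.update_of_ne hij, hzw i (by simpa using hij)]
      simp only [key x y h3, key x' y' h4, hx, hy]
  have hEA : ∀ p q x y, (E p q * A) x y = if x j = p then A (Function.update x j q) y else 0 := by
    intro p q x y
    rw [Matrix.mul_apply]
    by_cases hx : x j = p
    · simp [E, hx]
    · simp [E, hx]
  have hAE : ∀ p q x y, (A * E p q) x y = if y j = q then A x (Function.update y j p) else 0 := by
    intro p q x y
    rw [Matrix.mul_apply]
    have key : ∀ z, (z j = p ∧ y = Function.update z j q) ↔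
        (y j = q ∧ z = Function.update y j p) := by
      intro z
      constructor
      · rintro ⟨rfl, rfl⟩; simp
      · rintro ⟨rfl, rfl⟩; simp
    simp only [E, Matrix.of_apply, key]
    by_cases hy : y j = q
    · simp [hy]
    · simp [hy]
  rw [mem_supp, supportedOn_iff]
  refine ⟨fun x y ⟨i, hi, hxy⟩ => ?_, fun x y x' y' h1 h2 h3 h4 => ?_⟩
  · have hij : i = j := by simpa using hi
    subst hij
    have h5 := congrFun (congrFun (h _ (hE (x i) (x i))) x) y
    rw [hEA, hAE, if_pos rfl, if_neg (Ne.symm hxy), Function.update_eq_self] at h5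
    exact h5.symm
  · have hj : j ∉ ({j} : Set (ZMod L))ᶜ := by simp
    have h5 := congrFun (congrFun (h _ (hE (x j) (x' j))) x) y'
    rw [hEA, hAE, if_pos rfl, if_pos (h4 j hj).symm] at h5
    have e1 : Function.update x j (x' j) = x' := by
      funext i
      by_cases hij : i = j
      · subst hij; simp
      · rw [Function.update_of_ne hij, h1 i (by simpa using hij)]
    have e2 : Function.update y' j (x j) = y := by
      funext i
      by_cases hij : i = j
      · subst hij; simp [h3 i hj]
      · rw [Function.update_of_ne hij, h2 i (by simpa using hij)]
    rw [e1, e2] at h5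
    exact h5

/-- The converse of `supp_commute`: the sites outside `S` are removed one at a time and the supports
intersected. Locality is afterwards deduced from commutation through this lemma. -/
theorem mem_supp_of_commute {S : Set (ZMod L)} {A : Op L s}
    (h : ∀ j ∉ S, ∀ B ∈ (supp {j} : StarSubalgebra ℂ (Op L s)), A * B = B * A) : A ∈ supp S := by
  have key : ∀ F : Finset (ZMod L), (∀ j ∈ F, j ∉ S) → A ∈ supp ((F : Set (ZMod L))ᶜ) := by
    intro F
    induction F using Finset.induction_on with
    | empty =>
      intro _
      rw [mem_supp, supportedOn_iff]
      refine ⟨fun x y ⟨i, hi, _⟩ => absurd hi (by simp), fun x y x' y' h1 h2 _ _ => ?_⟩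
      rw [show x = x' from funext fun i => h1 i (by simp),
        show y = y' from funext fun i => h2 i (by simp)]
    | insert j F hj ih =>
      intro hF
      have h1 := ih fun i hi => hF i (Finset.mem_insert_of_mem hi)
      have h2 := mem_supp_compl_singleton (h j (hF j (Finset.mem_insert_self j F)))
      refine supp_mono ?_ (mem_supp_inter h1 h2)
      intro i hi
      simpa [not_or, and_comm] using hi
  have h1 := key (Finset.univ.filter (· ∉ S)) (by simp)
  refine supp_mono ?_ h1
  intro i hi
  simpa using hi

theorem eq_smul_one_of_mem_supp_empty {A : Op L s} (hA : A ∈ supp (∅ : Set (ZMod L))) :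
    ∃ a : ℂ, A = a • 1 := by
  rw [mem_supp, supportedOn_iff] at hA
  obtain ⟨p⟩ := ‹Nonempty s›
  refine ⟨A (fun _ => p) (fun _ => p), ?_⟩
  ext x y
  rw [Matrix.smul_apply, Matrix.one_apply]
  split_ifs with h
  · subst h
    simpa using hA.2 x x (fun _ => p) (fun _ => p) (by simp) (by simp) (by simp) (by simp)
  · obtain ⟨i, hi⟩ := Function.ne_iff.1 h
    simpa using hA.1 x y ⟨i, by simp, hi⟩

end Support

section SymOn

open Classical

variable {L : ℕ} [NeZero L] {s : Type} [Fintype s] [DecidableEq s]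

theorem symOn_mul (ν ν' : Matrix s s ℂ) (S : Set (ZMod L)) :
    symOn ν S * symOn ν' S = symOn (ν * ν') S := by
  rw [symOn, symOn, tensorOp_mul, symOn]
  congr 1
  funext i
  split_ifs <;> simp

theorem symOn_one (S : Set (ZMod L)) : symOn (1 : Matrix s s ℂ) S = 1 := by
  rw [symOn, ← tensorOp_one]
  simp

theorem symOn_conjTranspose (ν : Matrix s s ℂ) (S : Set (ZMod L)) :
    (symOn ν S)ᴴ = symOn νᴴ S := by
  rw [symOn, tensorOp_conjTranspose, symOn]
  congr 1
  funext i
  split_ifs <;> simp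

theorem symOn_unitary {ν : Matrix s s ℂ} (h : νᴴ * ν = 1) (S : Set (ZMod L)) :
    (symOn ν S)ᴴ * symOn ν S = 1 := by
  rw [symOn_conjTranspose, symOn_mul, h, symOn_one]

theorem symOn_union (ν : Matrix s s ℂ) {S T : Set (ZMod L)} (h : Disjoint S T) :
    symOn ν S * symOn ν T = symOn ν (S ∪ T) := by
  rw [symOn, symOn, tensorOp_mul, symOn]
  congr 1
  funext i
  by_cases hS : i ∈ S
  · have hT : i ∉ T := fun hT => Set.disjoint_left.1 h hS hT
    simp [hS, hT]
  · simp [hS]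

theorem ntr_symOn [Nonempty s] (ν : Matrix s s ℂ) (S : Set (ZMod L)) :
    ntr (symOn ν S) = ntr ν ^ S.ncard := by
  rw [symOn, ntr_tensorOp]
  have : ∀ i, ntr (if i ∈ S then ν else 1) = if i ∈ S then ntr ν else 1 := by
    intro i
    split_ifs
    · rfl
    · exact ntr_one
  simp only [this, Finset.prod_ite, Finset.prod_const]
  have hc : (Finset.univ.filter (· ∈ S)).card = S.ncard := by
    rw [Set.ncard_eq_toFinset_card']
    congr 1
    ext i; simp
  rw [hc, one_pow, mul_one]

theorem symOn_mem_supp [Nonempty s] (ν : Matrix s s ℂ) (S : Set (ZMod L)) :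
    symOn ν S ∈ supp S := by
  rw [mem_supp, supportedOn_iff]
  refine ⟨fun x y ⟨i, hi, hxy⟩ => ?_, fun x y x' y' h1 h2 h3 h4 => ?_⟩
  · exact Finset.prod_eq_zero (Finset.mem_univ i) (by simp [hi, hxy])
  · refine Finset.prod_congr rfl fun i _ => ?_
    by_cases hi : i ∈ S
    · rw [h1 i hi, h2 i hi]
    · simp [hi, h3 i hi, h4 i hi, Matrix.one_apply]

/-- On operators supported on `S`, the global symmetry acts as its restriction to `S`. -/
theorem symOn_univ_conj [Nonempty s] {ν : Matrix s s ℂ} (h : νᴴ * ν = 1) {S : Set (ZMod L)}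
    {X : Op L s} (hX : X ∈ supp S) :
    symOn ν Set.univ * X * (symOn ν Set.univ)ᴴ = symOn ν S * X * (symOn ν S)ᴴ := by
  have h1 : symOn ν (Set.univ : Set (ZMod L)) = symOn ν S * symOn ν Sᶜ := by
    rw [symOn_union ν disjoint_compl_right, Set.union_compl_self]
  have h2 := supp_commute_compl hX (symOn_mem_supp ν Sᶜ)
  have h3 : symOn ν Sᶜ * (symOn ν Sᶜ)ᴴ = 1 := mul_eq_one_comm.1 (symOn_unitary h Sᶜ)
  rw [h1, Matrix.conjTranspose_mul]
  calc symOn ν S * symOn ν Sᶜ * X * ((symOn ν Sᶜ)ᴴ * (symOn ν S)ᴴ)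
      = symOn ν S * (symOn ν Sᶜ * X) * (symOn ν Sᶜ)ᴴ * (symOn ν S)ᴴ := by
        simp only [mul_assoc]
    _ = symOn ν S * X * (symOn ν Sᶜ * (symOn ν Sᶜ)ᴴ) * (symOn ν S)ᴴ := by
        rw [← h2]; simp only [mul_assoc]
    _ = _ := by rw [h3, mul_one]

theorem symOn_conj_mem [Nonempty s] {ν : Matrix s s ℂ} (h : νᴴ * ν = 1) {S : Set (ZMod L)}
    {X : Op L s} (hX : X ∈ supp S) :
    symOn ν Set.univ * X * (symOn ν Set.univ)ᴴ ∈ supp S := by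
  rw [symOn_univ_conj h hX]
  exact mul_mem (mul_mem (symOn_mem_supp ν S) hX) (star_mem (symOn_mem_supp ν S))

end SymOn

end QCA

namespace QCA

/-! ### Heisenberg evolution and its spreading -/

section Evolve

variable {L : ℕ} [NeZero L] {s : Type} [Fintype s] [DecidableEq s]

/-- Heisenberg evolution as a homomorphism of `*`-algebras. -/
noncomputable def evolveHom (U : Op L s) (hU : U * Uᴴ = 1) : Op L s →⋆ₐ[ℂ] Op L s where
  toFun := evolve U
  map_one' := by rw [evolve, mul_one]; exact mul_eq_one_comm.1 hU
  map_mul' A B := by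
    have : U * (Uᴴ * (B * U)) = B * U := by rw [← mul_assoc, hU, one_mul]
    simp only [evolve, mul_assoc, this]
  map_zero' := by simp [evolve]
  map_add' A B := by simp [evolve, mul_add, add_mul]
  commutes' a := by
    rw [Algebra.algebraMap_eq_smul_one, evolve, mul_smul_comm, mul_one, smul_mul_assoc,
      mul_eq_one_comm.1 hU]
  map_star' A := by
    simp [evolve, Matrix.star_eq_conjTranspose, Matrix.conjTranspose_mul, mul_assoc]

omit [DecidableEq s] in
theorem evolve_add (U A B : Op L s) : evolve U (A + B) = evolve U A + evolve U B := by
  simp [evolve, mul_add, add_mul]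

omit [DecidableEq s] in
theorem evolve_conjTranspose (U A : Op L s) : evolve U Aᴴ = (evolve U A)ᴴ := by
  simp [evolve, Matrix.conjTranspose_mul, mul_assoc]

theorem evolve_mul {U : Op L s} (hU : U * Uᴴ = 1) (A B : Op L s) :
    evolve U (A * B) = evolve U A * evolve U B := map_mul (evolveHom U hU) A B

theorem evolve_symm_evolve {U : Op L s} (hU : U * Uᴴ = 1) (A : Op L s) :
    evolve Uᴴ (evolve U A) = A := by
  rw [evolve, evolve, Matrix.conjTranspose_conjTranspose]
  calc U * (Uᴴ * A * U) * Uᴴ = (U * Uᴴ) * A * (U * Uᴴ) := by simp only [mul_assoc]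
    _ = A := by rw [hU, one_mul, mul_one]

theorem evolve_evolve_symm {U : Op L s} (hU : U * Uᴴ = 1) (A : Op L s) :
    evolve U (evolve Uᴴ A) = A := by
  have h1 : Uᴴ * Uᴴᴴ = 1 := by
    rw [Matrix.conjTranspose_conjTranspose]; exact mul_eq_one_comm.1 hU
  simpa using evolve_symm_evolve h1 A

omit [DecidableEq s] in
theorem evolve_comp (U W A : Op L s) : evolve (U * W) A = evolve W (evolve U A) := by
  simp only [evolve, Matrix.conjTranspose_mul, mul_assoc]

theorem commute_of_evolve {U : Op L s} (hU : U * Uᴴ = 1) {A B : Op L s}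
    (h : evolve U A * evolve U B = evolve U B * evolve U A) : A * B = B * A := by
  rw [← evolve_mul hU, ← evolve_mul hU] at h
  rw [← evolve_symm_evolve hU (A * B), h, evolve_symm_evolve hU]

theorem ntr_evolve {U : Op L s} (hU : U * Uᴴ = 1) (A : Op L s) : ntr (evolve U A) = ntr A := by
  rw [evolve, ntr_mul_comm, ← mul_assoc, hU, one_mul]

end Evolve

section Neighbourhood

variable {L : ℕ} [NeZero L]

/-- The sites at distance at most `ξ` from `S`. -/
def nbr (ξ : ℕ) (S : Set (ZMod L)) : Set (ZMod L) :=
  {x | ∃ i ∈ S, ∃ k : ℤ, -ξ ≤ k ∧ k ≤ ξ ∧ x = i + k}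

omit [NeZero L] in
theorem nbr_singleton (ξ : ℕ) (i : ZMod L) : nbr ξ {i} = arc (i - (ξ : ZMod L)) (2 * ξ + 1) := by
  ext x
  constructor
  · rintro ⟨_, rfl, k, h1, h2, rfl⟩
    refine ⟨(k + ξ).toNat, by omega, ?_⟩
    have h3 : (((k + ξ).toNat : ℤ) : ZMod L) = ((k + ξ : ℤ) : ZMod L) := by
      rw [Int.toNat_of_nonneg (by omega)]
    push_cast at h3
    rw [h3]; ring
  · rintro ⟨j, hj, rfl⟩
    exact ⟨i, rfl, j - ξ, by omega, by omega, by push_cast; ring⟩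

omit [NeZero L] in
theorem nbr_symm {ξ : ℕ} {i j : ZMod L} (h : i ∈ nbr ξ {j}) : j ∈ nbr ξ {i} := by
  obtain ⟨_, rfl, k, h1, h2, rfl⟩ := h
  exact ⟨_, rfl, -k, by omega, by omega, by push_cast; ring⟩

omit [NeZero L] in
theorem mem_nbr_iff {ξ : ℕ} {S : Set (ZMod L)} {x : ZMod L} :
    x ∈ nbr ξ S ↔ ∃ i ∈ S, x ∈ nbr ξ {i} := by
  simp [nbr]

end Neighbourhood

section Spreading

variable {L : ℕ} [NeZero L] {s : Type} [Fintype s] [DecidableEq s] {ξ : ℕ} {U : Op L s}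

theorem IsQCA.mul_conjTranspose (h : IsQCA ξ U) : U * Uᴴ = 1 := Matrix.mem_unitaryGroup_iff.1 h.1

theorem IsQCA.conjTranspose_mul (h : IsQCA ξ U) : Uᴴ * U = 1 := Matrix.mem_unitaryGroup_iff'.1 h.1

theorem IsQCA.evolve_site (h : IsQCA ξ U) {i : ZMod L} {A : Op L s} (hA : A ∈ supp {i}) :
    evolve U A ∈ supp (nbr ξ {i}) := by
  rw [nbr_singleton, mem_supp]
  exact h.2 i A (mem_supp.1 hA)

variable [Nonempty s]

/-- If `i` is farther than `ξ` from `j`, operators on `j` commute with evolved operators on `i`.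
Evolving back, the preimage of an operator on `j` commutes with all operators on such `i`. -/
theorem IsQCA.symm (h : IsQCA ξ U) : IsQCA ξ Uᴴ := by
  have hU := h.mul_conjTranspose
  refine ⟨Matrix.mem_unitaryGroup_iff.2 (by
    rw [Matrix.star_eq_conjTranspose, Matrix.conjTranspose_conjTranspose]
    exact h.conjTranspose_mul), fun j B hB => ?_⟩
  rw [← mem_supp, ← nbr_singleton]
  refine mem_supp_of_commute fun i hi C hC => ?_
  apply commute_of_evolve hU
  rw [evolve_evolve_symm hU]
  refine supp_commute ?_ (mem_supp.2 hB) (h.evolve_site hC)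
  rw [Set.disjoint_singleton_left]
  exact fun h' => hi (nbr_symm h')

theorem IsQCA.evolve_mem (h : IsQCA ξ U) {S : Set (ZMod L)} {A : Op L s} (hA : A ∈ supp S) :
    evolve U A ∈ supp (nbr ξ S) := by
  have hU := h.mul_conjTranspose
  refine mem_supp_of_commute fun k hk B hB => ?_
  rw [← evolve_evolve_symm hU B, ← evolve_mul hU, ← evolve_mul hU]
  congr 1
  refine supp_commute ?_ hA (h.symm.evolve_site hB)
  rw [Set.disjoint_left]
  intro i hi hik
  exact hk (mem_nbr_iff.2 ⟨i, hi, nbr_symm hik⟩)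

theorem IsQCA.symm_evolve_mem (h : IsQCA ξ U) {S : Set (ZMod L)} {A : Op L s} (hA : A ∈ supp S) :
    evolve Uᴴ A ∈ supp (nbr ξ S) := h.symm.evolve_mem hA

theorem IsQCA.mono (h : IsQCA ξ U) {ζ : ℕ} (hζ : ξ ≤ ζ) : IsQCA ζ U := by
  refine ⟨h.1, fun i A hA => ?_⟩
  rw [← mem_supp, ← nbr_singleton]
  refine supp_mono ?_ (h.evolve_site (mem_supp.2 hA))
  rintro _ ⟨i, hi, k, h1, h2, rfl⟩
  exact ⟨i, hi, k, by omega, by omega, rfl⟩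

theorem IsQCA.mul {ζ : ℕ} {W : Op L s} (hU : IsQCA ξ U) (hW : IsQCA ζ W) :
    IsQCA (ξ + ζ) (U * W) := by
  refine ⟨mul_mem hU.1 hW.1, fun i A hA => ?_⟩
  rw [← mem_supp, ← nbr_singleton, evolve_comp]
  refine supp_mono ?_ (hW.evolve_mem (hU.evolve_site (mem_supp.2 hA)))
  rintro _ ⟨_, ⟨i, hi, k, h1, h2, rfl⟩, k', h1', h2', rfl⟩
  exact ⟨i, hi, k + k', by push_cast; omega, by push_cast; omega, by push_cast; ring⟩

/-- The operators supported on `T` that are evolved operators supported on `S`. -/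
def bal (U : Op L s) (S T : Set (ZMod L)) : Set (Op L s) :=
  {X | evolve Uᴴ X ∈ supp S ∧ X ∈ supp T}

/-- Each of the two supports confines the other through the spreading bound. -/
theorem bal_subset (h : IsQCA ξ U) {S T S' T' : Set (ZMod L)} (hS : S ∩ nbr ξ T ⊆ S')
    (hT : T ∩ nbr ξ S ⊆ T') : bal U S T ⊆ bal U S' T' := by
  rintro X ⟨h1, h2⟩
  refine ⟨supp_mono hS (mem_supp_inter h1 (h.symm_evolve_mem h2)),
    supp_mono hT (mem_supp_inter h2 ?_)⟩
  have := h.evolve_mem h1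
  rwa [evolve_evolve_symm h.mul_conjTranspose] at this

/-- The geometric condition under which the algebra of evolved operators on `I` splits into the
parts supported on `P` and on `Q`. -/
structure Splits (ξ : ℕ) (I P Q : Set (ZMod L)) : Prop where
  nbr_subset : nbr ξ I ⊆ P ∪ Q
  disjoint : Disjoint P Q
  compl : ∀ j ∉ I, Disjoint (nbr ξ {j}) Q ∨ Disjoint (nbr ξ {j}) P

omit [NeZero L] in
theorem Splits.swap {I P Q : Set (ZMod L)} (h : Splits ξ I P Q) : Splits ξ I Q P :=
  ⟨by rw [Set.union_comm]; exact h.nbr_subset, h.disjoint.symm, fun j hj => (h.compl j hj).symm⟩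

/-- This is the locality argument behind both splittings. It is enough that `X` commutes with each
operator `Y` on a site of `P`. The preimage of `Y` lives on `I` and on the set `J` of outside sites
whose neighbourhoods miss `Q`. Expanding it in matrix units on `J`, the coefficients live on `I`,
and their evolution avoids `Q`, so it lies in `bal U I P` and commutes with `X`. The evolved
operators on `J` commute with `X` because `J` is disjoint from `I`. -/
theorem mem_supp_of_commute_bal (h : IsQCA ξ U) {I P Q : Set (ZMod L)} (hs : Splits ξ I P Q)
    {X : Op L s} (hX : evolve Uᴴ X ∈ supp I) (hc : ∀ Y ∈ bal U I P, X * Y = Y * X) :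
    X ∈ supp Q := by
  classical
  have hU := h.mul_conjTranspose
  have hXPQ : X ∈ supp (P ∪ Q) := by
    have := h.evolve_mem hX
    rw [evolve_evolve_symm hU] at this
    exact supp_mono hs.nbr_subset this
  suffices hXP : X ∈ supp Pᶜ by
    refine supp_mono ?_ (mem_supp_inter hXPQ hXP)
    rintro i ⟨hi | hi, hi'⟩
    · exact absurd hi hi'
    · exact hi
  refine mem_supp_of_commute fun p hp Y hY => ?_
  have hpP : p ∈ P := not_not.1 hp
  have hYP : Y ∈ supp P := supp_mono (by simpa using hpP) hY
  obtain ⟨J, hJ⟩ : ∃ J : Set (ZMod L), ∀ j, j ∈ J ↔ j ∉ I ∧ Disjoint (nbr ξ {j}) Q :=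
    ⟨{j | j ∉ I ∧ Disjoint (nbr ξ {j}) Q}, fun j => Iff.rfl⟩
  have hnJ : nbr ξ J ⊆ Qᶜ := by
    intro x hx
    obtain ⟨j, hj, hxj⟩ := mem_nbr_iff.1 hx
    exact fun hxQ => Set.disjoint_left.1 ((hJ j).1 hj).2 hxj hxQ
  have hJI : Disjoint J I := Set.disjoint_left.2 fun j hj hjI => ((hJ j).1 hj).1 hjI
  have hZ : evolve Uᴴ Y ∈ supp (I ∪ J) := by
    refine mem_supp_of_commute fun j hj B hB => ?_
    apply commute_of_evolve hU
    rw [evolve_evolve_symm hU]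
    refine supp_commute ?_ hYP (h.evolve_site hB)
    rw [Set.mem_union, not_or] at hj
    rcases hs.compl j hj.1 with h1 | h1
    · exact absurd ((hJ j).2 ⟨hj.1, h1⟩) hj.2
    · exact h1.symm
  obtain ⟨Z, hYZ, hZc, hZdef⟩ :=
    FactorRep.exists_commutant_decomposition (embOp J) (evolve Uᴴ Y)
  have hZI : ∀ i j, Z i j ∈ supp I := by
    intro i j
    have h1 : Z i j ∈ supp (I ∪ J) := by
      rw [hZdef]
      exact sum_mem fun k _ => mul_mem (mul_mem (supp_mono Set.subset_union_right (embOp_mem _ _)) hZ)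
        (supp_mono Set.subset_union_right (embOp_mem _ _))
    have h2 : Z i j ∈ supp Jᶜ := by
      refine mem_supp_of_commute fun k hk B hB => ?_
      obtain ⟨b, rfl⟩ := supp_mono (T := J) (by simpa using hk) hB
      exact (hZc i j b).symm
    refine supp_mono ?_ (mem_supp_inter h1 h2)
    rintro x ⟨hx | hx, hx'⟩
    · exact hx
    · exact absurd hx hx'
  have hZP : ∀ i j, evolve U (Z i j) ∈ bal U I P := by
    intro i j
    refine ⟨by rw [evolve_symm_evolve hU]; exact hZI i j, ?_⟩
    have h1 : evolve U (Z i j) ∈ supp (P ∪ Q) := supp_mono hs.nbr_subset (h.evolve_mem (hZI i j))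
    have h2 : evolve U (Z i j) ∈ supp Qᶜ := by
      have h3 : ∀ E, evolve U (embOp J E) ∈ supp Qᶜ := fun E =>
        supp_mono hnJ (h.evolve_mem (embOp_mem J E))
      have h4 : Y ∈ supp Qᶜ := supp_mono (Set.subset_compl_iff_disjoint_right.2 hs.disjoint) hYP
      rw [hZdef]
      change evolveHom U hU _ ∈ _
      rw [map_sum]
      refine sum_mem fun k _ => ?_
      rw [map_mul, map_mul]
      refine mul_mem (mul_mem (h3 _) ?_) (h3 _)
      change evolve U (evolve Uᴴ Y) ∈ _
      rwa [evolve_evolve_symm hU]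
    refine supp_mono ?_ (mem_supp_inter h1 h2)
    rintro x ⟨hx | hx, hx'⟩
    · exact hx
    · exact absurd hx hx'
  have hYs : Y = ∑ i, ∑ j, evolve U (embOp J (Matrix.single i j 1)) * evolve U (Z i j) := by
    have := congrArg (evolveHom U hU) hYZ
    simp only [map_sum, map_mul] at this
    change evolve U (evolve Uᴴ Y) = _ at this
    rw [evolve_evolve_symm hU] at this
    exact this
  rw [hYs]
  simp only [Finset.mul_sum, Finset.sum_mul]
  refine Finset.sum_congr rfl fun i _ => Finset.sum_congr rfl fun j _ => ?_
  have h5 : X * evolve U (embOp J (Matrix.single i j 1))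
      = evolve U (embOp J (Matrix.single i j 1)) * X := by
    rw [← evolve_evolve_symm hU X, ← evolve_mul hU, ← evolve_mul hU]
    congr 1
    exact supp_commute hJI.symm hX (embOp_mem _ _)
  rw [← mul_assoc, h5, mul_assoc, hc _ (hZP i j), mul_assoc]

theorem commutant_bal (h : IsQCA ξ U) {I P Q : Set (ZMod L)} (hs : Splits ξ I P Q) :
    {X | evolve Uᴴ X ∈ supp I ∧ ∀ Y ∈ bal U I P, X * Y = Y * X} = bal U I Q := by
  ext X
  refine ⟨fun hX => ⟨hX.1, mem_supp_of_commute_bal h hs hX.1 hX.2⟩, fun hX => ⟨hX.1, fun Y hY => ?_⟩⟩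
  exact supp_commute hs.disjoint.symm hX.2 hY.2

end Spreading

/-! ### Transfer between the two halves of an interval algebra -/

section Transfer

variable {G : Type*} [Group G] {L : ℕ} [NeZero L] {s : Type} [Fintype s] [DecidableEq s]
  [Nonempty s] {ξ : ℕ} {U : Op L s} {μ : G →* Matrix.unitaryGroup s ℂ}

omit [Nonempty s] in
theorem symm_unitary (μ : G →* Matrix.unitaryGroup s ℂ) (g : G) :
    ((μ g).val)ᴴ * (μ g).val = 1 := Matrix.mem_unitaryGroup_iff'.1 (μ g).2

/-- The global symmetry operators. -/
noncomputable def symV (L : ℕ) [NeZero L] (μ : G →* Matrix.unitaryGroup s ℂ) (g : G) : Op L s :=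
  symOn (μ g).val Set.univ

omit [Nonempty s] in
theorem symV_unitary (g : G) : (symV L μ g)ᴴ * symV L μ g = 1 := symOn_unitary (symm_unitary μ g) _

omit [Nonempty s] in
theorem symV_unitary' (g : G) : symV L μ g * (symV L μ g)ᴴ = 1 :=
  mul_eq_one_comm.1 (symV_unitary g)

omit [Nonempty s] in
theorem IsSymmetric.evolve_conj (hsym : IsSymmetric (fun g => (μ g).val) U) (g : G) (A : Op L s) :
    symV L μ g * evolve U A * (symV L μ g)ᴴ = evolve U (symV L μ g * A * (symV L μ g)ᴴ) := by
  have h1 : U * symV L μ g = symV L μ g * U := hsym g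
  have h2 : symV L μ g * Uᴴ = Uᴴ * symV L μ g := by
    calc symV L μ g * Uᴴ = symV L μ g * Uᴴ * (symV L μ g)ᴴ * symV L μ g := by
          rw [mul_assoc _ _ (symV L μ g), symV_unitary, mul_one]
      _ = symV L μ g * (symV L μ g * U)ᴴ * symV L μ g := by
          rw [Matrix.conjTranspose_mul]; simp only [mul_assoc]
      _ = Uᴴ * symV L μ g := by
          rw [← h1, Matrix.conjTranspose_mul, ← mul_assoc, symV_unitary', one_mul]
  have h3 : U * (symV L μ g)ᴴ = (symV L μ g)ᴴ * U := by
    simpa using congrArg Matrix.conjTranspose h2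
  rw [evolve, evolve]
  calc symV L μ g * (Uᴴ * A * U) * (symV L μ g)ᴴ
      = (symV L μ g * Uᴴ) * A * (U * (symV L μ g)ᴴ) := by simp only [mul_assoc]
    _ = _ := by rw [h2, h3]; simp only [mul_assoc]

omit [Nonempty s] in
theorem IsSymmetric.symm (hsym : IsSymmetric (fun g => (μ g).val) U) :
    IsSymmetric (fun g => (μ g).val) Uᴴ := by
  intro g
  have h1 : U * symOn (μ g⁻¹).val Set.univ = symOn (μ g⁻¹).val Set.univ * U := hsym g⁻¹
  have h2 := congrArg Matrix.conjTranspose h1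
  rw [Matrix.conjTranspose_mul, Matrix.conjTranspose_mul, symOn_conjTranspose] at h2
  have h3 : ((μ g⁻¹).val)ᴴ = (μ g).val := by
    rw [map_inv, Matrix.UnitaryGroup.inv_val, Matrix.star_eq_conjTranspose,
      Matrix.conjTranspose_conjTranspose]
  rw [h3] at h2
  exact h2.symm

open Classical in
theorem card_fun_set (S : Set (ZMod L)) : Fintype.card (S → s) = Fintype.card s ^ S.ncard := by
  rw [Fintype.card_fun, Set.ncard_eq_toFinset_card', Set.toFinset_card]

/-- Passing from one half of the evolved operators on `I` to the other half. -/
theorem FactorRep.evolve_transfer (h : IsQCA ξ U) (hsym : IsSymmetric (fun g => (μ g).val) U)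
    {I P Q : Set (ZMod L)} (hs : Splits ξ I P Q) {r : ℕ} {R : G → Op L s}
    (hR : FactorRep (symV L μ) (bal U I P) r R) :
    ∃ l : ℕ, FactorRep (symV L μ) (bal U I Q) l
        (fun g => (R g)ᴴ * evolve U (symOn (μ g).val I)) ∧
      r * l = Fintype.card s ^ I.ncard ∧
      ∀ g, ntr (R g) * ntr ((R g)ᴴ * evolve U (symOn (μ g).val I)) = ntr (μ g).val ^ I.ncard := by
  classical
  have hU := h.mul_conjTranspose
  let Ψ : Matrix (I → s) (I → s) ℂ →⋆ₐ[ℂ] Op L s := (evolveHom U hU).comp (embOp I)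
  have hΨ : ∀ X, X ∈ Set.range Ψ ↔ evolve Uᴴ X ∈ supp I := by
    intro X
    constructor
    · rintro ⟨x, rfl⟩
      change evolve Uᴴ (evolve U (embOp I x)) ∈ _
      rw [evolve_symm_evolve hU]
      exact embOp_mem _ _
    · rintro ⟨x, hx⟩
      refine ⟨x, ?_⟩
      change evolve U (embOp I x) = X
      rw [← evolve_evolve_symm hU X]
      exact congrArg (evolve U) hx
  obtain ⟨l, hl, hcard, htr⟩ := hR.commutant Ψ (fun X hX => (hΨ X).2 hX.1)
    (fun g => evolve U (symOn (μ g).val I))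
    (fun g => (hΨ _).2 (by rw [evolve_symm_evolve hU]; exact symOn_mem_supp _ _))
    (fun g => by
      rw [← evolve_conjTranspose, ← evolve_mul hU, symOn_unitary (symm_unitary μ g)]
      exact map_one (evolveHom U hU))
    (fun g k => by rw [← evolve_mul hU, symOn_mul, _root_.map_mul μ]; rfl)
    (fun g X hX => by
      rw [← evolve_evolve_symm hU X, hsym.evolve_conj, symV,
        symOn_univ_conj (symm_unitary μ g) ((hΨ X).1 hX), evolve_mul hU, evolve_mul hU,
        evolve_conjTranspose])
  refine ⟨l, hl.congr_set ?_, by rw [hcard, card_fun_set], fun g => by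
    rw [htr, ntr_evolve hU, ntr_symOn]⟩
  rw [← commutant_bal h hs]
  ext X
  simp only [Set.mem_ofPred_eq, hΨ]

/-- This is the splitting for the inverse QCA `Uᴴ`, for which the two supports in `bal` exchange
roles. -/
theorem commutant_bal_static (h : IsQCA ξ U) {J P Q : Set (ZMod L)} (hs : Splits ξ J P Q) :
    {X | X ∈ supp J ∧ ∀ Y ∈ bal U P J, X * Y = Y * X} = bal U Q J := by
  have hU := h.mul_conjTranspose
  have hU' := h.symm.mul_conjTranspose
  ext X
  constructor
  · rintro ⟨hX, hc⟩
    refine ⟨mem_supp_of_commute_bal h.symm hs ?_ fun Y hY => ?_, hX⟩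
    · rw [Matrix.conjTranspose_conjTranspose, evolve_evolve_symm hU]; exact hX
    · obtain ⟨hY1, hY2⟩ := hY
      rw [Matrix.conjTranspose_conjTranspose] at hY1
      apply commute_of_evolve hU
      rw [evolve_evolve_symm hU]
      exact hc _ ⟨by rw [evolve_symm_evolve hU]; exact hY2, hY1⟩
  · rintro ⟨h1, h2⟩
    refine ⟨h2, fun Y hY => ?_⟩
    apply commute_of_evolve hU'
    exact supp_commute hs.disjoint.symm h1 hY.1

/-- Passing from one half of the operators on `J` to the other half. -/
theorem FactorRep.static_transfer (h : IsQCA ξ U)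
    {J P Q : Set (ZMod L)} (hs : Splits ξ J P Q) {r : ℕ} {R : G → Op L s}
    (hR : FactorRep (symV L μ) (bal U P J) r R) :
    ∃ l : ℕ, FactorRep (symV L μ) (bal U Q J) l (fun g => (R g)ᴴ * symOn (μ g).val J) ∧
      r * l = Fintype.card s ^ J.ncard ∧
      ∀ g, ntr (R g) * ntr ((R g)ᴴ * symOn (μ g).val J) = ntr (μ g).val ^ J.ncard := by
  classical
  obtain ⟨l, hl, hcard, htr⟩ := hR.commutant (embOp J) (fun X hX => hX.2)
    (fun g => symOn (μ g).val J) (fun g => symOn_mem_supp _ _)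
    (fun g => symOn_unitary (symm_unitary μ g) _)
    (fun g k => by rw [symOn_mul, _root_.map_mul μ]; rfl)
    (fun g X hX => symOn_univ_conj (symm_unitary μ g) hX)
  refine ⟨l, hl.congr_set ?_, by rw [hcard, card_fun_set], fun g => by rw [htr, ntr_symOn]⟩
  rw [← commutant_bal_static h hs]
  rfl

end Transfer

end QCA

namespace QCA

/-! ### Segments of the ring -/

section Segments

variable {L : ℕ} [NeZero L]

/-- The sites `x, x + 1, …, y - 1`. -/
def seg (L : ℕ) (x y : ℤ) : Set (ZMod L) := {z | ∃ k : ℤ, x ≤ k ∧ k < y ∧ (k : ZMod L) = z}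

omit [NeZero L] in
theorem eq_of_cast_eq {k k' : ℤ} (h : (k : ZMod L) = k') (h1 : k - k' < L) (h2 : k' - k < L) :
    k = k' := by
  rw [ZMod.intCast_eq_intCast_iff, Int.modEq_iff_dvd] at h
  have := Int.eq_zero_of_abs_lt_dvd h (by rw [abs_lt]; constructor <;> omega)
  omega

omit [NeZero L] in
theorem mem_seg {k x y : ℤ} (h1 : x ≤ k) (h2 : k < y) : (k : ZMod L) ∈ seg L x y := ⟨k, h1, h2, rfl⟩

omit [NeZero L] in
theorem seg_mono {x y x' y' : ℤ} (h1 : x' ≤ x) (h2 : y ≤ y') : seg L x y ⊆ seg L x' y' := by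
  rintro _ ⟨k, hk1, hk2, rfl⟩
  exact mem_seg (by omega) (by omega)

omit [NeZero L] in
theorem nbr_seg_subset (ξ : ℕ) (x y : ℤ) : nbr ξ (seg L x y) ⊆ seg L (x - ξ) (y + ξ) := by
  rintro _ ⟨_, ⟨k, h1, h2, rfl⟩, j, h3, h4, rfl⟩
  exact ⟨k + j, by omega, by omega, by push_cast; ring⟩

omit [NeZero L] in
theorem seg_union {x y z : ℤ} (h1 : x ≤ y) (h2 : y ≤ z) : seg L x y ∪ seg L y z = seg L x z := by
  ext i
  constructor
  · rintro (⟨k, hk1, hk2, rfl⟩ | ⟨k, hk1, hk2, rfl⟩)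
    · exact mem_seg (by omega) (by omega)
    · exact mem_seg (by omega) (by omega)
  · rintro ⟨k, hk1, hk2, rfl⟩
    rcases lt_or_ge k y with h | h
    · exact Or.inl (mem_seg (by omega) (by omega))
    · exact Or.inr (mem_seg (by omega) (by omega))

omit [NeZero L] in
theorem seg_disjoint {x y x' y' : ℤ} (h1 : y ≤ x') (h2 : y' ≤ x + L) :
    Disjoint (seg L x y) (seg L x' y') := by
  rw [Set.disjoint_left]
  rintro _ ⟨k, hk1, hk2, rfl⟩ ⟨k', hk1', hk2', hkk⟩
  have := eq_of_cast_eq hkk (by omega) (by omega)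
  omega

theorem exists_lift_seg (i : ZMod L) (x : ℤ) : ∃ k : ℤ, x ≤ k ∧ k < x + L ∧ (k : ZMod L) = i := by
  have hL : (0 : ℤ) < L := by exact_mod_cast NeZero.pos L
  refine ⟨x + ((i.cast : ℤ) - x) % L, ?_, ?_, ?_⟩
  · have := Int.emod_nonneg ((i.cast : ℤ) - x) hL.ne'
    omega
  · have := Int.emod_lt_of_pos ((i.cast : ℤ) - x) hL
    omega
  · push_cast
    ring

theorem ncard_seg {x y : ℤ} (h1 : x ≤ y) (h2 : y ≤ x + L) : (seg L x y).ncard = (y - x).toNat := by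
  have : seg L x y = (fun k : ℤ => (k : ZMod L)) '' (Finset.Ico x y : Set ℤ) := by
    ext i
    simp [seg, and_assoc]
  rw [this, Set.InjOn.ncard_image, Set.ncard_coe_finset, Int.card_Ico]
  intro k hk k' hk' hkk
  simp only [Finset.coe_Ico, Set.mem_Ico] at hk hk'
  exact eq_of_cast_eq hkk (by omega) (by omega)

omit [NeZero L] in
theorem seg_congr {x x' : ℤ} (h : (x : ZMod L) = x') (w : ℤ) :
    seg L x (x + w) = seg L x' (x' + w) := by
  have key : ∀ {x x' : ℤ}, (x : ZMod L) = x' → seg L x (x + w) ⊆ seg L x' (x' + w) := by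
    rintro x x' h _ ⟨k, h1, h2, rfl⟩
    exact ⟨k - x + x', by omega, by omega, by push_cast; rw [h]; ring⟩
  exact Set.Subset.antisymm (key h) (key h.symm)

omit [NeZero L] in
theorem arc_eq_seg (k : ℤ) (m : ℕ) : arc (k : ZMod L) m = seg L k (k + m) := by
  ext x
  constructor
  · rintro ⟨j, hj, rfl⟩
    exact ⟨k + j, by omega, by omega, by push_cast; ring⟩
  · rintro ⟨j, h1, h2, rfl⟩
    refine ⟨(j - k).toNat, by omega, ?_⟩
    have h3 : (((j - k).toNat : ℤ) : ZMod L) = ((j - k : ℤ) : ZMod L) := by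
      rw [Int.toNat_of_nonneg (by omega)]
    push_cast at h3
    rw [h3]; ring

/-- The complement of `[x, y)` has at least `4 ξ + 1` sites, so none of them is within distance `ξ`
of both halves. -/
theorem splits_seg {ξ : ℕ} {x y z : ℤ} (h1 : x + ξ ≤ z) (h2 : z + ξ ≤ y)
    (hL : y - x + 4 * ξ + 1 ≤ L) :
    Splits ξ (seg L x y) (seg L z (y + ξ)) (seg L (x - ξ) z) := by
  refine ⟨?_, ?_, fun j hj => ?_⟩
  · rw [Set.union_comm, seg_union (by omega) (by omega)]
    exact nbr_seg_subset ξ x y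
  · exact (seg_disjoint (by omega) (by omega)).symm
  · obtain ⟨k, hk1, hk2, rfl⟩ := exists_lift_seg j x
    have hky : y ≤ k := by
      by_contra h
      exact hj (mem_seg hk1 (by omega))
    have hsing : ({(k : ZMod L)} : Set (ZMod L)) ⊆ seg L k (k + 1) := by
      rintro _ rfl
      exact mem_seg (by omega) (by omega)
    have hn : nbr ξ {(k : ZMod L)} ⊆ seg L (k - ξ) (k + 1 + ξ) := by
      intro i hi
      obtain ⟨i', hi', hi''⟩ := mem_nbr_iff.1 hi
      exact nbr_seg_subset ξ _ _ (mem_nbr_iff.2 ⟨i', hsing hi', hi''⟩)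
    rcases lt_or_ge (k + ξ) (x - ξ + L) with h | h
    · exact Or.inl (Set.disjoint_of_subset_left hn (seg_disjoint (by omega) (by omega)).symm)
    · exact Or.inr (Set.disjoint_of_subset_left hn (seg_disjoint (by omega) (by omega)).symm)

end Segments

/-! ### Boundary algebras and translation of the cuts -/

section RightLeft

variable {L : ℕ} [NeZero L] {s : Type} [Fintype s] [DecidableEq s] [Nonempty s] {ξ : ℕ} {U : Op L s}

/-- The boundary algebra right of the cut `c` of the evolved operators on sites left of `b`. -/
def right (ξ : ℕ) (U : Op L s) (b c : ℤ) : Set (Op L s) :=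
  bal U (seg L (c - ξ) b) (seg L c (b + ξ))

/-- The boundary algebra left of the cut `c` of the evolved operators on sites right of `a`. -/
def left (ξ : ℕ) (U : Op L s) (a c : ℤ) : Set (Op L s) :=
  bal U (seg L a (c + ξ)) (seg L (a - ξ) c)

omit [NeZero L] in
theorem seg_inter_nbr_subset {x y x' y' x'' y'' : ℤ} (h1 : x'' ≤ x ∨ x'' ≤ x' - ξ)
    (h2 : y ≤ y'' ∨ y' + ξ ≤ y'') (h3 : y - (x' - ξ) ≤ L) (h4 : y' + ξ - x ≤ L) :
    seg L x y ∩ nbr ξ (seg L x' y') ⊆ seg L x'' y'' := by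
  rintro _ ⟨⟨k, hk1, hk2, rfl⟩, hk⟩
  obtain ⟨k', hk1', hk2', hkk⟩ := nbr_seg_subset ξ _ _ hk
  have := eq_of_cast_eq hkk (by omega) (by omega)
  exact mem_seg (by omega) (by omega)

/-- Sites more than `ξ` beyond the cuts contribute nothing, so the outer ends `a` and `e` do not
matter. -/
theorem bal_eq_right (h : IsQCA ξ U) {a b c e : ℤ} (h1 : a + ξ ≤ c) (h2 : c + ξ ≤ b)
    (h3 : b + ξ ≤ e) (hL : e - a + ξ ≤ L) :
    bal U (seg L a b) (seg L c e) = right ξ U b c := by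
  apply Set.Subset.antisymm
  · exact bal_subset h (seg_inter_nbr_subset (by omega) (by omega) (by omega) (by omega))
      (seg_inter_nbr_subset (by omega) (by omega) (by omega) (by omega))
  · exact bal_subset h (Set.inter_subset_left.trans (seg_mono (by omega) (by omega)))
      (Set.inter_subset_left.trans (seg_mono (by omega) (by omega)))

theorem bal_eq_left (h : IsQCA ξ U) {a b c e : ℤ} (h1 : c + ξ ≤ b) (h2 : a + ξ ≤ c)
    (h3 : e + ξ ≤ a) (hL : b - e + ξ ≤ L) :
    bal U (seg L a b) (seg L e c) = left ξ U a c := by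
  apply Set.Subset.antisymm
  · exact bal_subset h (seg_inter_nbr_subset (by omega) (by omega) (by omega) (by omega))
      (seg_inter_nbr_subset (by omega) (by omega) (by omega) (by omega))
  · exact bal_subset h (Set.inter_subset_left.trans (seg_mono (by omega) (by omega)))
      (Set.inter_subset_left.trans (seg_mono (by omega) (by omega)))

theorem right_mono_spread (h : IsQCA ξ U) {ζ : ℕ} (hζ : ξ ≤ ζ) {b c : ℤ} (h2 : c + ξ ≤ b)
    (hL : b - c + 3 * ζ ≤ L) : right ζ U b c = right ξ U b c :=
  bal_eq_right h (by omega) (by omega) (by omega) (by omega)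

variable {G : Type*} [Group G] {μ : G →* Matrix.unitaryGroup s ℂ} {r : ℕ} {R : G → Op L s}

/-- The evolved operators on `[a, b)` factor at `c` into a left and a right boundary algebra.
Returning by `left_to_right_evolve` with another `b` moves the source cut while `c` stays fixed. -/
theorem right_to_left_evolve (h : IsQCA ξ U) (hsym : IsSymmetric (fun g => (μ g).val) U)
    {a b c : ℤ} (h1 : a + ξ ≤ c) (h2 : c + ξ ≤ b) (hL : b - a + 4 * ξ + 1 ≤ L)
    (hR : FactorRep (symV L μ) (right ξ U b c) r R) :
    ∃ l : ℕ, FactorRep (symV L μ) (left ξ U a c) l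
        (fun g => (R g)ᴴ * evolve U (symOn (μ g).val (seg L a b))) ∧
      r * l = Fintype.card s ^ (b - a).toNat ∧
      ∀ g, ntr (R g) * ntr ((R g)ᴴ * evolve U (symOn (μ g).val (seg L a b)))
        = ntr (μ g).val ^ (b - a).toNat := by
  rw [← bal_eq_right (a := a) (e := b + ξ) h h1 h2 le_rfl (by omega)] at hR
  rw [← bal_eq_left (b := b) (e := a - ξ) h h2 h1 (by omega) (by omega)]
  have := hR.evolve_transfer h hsym (splits_seg h1 h2 hL)
  rwa [ncard_seg (by omega) (by omega)] at this

theorem left_to_right_evolve (h : IsQCA ξ U) (hsym : IsSymmetric (fun g => (μ g).val) U)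
    {a b c : ℤ} (h1 : a + ξ ≤ c) (h2 : c + ξ ≤ b) (hL : b - a + 4 * ξ + 1 ≤ L)
    (hR : FactorRep (symV L μ) (left ξ U a c) r R) :
    ∃ l : ℕ, FactorRep (symV L μ) (right ξ U b c) l
        (fun g => (R g)ᴴ * evolve U (symOn (μ g).val (seg L a b))) ∧
      r * l = Fintype.card s ^ (b - a).toNat ∧
      ∀ g, ntr (R g) * ntr ((R g)ᴴ * evolve U (symOn (μ g).val (seg L a b)))
        = ntr (μ g).val ^ (b - a).toNat := by
  rw [← bal_eq_left (b := b) (e := a - ξ) h h2 h1 (by omega) (by omega)] at hR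
  rw [← bal_eq_right (a := a) (e := b + ξ) h h1 h2 le_rfl (by omega)]
  have := hR.evolve_transfer h hsym (splits_seg h1 h2 hL).swap
  rwa [ncard_seg (by omega) (by omega)] at this

/-- The operators on `[c, e)` factor into those evolved from the left and from the right of `b`.
Returning by `left_to_right_static` with another `c` moves the target cut while `b` stays fixed. -/
theorem right_to_left_static (h : IsQCA ξ U)
    {b c e : ℤ} (h1 : c + ξ ≤ b) (h2 : b + ξ ≤ e) (hL : e - c + 4 * ξ + 1 ≤ L)
    (hR : FactorRep (symV L μ) (right ξ U b c) r R) :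
    ∃ l : ℕ, FactorRep (symV L μ) (left ξ U b e) l
        (fun g => (R g)ᴴ * symOn (μ g).val (seg L c e)) ∧
      r * l = Fintype.card s ^ (e - c).toNat ∧
      ∀ g, ntr (R g) * ntr ((R g)ᴴ * symOn (μ g).val (seg L c e))
        = ntr (μ g).val ^ (e - c).toNat := by
  rw [← bal_eq_right (a := c - ξ) (e := e) h (by omega) h1 h2 (by omega)] at hR
  rw [← bal_eq_left (b := e + ξ) (e := c) h (by omega) h2 h1 (by omega)]
  have := hR.static_transfer h (splits_seg h1 h2 hL).swap
  rwa [ncard_seg (by omega) (by omega)] at this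

theorem left_to_right_static (h : IsQCA ξ U)
    {b c e : ℤ} (h1 : c + ξ ≤ b) (h2 : b + ξ ≤ e) (hL : e - c + 4 * ξ + 1 ≤ L)
    (hR : FactorRep (symV L μ) (left ξ U b e) r R) :
    ∃ l : ℕ, FactorRep (symV L μ) (right ξ U b c) l
        (fun g => (R g)ᴴ * symOn (μ g).val (seg L c e)) ∧
      r * l = Fintype.card s ^ (e - c).toNat ∧
      ∀ g, ntr (R g) * ntr ((R g)ᴴ * symOn (μ g).val (seg L c e))
        = ntr (μ g).val ^ (e - c).toNat := by
  rw [← bal_eq_left (b := e + ξ) (e := c) h (by omega) h2 h1 (by omega)] at hR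
  rw [← bal_eq_right (a := c - ξ) (e := e) h (by omega) h1 h2 (by omega)]
  have := hR.static_transfer h (splits_seg h1 h2 hL)
  rwa [ncard_seg (by omega) (by omega)] at this

/-- `R g` is the symmetry operator of the site `j` times an operator commuting with everything on
`j`, so its normalized trace has `ntr (μ g)` as a factor. This covers the group elements for which
the product formulas cannot be divided. -/
theorem ntr_eq_zero_of_site {𝓑 : Set (Op L s)} (hR : FactorRep (symV L μ) 𝓑 r R) (j : ZMod L)
    (hj : ∀ A ∈ (supp {j} : StarSubalgebra ℂ (Op L s)), A ∈ 𝓑) {g : G}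
    (hg : ntr (μ g).val = 0) : ntr (R g) = 0 := by
  classical
  obtain ⟨S, hS⟩ : ∃ S : Set (ZMod L), S = {j} := ⟨_, rfl⟩
  rw [← hS] at hj
  set u : Op L s := symOn (μ g).val S with hu
  have huu : uᴴ * u = 1 := symOn_unitary (symm_unitary μ g) _
  have huu' : u * uᴴ = 1 := mul_eq_one_comm.1 huu
  have hRu := hR.unitary g
  obtain ⟨φ, ρ, -, -, hV⟩ := id hR
  have hc : ∀ X ∈ (supp S : StarSubalgebra ℂ (Op L s)), X * (uᴴ * R g) = (uᴴ * R g) * X := by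
    intro X hX
    have h1 := hV g X (hj X hX)
    rw [symV, symOn_univ_conj (symm_unitary μ g) hX, ← hu] at h1
    calc X * (uᴴ * R g) = uᴴ * (u * X * uᴴ) * R g := by
          simp only [← mul_assoc]; rw [huu, one_mul]
      _ = uᴴ * R g * X * ((R g)ᴴ * R g) := by rw [h1]; simp only [mul_assoc]
      _ = _ := by rw [hRu, mul_one]
  obtain ⟨x, hx⟩ := symOn_mem_supp (s := s) (μ g).val S
  have hx' : embOp S x = u := hx
  have h2 : R g = embOp S x * (uᴴ * R g) := by rw [hx', ← mul_assoc, huu', one_mul]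
  rw [h2, ntr_map_mul_of_commute _ _ fun Y => hc _ (embOp_mem _ Y)]
  have h3 : ntr x = 0 := by
    rw [← ntr_map (embOp S) x, hx', hu, ntr_symOn, hg, hS]; simp
  rw [h3, zero_mul]

theorem right_ntr_eq_zero (h : IsQCA ξ U) {b c : ℤ} (hbc : c + ξ < b)
    (hR : FactorRep (symV L μ) (right ξ U b c) r R) {g : G} (hg : ntr (μ g).val = 0) :
    ntr (R g) = 0 := by
  refine ntr_eq_zero_of_site hR (c : ZMod L) (fun A hA => ?_) hg
  have hs : ({(c : ZMod L)} : Set (ZMod L)) ⊆ seg L c (c + 1) := by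
    rintro _ rfl; exact mem_seg le_rfl (by omega)
  have hA' := supp_mono hs hA
  exact ⟨supp_mono ((nbr_seg_subset ξ _ _).trans (seg_mono le_rfl (by omega)))
    (h.symm_evolve_mem hA'), supp_mono (seg_mono le_rfl (by omega)) hA'⟩

theorem left_ntr_eq_zero (h : IsQCA ξ U) {a c : ℤ} (hac : a + ξ < c)
    (hR : FactorRep (symV L μ) (left ξ U a c) r R) {g : G} (hg : ntr (μ g).val = 0) :
    ntr (R g) = 0 := by
  refine ntr_eq_zero_of_site hR ((c - 1 : ℤ) : ZMod L) (fun A hA => ?_) hg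
  have hs : ({((c - 1 : ℤ) : ZMod L)} : Set (ZMod L)) ⊆ seg L (c - 1) c := by
    rintro _ rfl; exact mem_seg le_rfl (by omega)
  have hA' := supp_mono hs hA
  exact ⟨supp_mono ((nbr_seg_subset ξ _ _).trans (seg_mono (by omega) le_rfl))
    (h.symm_evolve_mem hA'), supp_mono (seg_mono (by omega) le_rfl) hA'⟩

theorem symOn_seg_mul (g : G) {x y z : ℤ} (h1 : x ≤ y) (h2 : y ≤ z) (h3 : z ≤ x + L) :
    symOn (μ g).val (seg L x y) * symOn (μ g).val (seg L y z) = symOn (μ g).val (seg L x z) := by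
  rw [symOn_union _ (seg_disjoint le_rfl h3), seg_union h1 h2]

theorem left_right_commute {a b c : ℤ} (hL : b - a + 2 * ξ ≤ L) {X Y : Op L s}
    (hX : X ∈ left ξ U a c) (hY : Y ∈ right ξ U b c) : X * Y = Y * X :=
  supp_commute (seg_disjoint le_rfl (by omega)) hX.2 hY.2

/-- The supports may overlap near `b`; it is the preimages under the evolution that are disjoint. -/
theorem right_left_commute (h : IsQCA ξ U) {b c e : ℤ} (hL : e - c + 2 * ξ ≤ L) {X Y : Op L s}
    (hX : X ∈ right ξ U b c) (hY : Y ∈ left ξ U b e) : X * Y = Y * X :=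
  commute_of_evolve h.symm.mul_conjTranspose
    (supp_commute (seg_disjoint le_rfl (by omega)) hX.1 hY.1)

/-- Translation of the cut: the invariants of the boundary algebra do not change. -/
theorem right_shift (h : IsQCA ξ U) (hsym : IsSymmetric (fun g => (μ g).val) U)
    {b c : ℤ} (hbc : c + ξ < b) (m : ℕ) (hL : b - c + m + 6 * ξ + 1 ≤ L)
    (hR : FactorRep (symV L μ) (right ξ U b c) r R) :
    FactorRep (symV L μ) (right ξ U (b + m) (c + m)) r
      (fun g => (symOn (μ g).val (seg L c (c + m)))ᴴ * R g *
        evolve U (symOn (μ g).val (seg L b (b + m)))) ∧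
    ∀ g, ntr ((symOn (μ g).val (seg L c (c + m)))ᴴ * R g *
        evolve U (symOn (μ g).val (seg L b (b + m)))) = ntr (R g) := by
  have hU := h.mul_conjTranspose
  -- Two evolved transfers through a left algebra at `c` move `b` to `b + m`; two static transfers
  -- through a left algebra at `b + m + ξ` move `c` to `c + m`. The first pair multiplies the
  -- dimension by `d ^ m`, with `d` that of a site, and the second divides by it.
  obtain ⟨l, hl, hrl, htl⟩ := right_to_left_evolve (a := c - ξ) h hsym (by omega) hbc.le
    (by omega) hR
  obtain ⟨r₁, hr₁, hlr₁, htr₁⟩ := left_to_right_evolve (b := b + m) h hsym (by omega) (by omega)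
    (by omega) hl
  obtain ⟨l₁, hl₁, hrl₁, htl₁⟩ := right_to_left_static (e := b + m + ξ) h (by omega) le_rfl
    (by omega) hr₁
  obtain ⟨r₂, hr₂, hlr₂, htr₂⟩ := left_to_right_static (c := c + m) h (by omega) le_rfl
    (by omega) hl₁
  set K : G → Op L s := fun g => (R g)ᴴ * evolve U (symOn (μ g).val (seg L (c - ξ) b)) with hK
  set R₁ : G → Op L s := fun g => (K g)ᴴ * evolve U (symOn (μ g).val (seg L (c - ξ) (b + m)))
    with hR₁
  set K₁ : G → Op L s := fun g => (R₁ g)ᴴ * symOn (μ g).val (seg L c (b + m + ξ)) with hK₁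
  set R₂ : G → Op L s := fun g => (K₁ g)ᴴ * symOn (μ g).val (seg L (c + m) (b + m + ξ)) with hR₂
  have e1 : ∀ g, R₁ g = R g * evolve U (symOn (μ g).val (seg L b (b + m))) := by
    intro g
    have h1 : evolve U (symOn (μ g).val (seg L (c - ξ) b)) = R g * K g := by
      rw [hK]; simp only; rw [← mul_assoc, hR.unitary', one_mul]
    have h2 : K g * R g = R g * K g := left_right_commute (by omega) (hl.mem g) (hR.mem g)
    simp only [hR₁]
    rw [← symOn_seg_mul (y := b) g (by omega) (by omega) (by omega), evolve_mul hU, h1, ← h2,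
      ← mul_assoc, ← mul_assoc, hl.unitary, one_mul]
  have e2 : ∀ g, R₂ g = (symOn (μ g).val (seg L c (c + m)))ᴴ * R₁ g := by
    intro g
    have h1 : symOn (μ g).val (seg L c (b + m + ξ)) = R₁ g * K₁ g := by
      rw [hK₁]; simp only; rw [← mul_assoc, hr₁.unitary', one_mul]
    have h2 : R₁ g * K₁ g = K₁ g * R₁ g :=
      right_left_commute h (by omega) (hr₁.mem g) (hl₁.mem g)
    have h3 := symOn_seg_mul (L := L) (μ := μ) (x := c) (y := c + m) (z := b + m + ξ) g (by omega)
      (by omega) (by omega)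
    have h4 : symOn (μ g).val (seg L (c + m) (b + m + ξ))
        = (symOn (μ g).val (seg L c (c + m)))ᴴ * (K₁ g * R₁ g) := by
      rw [← h2, ← h1, ← h3, ← mul_assoc, symOn_unitary (symm_unitary μ g), one_mul]
    have h5 : (K₁ g)ᴴ * (symOn (μ g).val (seg L c (c + m)))ᴴ
        = (symOn (μ g).val (seg L c (c + m)))ᴴ * (K₁ g)ᴴ := by
      have hd : Disjoint (seg L c (c + m)) (seg L (b + m - ξ) (b + m + ξ)) :=
        seg_disjoint (by omega) (by omega)
      exact supp_commute hd.symm (star_mem (hl₁.mem g).2) (star_mem (symOn_mem_supp _ _))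
    simp only [hR₂]
    rw [h4, ← mul_assoc, h5, mul_assoc, ← mul_assoc (K₁ g)ᴴ, hl₁.unitary, one_mul]
  have e3 : ∀ g, R₂ g = (symOn (μ g).val (seg L c (c + m)))ᴴ * R g *
        evolve U (symOn (μ g).val (seg L b (b + m))) := fun g => by
    rw [e2, e1, mul_assoc]
  have hd : 0 < Fintype.card s := Fintype.card_pos
  have x1 : (b + m - (c - ξ)).toNat = (b - (c - ξ)).toNat + m := by omega
  have x2 : (b + m + ξ - c).toNat = (b + m + ξ - (c + m)).toNat + m := by omega
  have hrr : r₂ = r := by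
    rw [x1, pow_add, ← hrl] at hlr₁
    rw [x2, pow_add, ← hlr₂] at hrl₁
    have y1 : r₁ = r * Fintype.card s ^ m :=
      Nat.eq_of_mul_eq_mul_left hl.rank_pos (by rw [hlr₁]; ring)
    have y2 : r₁ = r₂ * Fintype.card s ^ m :=
      Nat.eq_of_mul_eq_mul_left hl₁.rank_pos (by rw [mul_comm, hrl₁]; ring)
    exact Nat.eq_of_mul_eq_mul_right (pow_pos hd m) (y2.symm.trans y1)
  subst hrr
  have hfin := hr₂.congr_rep e3
  refine ⟨hfin, fun g => ?_⟩
  -- The powers of `ntr (μ g)` cancel only if it is nonzero; otherwise both boundary characters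
  -- vanish, since each algebra contains a whole site.
  by_cases hg : ntr (μ g).val = 0
  · rw [right_ntr_eq_zero h (by omega) hfin hg, right_ntr_eq_zero h hbc hR hg]
  · rw [← e3 g]
    have z1 := htl g
    have z2 := htr₁ g
    have z3 := htl₁ g
    have z4 := htr₂ g
    change ntr (R g) * ntr (K g) = _ at z1
    change ntr (K g) * ntr (R₁ g) = _ at z2
    change ntr (R₁ g) * ntr (K₁ g) = _ at z3
    change ntr (K₁ g) * ntr (R₂ g) = _ at z4
    rw [x1, pow_add, ← z1] at z2
    rw [x2, pow_add, ← z4] at z3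
    have n1 : ntr (K g) ≠ 0 := fun h0 => by
      rw [h0, mul_zero] at z1; exact pow_ne_zero _ hg z1.symm
    have n2 : ntr (K₁ g) ≠ 0 := fun h0 => by
      rw [h0, zero_mul] at z4; exact pow_ne_zero _ hg z4.symm
    have y1 : ntr (R₁ g) = ntr (R g) * ntr (μ g).val ^ m :=
      mul_left_cancel₀ n1 (by rw [z2]; ring)
    have y2 : ntr (R₁ g) = ntr (R₂ g) * ntr (μ g).val ^ m :=
      mul_left_cancel₀ n2 (by rw [mul_comm, z3]; ring)
    exact mul_right_cancel₀ (pow_ne_zero m hg) (y2.symm.trans y1)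

/-- Widening the boundary algebra by `k` sites. -/
theorem right_widen (h : IsQCA ξ U) {b c : ℤ} (hbc : c + ξ ≤ b) (k : ℕ)
    (hL : b - c + k + 5 * ξ + 1 ≤ L) (hR : FactorRep (symV L μ) (right ξ U b c) r R) :
    ∃ R' : G → Op L s, FactorRep (symV L μ) (right ξ U b (c - k)) (r * Fintype.card s ^ k) R' ∧
      ∀ g, ntr (R' g) = ntr (R g) * ntr (μ g).val ^ k := by
  rcases Nat.eq_zero_or_pos k with rfl | hk
  · exact ⟨R, by simpa using hR, by simp⟩
  obtain ⟨l, hl, hrl, htl⟩ := right_to_left_static (e := b + ξ) h hbc le_rfl (by omega) hR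
  obtain ⟨r', hr', hlr, htr⟩ := left_to_right_static (c := c - k) h (by omega) le_rfl (by omega) hl
  have x1 : (b + ξ - (c - k)).toNat = (b + ξ - c).toNat + k := by omega
  have hrr : r' = r * Fintype.card s ^ k := by
    rw [x1, pow_add, ← hrl] at hlr
    exact Nat.eq_of_mul_eq_mul_left hl.rank_pos (by rw [hlr]; ring)
  subst hrr
  refine ⟨_, hr', fun g => ?_⟩
  by_cases hg : ntr (μ g).val = 0
  · rw [right_ntr_eq_zero h (by omega) hr' hg, hg, zero_pow hk.ne', mul_zero]
  · have z1 := htl g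
    have z2 := htr g
    rw [x1, pow_add, ← z1] at z2
    have n1 : ntr ((R g)ᴴ * symOn (μ g).val (seg L c (b + ξ))) ≠ 0 := fun h0 => by
      rw [h0, mul_zero] at z1; exact pow_ne_zero _ hg z1.symm
    exact mul_left_cancel₀ n1 (by rw [z2]; ring)

theorem right_congr {b c b' c' : ℤ} (hc : (c : ZMod L) = c') (hw : b - c = b' - c') :
    right ξ U b c = right ξ U b' c' := by
  unfold right
  have h1 := seg_congr (L := L) (x := c - ξ) (x' := c' - ξ) (by push_cast; rw [hc]) (b - c + ξ)
  have h2 := seg_congr (L := L) (x := c) (x' := c') hc (b - c + ξ)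
  rw [show c - ξ + (b - c + ξ) = b by ring, show c' - ξ + (b - c + ξ) = b' by omega] at h1
  rw [show c + (b - c + ξ) = b + ξ by ring, show c' + (b - c + ξ) = b' + ξ by omega] at h2
  rw [h1, h2]

/-- The invariants of the boundary algebra are the same at all positions. -/
theorem right_translate (h : IsQCA ξ U) (hsym : IsSymmetric (fun g => (μ g).val) U)
    {b c b' c' : ℤ} (hbc : c + ξ < b) (hw : b - c = b' - c') (hL : b - c + 6 * ξ + 2 ≤ L)
    (hR : FactorRep (symV L μ) (right ξ U b c) r R) :
    ∃ R' : G → Op L s, FactorRep (symV L μ) (right ξ U b' c') r R' ∧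
      ∀ g, ntr (R' g) = ntr (R g) := by
  -- Unit steps keep the bound on `L` independent of the total distance. Every position is reached
  -- by moving to the right around the ring.
  have key : ∀ t : ℕ, ∃ R' : G → Op L s,
      FactorRep (symV L μ) (right ξ U (b + t) (c + t)) r R' ∧ ∀ g, ntr (R' g) = ntr (R g) := by
    intro t
    induction t with
    | zero => exact ⟨R, by simpa using hR, fun g => rfl⟩
    | succ t ih =>
      obtain ⟨R', hR', htr⟩ := ih
      obtain ⟨h1, h2⟩ := right_shift h hsym (by omega) 1 (by push_cast; omega) hR'
      refine ⟨_, ?_, fun g => (h2 g).trans (htr g)⟩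
      have e1 : b + ((t + 1 : ℕ) : ℤ) = b + t + (1 : ℕ) := by push_cast; ring
      have e2 : c + ((t + 1 : ℕ) : ℤ) = c + t + (1 : ℕ) := by push_cast; ring
      rw [e1, e2]
      exact h1
  obtain ⟨k, hk1, hk2, hk3⟩ := exists_lift_seg (c' : ZMod L) c
  obtain ⟨R', hR', htr⟩ := key (k - c).toNat
  refine ⟨R', hR'.congr_set (right_congr ?_ ?_), htr⟩
  · rw [← hk3, Int.toNat_of_nonneg (by omega)]
    congr 1; ring
  · omega

end RightLeft

end QCA

namespace QCA

/-! ### Layers of symmetric circuits -/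

section Symmetric

variable {G : Type*} {L : ℕ} [NeZero L] {s : Type} [Fintype s] [DecidableEq s]
  {μ : G → Matrix s s ℂ}

theorem IsSymmetric.one : IsSymmetric μ (1 : Op L s) := fun g => by rw [one_mul, mul_one]

theorem IsSymmetric.mul {A B : Op L s} (hA : IsSymmetric μ A) (hB : IsSymmetric μ B) :
    IsSymmetric μ (A * B) := fun g => by
  rw [mul_assoc, hB g, ← mul_assoc, hA g, mul_assoc]

theorem IsSymmetric.list_prod {l : List (Op L s)} (h : ∀ A ∈ l, IsSymmetric μ A) :
    IsSymmetric μ l.prod := by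
  induction l with
  | nil => exact IsSymmetric.one
  | cons A l ih =>
    rw [List.prod_cons]
    exact (h A (by simp)).mul (ih fun B hB => h B (by simp [hB]))

theorem IsSymmetricLayer.isSymmetric {ℓ : ℕ} {V : Op L s} (h : IsSymmetricLayer μ ℓ V) :
    IsSymmetric μ V := by
  obtain ⟨m, start, len, gate, -, -, hg, rfl⟩ := h
  refine IsSymmetric.list_prod fun A hA => ?_
  obtain ⟨j, rfl⟩ := (List.mem_ofFn' _ _).1 hA
  exact (hg j).2.2

theorem IsSymmetricLayer.mem_unitaryGroup {ℓ : ℕ} {V : Op L s} (h : IsSymmetricLayer μ ℓ V) :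
    V ∈ Matrix.unitaryGroup (ZMod L → s) ℂ := by
  obtain ⟨m, start, len, gate, -, -, hg, rfl⟩ := h
  refine list_prod_mem fun A hA => ?_
  obtain ⟨j, rfl⟩ := (List.mem_ofFn' _ _).1 hA
  exact (hg j).1

end Symmetric

section Layers

variable {G : Type*} {L : ℕ} [NeZero L] {s : Type} [Fintype s] [DecidableEq s] [Nonempty s]
  {μ : G → Matrix s s ℂ} {ℓ : ℕ}

/-- Conjugation with `V` preserves the algebra of operators on `I`. -/
def Normalizes (V : Op L s) (I : Set (ZMod L)) : Prop :=
  ∀ A ∈ (supp I : StarSubalgebra ℂ (Op L s)), evolve V A ∈ supp I ∧ evolve Vᴴ A ∈ supp I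

omit [Nonempty s] in
theorem Normalizes.list_prod {l : List (Op L s)} {I : Set (ZMod L)} (h : ∀ V ∈ l, Normalizes V I) :
    Normalizes l.prod I := by
  induction l with
  | nil =>
    intro A hA
    simpa [evolve] using hA
  | cons V l ih =>
    intro A hA
    have h1 := h V (by simp)
    have h2 := ih fun W hW => h W (by simp [hW])
    rw [List.prod_cons, Matrix.conjTranspose_mul, evolve_comp, evolve_comp]
    exact ⟨(h2 _ (h1 A hA).1).1, (h1 _ (h2 A hA).2).2⟩

theorem normalizes_of_mem_supp {V : Op L s} (hV : V ∈ Matrix.unitaryGroup (ZMod L → s) ℂ)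
    {S I : Set (ZMod L)} (hS : V ∈ supp S) (h : S ⊆ I ∨ Disjoint S I) : Normalizes V I := by
  intro A hA
  rcases h with h | h
  · have h1 := supp_mono h hS
    refine ⟨mul_mem (mul_mem (star_mem h1) hA) h1, ?_⟩
    rw [evolve, Matrix.conjTranspose_conjTranspose]
    exact mul_mem (mul_mem h1 hA) (star_mem h1)
  · have h1 : V * A = A * V := supp_commute h hS hA
    have h2 : Vᴴ * A = A * Vᴴ := supp_commute h (star_mem hS) hA
    have h3 : Vᴴ * V = 1 := Matrix.mem_unitaryGroup_iff'.1 hV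
    have h4 : V * Vᴴ = 1 := Matrix.mem_unitaryGroup_iff.1 hV
    rw [evolve, evolve, Matrix.conjTranspose_conjTranspose, h1, h2, mul_assoc, mul_assoc, h3, h4,
      mul_one]
    exact ⟨hA, hA⟩

/-- The set consisting of `i` and of the interval of the gate containing it, if any, either contains
or is disjoint from the interval of each gate. Conjugation with the layer therefore preserves the
operators on it. -/
theorem IsSymmetricLayer.isQCA {V : Op L s} (h : IsSymmetricLayer μ ℓ V) : IsQCA ℓ V := by
  refine ⟨h.mem_unitaryGroup, fun i A hA => ?_⟩
  obtain ⟨m, start, len, gate, hlen, hdisj, hg, rfl⟩ := h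
  rw [← mem_supp, ← nbr_singleton]
  let I : Set (ZMod L) :=
    {x | x = i ∨ ∃ j, i ∈ arc (start j) (len j) ∧ x ∈ arc (start j) (len j)}
  have hI : Normalizes (List.ofFn gate).prod I := by
    refine Normalizes.list_prod fun W hW => ?_
    obtain ⟨j, rfl⟩ := (List.mem_ofFn' _ _).1 hW
    refine normalizes_of_mem_supp (hg j).1 (mem_supp.2 (hg j).2.1) ?_
    by_cases hij : i ∈ arc (start j) (len j)
    · exact Or.inl fun x hx => Or.inr ⟨j, hij, hx⟩
    · refine Or.inr (Set.disjoint_left.2 fun x hx hxI => ?_)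
      rcases hxI with rfl | ⟨k, hik, hxk⟩
      · exact hij hx
      · have hjk : j ≠ k := by rintro rfl; exact hij hik
        exact Set.disjoint_left.1 (hdisj j k hjk) hx hxk
  refine supp_mono ?_ (hI A (supp_mono (by rintro _ rfl; exact Or.inl rfl) (mem_supp.2 hA))).1
  rintro x (rfl | ⟨j, ⟨k, hk, rfl⟩, ⟨k', hk', rfl⟩⟩)
  · exact ⟨x, rfl, 0, by omega, by omega, by simp⟩
  · have := hlen j
    exact ⟨_, rfl, k' - k, by omega, by omega, by push_cast; ring⟩

/-- No gate acts across the cut to the left of site `b`. -/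
def Uncut {m : ℕ} (start : Fin m → ZMod L) (len : Fin m → ℕ) (b : ℤ) : Prop :=
  ∀ j, ¬ (((b - 1 : ℤ) : ZMod L) ∈ arc (start j) (len j) ∧ (b : ZMod L) ∈ arc (start j) (len j))

/-- If a gate crosses the cut at `x`, its right end is at most `ℓ` sites further. No gate crosses
there, because the last site of the gate belongs to no other one and the gate is too short to wrap
around the ring. -/
theorem exists_uncut {m : ℕ} {start : Fin m → ZMod L} {len : Fin m → ℕ} (hlen : ∀ j, len j ≤ ℓ)
    (hdisj : ∀ i j, i ≠ j → Disjoint (arc (start i) (len i)) (arc (start j) (len j)))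
    (hL : ℓ < L) (x : ℤ) : ∃ b : ℤ, x ≤ b ∧ b ≤ x + ℓ ∧ Uncut start len b := by
  by_cases hx : Uncut start len x
  · exact ⟨x, le_rfl, by omega, hx⟩
  · unfold Uncut at hx
    push Not at hx
    obtain ⟨j, hj1, hj2⟩ := hx
    obtain ⟨k, -, -, hk⟩ := exists_lift_seg (start j) 0
    have hl := hlen j
    rw [← hk, arc_eq_seg] at hj1
    obtain ⟨k', h1, h2, h3⟩ := hj1
    have hstart : start j = ((k + (x - 1 - k') : ℤ) : ZMod L) := by
      push_cast at h3 ⊢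
      rw [h3, ← hk]; ring
    set y : ℤ := k + (x - 1 - k') with hy
    refine ⟨y + len j, by omega, by omega, fun i hi => ?_⟩
    have hb1 : ((y + len j - 1 : ℤ) : ZMod L) ∈ arc (start j) (len j) := by
      rw [hstart, arc_eq_seg]
      exact mem_seg (by omega) (by omega)
    by_cases hij : i = j
    · subst hij
      have h4 := hi.2
      rw [hstart, arc_eq_seg] at h4
      obtain ⟨z, hz1, hz2, hz3⟩ := h4
      have := eq_of_cast_eq hz3 (by omega) (by omega)
      omega
    · exact Set.disjoint_left.1 (hdisj i j hij) hi.1 hb1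

theorem subset_or_disjoint_of_uncut {m : ℕ} {start : Fin m → ZMod L} {len : Fin m → ℕ} {a b : ℤ}
    (ha : Uncut start len a) (hb : Uncut start len b) (j : Fin m) :
    arc (start j) (len j) ⊆ seg L a b ∨ Disjoint (arc (start j) (len j)) (seg L a b) := by
  obtain ⟨k, hk1, hk2, hk⟩ := exists_lift_seg (start j) a
  have ha' := ha j
  have hb'' := hb j
  rw [← hk, arc_eq_seg] at ha' hb'' ⊢
  rcases lt_or_ge k b with h | h
  · left
    refine seg_mono hk1 ?_
    by_contra hlt
    exact hb'' ⟨mem_seg (by omega) (by omega), mem_seg (by omega) (by omega)⟩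
  · right
    refine (seg_disjoint h ?_).symm
    by_contra hlt
    refine ha' ⟨?_, ?_⟩
    · exact ⟨a + L - 1, by omega, by omega, by push_cast; simp⟩
    · exact ⟨a + L, by omega, by omega, by push_cast; simp⟩

end Layers

/-! ### Invariance of the boundary data under circuits -/

section CircuitInvariance

variable {G : Type*} [Group G] {L : ℕ} [NeZero L] {s : Type} [Fintype s] [DecidableEq s]
  [Nonempty s] {μ : G →* Matrix.unitaryGroup s ℂ} {ℓ ξ : ℕ} {U V : Op L s}

/-- A layer of a symmetric circuit does not change the invariants of the boundary algebra. -/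
theorem right_layer (hV : IsSymmetricLayer (fun g => (μ g).val) ℓ V) (hU : IsQCA ξ U)
    (hUs : IsSymmetric (fun g => (μ g).val) U) (hVU : IsQCA ξ (V * U)) {b c : ℤ} (hbc : c + ξ < b)
    (hL : b - c + 6 * ξ + 2 * ℓ + 2 ≤ L) {r : ℕ} {R : G → Op L s}
    (hR : FactorRep (symV L μ) (right ξ U b c) r R) :
    ∃ R' : G → Op L s, FactorRep (symV L μ) (right ξ (V * U) b c) r R' ∧
      ∀ g, ntr (R' g) = ntr (R g) := by
  have hVUs := hV.isSymmetric.mul hUs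
  obtain ⟨m, start, len, gate, hlen, hdisj, hg, hVeq⟩ := hV
  -- Both ends `a` and `b₁` are put between gates, so `V` preserves the operators on `[a, b₁)` and
  -- the evolved algebras of `U` and `V * U` on this interval coincide. The boundary data are
  -- translated to this cut and back.
  obtain ⟨b₁, hb1, hb2, hb⟩ := exists_uncut hlen hdisj (by omega) b
  set c₁ := c + (b₁ - b) with hc₁
  obtain ⟨a, ha1, ha2, ha⟩ := exists_uncut hlen hdisj (by omega) (c₁ - ξ - ℓ)
  obtain ⟨R₁, hR₁, htr₁⟩ := right_translate (b' := b₁) (c' := c₁) hU hUs hbc (by omega) (by omega)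
    hR
  have hN : Normalizes V (seg L a b₁) := by
    rw [hVeq]
    refine Normalizes.list_prod fun W hW => ?_
    obtain ⟨j, rfl⟩ := (List.mem_ofFn' _ _).1 hW
    exact normalizes_of_mem_supp (hg j).1 (mem_supp.2 (hg j).2.1)
      (subset_or_disjoint_of_uncut ha hb j)
  have hVV : V * Vᴴ = 1 := by
    have h1 := hVU.mul_conjTranspose
    rw [Matrix.conjTranspose_mul, mul_assoc, ← mul_assoc U, hU.mul_conjTranspose, one_mul] at h1
    exact h1
  have hset : right ξ U b₁ c₁ = right ξ (V * U) b₁ c₁ := by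
    rw [← bal_eq_right (a := a) (e := b₁ + ξ) hU (by omega) (by omega) le_rfl (by omega),
      ← bal_eq_right (a := a) (e := b₁ + ξ) hVU (by omega) (by omega) le_rfl (by omega)]
    ext X
    refine and_congr ?_ Iff.rfl
    rw [Matrix.conjTranspose_mul, evolve_comp]
    refine ⟨fun h => (hN _ h).2, fun h => ?_⟩
    have := (hN _ h).1
    rwa [evolve_evolve_symm hVV] at this
  obtain ⟨R₂, hR₂, htr₂⟩ := right_translate (b' := b) (c' := c) hVU hVUs (by omega) (by omega)
    (by omega) (hR₁.congr_set hset)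
  exact ⟨R₂, hR₂, fun g => (htr₂ g).trans (htr₁ g)⟩

/-- A symmetric circuit does not change the invariants of the boundary algebra. -/
theorem right_circuit {D : ℕ} {W : Op L s} (hW : IsSymmetricCircuit (fun g => (μ g).val) D ℓ W)
    {ζ : ℕ} (hU : IsQCA ζ U) (hUs : IsSymmetric (fun g => (μ g).val) U) (hξ : ζ + D * ℓ ≤ ξ)
    {b c : ℤ} (hbc : c + ξ < b) (hL : b - c + 6 * ξ + 2 * ℓ + 2 ≤ L) {r : ℕ} {R : G → Op L s}
    (hR : FactorRep (symV L μ) (right ξ U b c) r R) :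
    ∃ R' : G → Op L s, FactorRep (symV L μ) (right ξ (W * U) b c) r R' ∧
      ∀ g, ntr (R' g) = ntr (R g) := by
  obtain ⟨layer, hlayer, rfl⟩ := hW
  -- All partial products are regarded as QCA with the common spreading length `ξ`, so their
  -- boundary algebras have the same shape.
  have key : ∀ l : List (Op L s), (∀ V ∈ l, IsSymmetricLayer (fun g => (μ g).val) ℓ V) →
      l.length ≤ D → IsQCA (ζ + l.length * ℓ) (l.prod * U) ∧
      IsSymmetric (fun g => (μ g).val) (l.prod * U) ∧
      ∃ R' : G → Op L s, FactorRep (symV L μ) (right ξ (l.prod * U) b c) r R' ∧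
        ∀ g, ntr (R' g) = ntr (R g) := by
    intro l
    induction l with
    | nil =>
      intro _ _
      simp only [List.prod_nil, one_mul, List.length_nil, zero_mul, add_zero]
      exact ⟨hU, hUs, R, hR, fun g => rfl⟩
    | cons V l ih =>
      intro hl hD
      rw [List.length_cons] at hD
      obtain ⟨h1, h2, R', hR', htr'⟩ := ih (fun W hW => hl W (by simp [hW])) (by omega)
      have hV := hl V (by simp)
      have hQ : IsQCA (ζ + (l.length + 1) * ℓ) (V * (l.prod * U)) :=
        (hV.isQCA.mul h1).mono (le_of_eq (by ring))
      have hDl : (l.length + 1) * ℓ ≤ D * ℓ := Nat.mul_le_mul_right ℓ hD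
      have hDl' : l.length * ℓ ≤ D * ℓ := Nat.mul_le_mul_right ℓ (by omega)
      obtain ⟨R₁, hR₁, htr₁⟩ := right_layer hV (h1.mono (ζ := ξ) (by omega)) h2
        (hQ.mono (by omega)) hbc hL hR'
      rw [List.prod_cons, List.length_cons, mul_assoc]
      exact ⟨hQ, hV.isSymmetric.mul h2, R₁, hR₁, fun g => (htr₁ g).trans (htr' g)⟩
  obtain ⟨-, -, h⟩ := key (List.ofFn layer) (fun V hV => by
    obtain ⟨j, rfl⟩ := (List.mem_ofFn' _ _).1 hV
    exact hlayer j) (by simp)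
  exact h

end CircuitInvariance

end QCA

namespace QCA

/-! ### Ancillas -/

section Reindex

variable {p q : Type*} [Fintype p] [DecidableEq p] [Fintype q] [DecidableEq q]

/-- Relabelling of the basis. -/
noncomputable def submatrixHom (e : p ≃ q) : Matrix q q ℂ →⋆ₐ[ℂ] Matrix p p ℂ where
  toFun A := A.submatrix e e
  map_one' := by simp
  map_mul' A B := by rw [Matrix.submatrix_mul_equiv]
  map_zero' := by simp
  map_add' A B := rfl
  commutes' a := by
    rw [Algebra.algebraMap_eq_smul_one, Algebra.algebraMap_eq_smul_one]
    exact congrArg (fun M : Matrix p p ℂ => a • M) (Matrix.submatrix_one_equiv _)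
  map_star' A := by
    rw [Matrix.star_eq_conjTranspose, Matrix.star_eq_conjTranspose, Matrix.conjTranspose_submatrix]

theorem submatrixHom_surjective (e : p ≃ q) : Function.Surjective (submatrixHom e) := fun A =>
  ⟨A.submatrix e.symm e.symm, by
    ext i j
    change A (e.symm (e i)) (e.symm (e j)) = _
    simp⟩

/-- `A ↦ A ⊗ 1`. -/
noncomputable def kronOneHom (p q : Type*) [Fintype p] [DecidableEq p] [Fintype q] [DecidableEq q] :
    Matrix p p ℂ →⋆ₐ[ℂ] Matrix (p × q) (p × q) ℂ where
  toFun A := A ⊗ₖ (1 : Matrix q q ℂ)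
  map_one' := by simp
  map_mul' A B := by rw [← Matrix.mul_kronecker_mul, one_mul]
  map_zero' := by simp
  map_add' A B := by rw [Matrix.add_kronecker]
  commutes' a := by
    rw [Algebra.algebraMap_eq_smul_one, Matrix.smul_kronecker, Algebra.algebraMap_eq_smul_one,
      Matrix.one_kronecker_one]
  map_star' A := by simp [Matrix.star_eq_conjTranspose, Matrix.conjTranspose_kronecker]

/-- `B ↦ 1 ⊗ B`. -/
noncomputable def oneKronHom (p q : Type*) [Fintype p] [DecidableEq p] [Fintype q] [DecidableEq q] :
    Matrix q q ℂ →⋆ₐ[ℂ] Matrix (p × q) (p × q) ℂ where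
  toFun B := (1 : Matrix p p ℂ) ⊗ₖ B
  map_one' := by simp
  map_mul' A B := by rw [← Matrix.mul_kronecker_mul, one_mul]
  map_zero' := by simp
  map_add' A B := by rw [Matrix.kronecker_add]
  commutes' a := by
    rw [Algebra.algebraMap_eq_smul_one, Matrix.kronecker_smul, Algebra.algebraMap_eq_smul_one,
      Matrix.one_kronecker_one]
  map_star' A := by simp [Matrix.star_eq_conjTranspose, Matrix.conjTranspose_kronecker]

end Reindex

section Ancilla

variable {L : ℕ} [NeZero L] {s t : Type} [Fintype s] [DecidableEq s] [Fintype t] [DecidableEq t]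

/-- Separation of the configurations of the sites and of their ancillas. -/
def splitEquiv (L : ℕ) (s t : Type) : (ZMod L → s × t) ≃ (ZMod L → s) × (ZMod L → t) :=
  Equiv.arrowProdEquivProdArrow _ _ _

/-- `A ⊗ 1`: an operator on the chain with ancillas. -/
noncomputable def ancL (t : Type) [Fintype t] [DecidableEq t] : Op L s →⋆ₐ[ℂ] Op L (s × t) :=
  (submatrixHom (splitEquiv L s t)).comp (kronOneHom _ _)

/-- `1 ⊗ B`: an operator on the ancillas. -/
noncomputable def ancR (s : Type) [Fintype s] [DecidableEq s] : Op L t →⋆ₐ[ℂ] Op L (s × t) :=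
  (submatrixHom (splitEquiv L s t)).comp (oneKronHom _ _)

theorem withAncilla_eq (U : Op L s) : withAncilla t U = ancL t U := by
  ext x y
  change _ = U (fun i => (x i).1) (fun i => (y i).1) *
    (1 : Op L t) (fun i => (x i).2) (fun i => (y i).2)
  rw [Matrix.one_apply]
  rfl

theorem ancL_mul_ancR (A : Op L s) (B : Op L t) :
    ancL t A * ancR s B = submatrixHom (splitEquiv L s t) (A ⊗ₖ B) := by
  change submatrixHom _ (A ⊗ₖ (1 : Op L t)) * submatrixHom _ ((1 : Op L s) ⊗ₖ B) = _
  rw [← map_mul, ← Matrix.mul_kronecker_mul, one_mul, mul_one]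

theorem ancL_mul_ancR_apply (A : Op L s) (B : Op L t) (x y : ZMod L → s × t) :
    (ancL t A * ancR s B) x y = A (fun i => (x i).1) (fun i => (y i).1) *
      B (fun i => (x i).2) (fun i => (y i).2) := by
  rw [ancL_mul_ancR]; rfl

theorem ancL_commute_ancR (A : Op L s) (B : Op L t) : ancL t A * ancR s B = ancR s B * ancL t A := by
  rw [ancL_mul_ancR]
  change _ = submatrixHom _ ((1 : Op L s) ⊗ₖ B) * submatrixHom _ (A ⊗ₖ (1 : Op L t))
  rw [← map_mul, ← Matrix.mul_kronecker_mul, one_mul, mul_one]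

theorem ancL_evolve (U A : Op L s) : evolve (ancL t U) (ancL t A) = ancL t (evolve U A) := by
  simp only [evolve, map_mul, ← Matrix.star_eq_conjTranspose, map_star]

theorem ancL_conjTranspose (U : Op L s) : (ancL t U)ᴴ = ancL t Uᴴ := by
  simp only [← Matrix.star_eq_conjTranspose, map_star]

theorem evolve_ancR {U : Op L s} (hU : U * Uᴴ = 1) (B : Op L t) :
    evolve (ancL t U) (ancR s B) = ancR s B := by
  rw [evolve, mul_assoc, ← ancL_commute_ancR, ← mul_assoc, ancL_conjTranspose, ← map_mul,
    mul_eq_one_comm.1 hU, map_one, one_mul]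

theorem symOn_kronecker (ν : Matrix s s ℂ) (κ : Matrix t t ℂ) (S : Set (ZMod L)) :
    symOn (ν ⊗ₖ κ) S = ancL t (symOn ν S) * ancR s (symOn κ S) := by
  ext x y
  rw [ancL_mul_ancR_apply]
  simp only [symOn, tensorOp, Matrix.of_apply, ← Finset.prod_mul_distrib]
  refine Finset.prod_congr rfl fun i _ => ?_
  split_ifs
  · rfl
  · rw [← Matrix.one_kronecker_one]; rfl

variable [Nonempty s] [Nonempty t]

theorem ancL_mem_supp {S : Set (ZMod L)} {A : Op L s} (hA : A ∈ supp S) : ancL t A ∈ supp S := by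
  rw [mem_supp, supportedOn_iff] at hA ⊢
  have e : ∀ x y, ancL t A x y = A (fun i => (x i).1) (fun i => (y i).1) *
      (if (fun i => (x i).2) = fun i => (y i).2 then 1 else 0) := fun x y => by
    rw [← withAncilla_eq]; rfl
  refine ⟨fun x y ⟨i, hi, hxy⟩ => ?_, fun x y x' y' h1 h2 h3 h4 => ?_⟩
  · rw [e]
    by_cases h : (x i).1 = (y i).1
    · rw [if_neg, mul_zero]
      exact fun h' => hxy (Prod.ext h (congrFun h' i))
    · rw [hA.1 _ _ ⟨i, hi, h⟩, zero_mul]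
  · rw [e, e, hA.2 _ _ (fun i => (x' i).1) (fun i => (y' i).1)
      (fun i hi => by rw [h1 i hi]) (fun i hi => by rw [h2 i hi])
      (fun i hi => by rw [h3 i hi]) (fun i hi => by rw [h4 i hi])]
    congr 2
    simp only [funext_iff, eq_iff_iff]
    refine forall_congr' fun i => ?_
    by_cases hi : i ∈ S
    · rw [h1 i hi, h2 i hi]
    · simp [h3 i hi, h4 i hi]

theorem ancR_mem_supp {S : Set (ZMod L)} {B : Op L t} (hB : B ∈ supp S) : ancR s B ∈ supp S := by
  rw [mem_supp, supportedOn_iff] at hB ⊢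
  have e : ∀ x y, ancR s B x y = (if (fun i => (x i).1) = fun i => (y i).1 then 1 else 0) *
      B (fun i => (x i).2) (fun i => (y i).2) := fun x y => by
    change (1 : Op L s) (fun i => (x i).1) (fun i => (y i).1) * _ = _
    rw [Matrix.one_apply]; rfl
  refine ⟨fun x y ⟨i, hi, hxy⟩ => ?_, fun x y x' y' h1 h2 h3 h4 => ?_⟩
  · rw [e]
    by_cases h : (x i).2 = (y i).2
    · rw [if_neg, zero_mul]
      exact fun h' => hxy (Prod.ext (congrFun h' i) h)
    · rw [hB.1 _ _ ⟨i, hi, h⟩, mul_zero]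
  · rw [e, e, hB.2 _ _ (fun i => (x' i).2) (fun i => (y' i).2)
      (fun i hi => by rw [h1 i hi]) (fun i hi => by rw [h2 i hi])
      (fun i hi => by rw [h3 i hi]) (fun i hi => by rw [h4 i hi])]
    congr 2
    simp only [funext_iff, eq_iff_iff]
    refine forall_congr' fun i => ?_
    by_cases hi : i ∈ S
    · rw [h1 i hi, h2 i hi]
    · simp [h3 i hi, h4 i hi]

theorem mem_supp_of_ancL {S : Set (ZMod L)} {A : Op L s} (hA : ancL t A ∈ supp S) : A ∈ supp S := by
  refine mem_supp_of_commute fun j hj B hB => starAlgHom_injective (ancL t) ?_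
  rw [map_mul, map_mul]
  exact supp_commute (Set.disjoint_singleton_right.2 hj) hA (ancL_mem_supp hB)

/-- For fixed configurations of the sites, the block of `X` on the ancillas commutes with every
single-ancilla operator and is a scalar; these scalars are the entries of `A`. -/
theorem exists_ancL_of_commute {X : Op L (s × t)} (h : ∀ j, ∀ B ∈ (supp {j} :
    StarSubalgebra ℂ (Op L t)), X * ancR s B = ancR s B * X) : ∃ A : Op L s, ancL t A = X := by
  obtain ⟨M, rfl⟩ := submatrixHom_surjective (splitEquiv L s t) X
  have hM : ∀ a b, ∃ c : ℂ, (Matrix.of fun u v => M (a, u) (b, v) : Op L t) = c • 1 := by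
    intro a b
    refine eq_smul_one_of_mem_supp_empty (mem_supp_of_commute fun j _ B hB => ?_)
    have h1 := h j B hB
    have h2 : M * ((1 : Op L s) ⊗ₖ B) = ((1 : Op L s) ⊗ₖ B) * M := by
      refine starAlgHom_injective (submatrixHom (splitEquiv L s t)) ?_
      rw [map_mul, map_mul]; exact h1
    ext u v
    have h3 := congrFun (congrFun h2 (a, u)) (b, v)
    simpa [Matrix.mul_apply, Fintype.sum_prod_type, Matrix.kroneckerMap_apply, Matrix.one_apply,
      ite_and] using h3
  choose c hc using hM
  refine ⟨Matrix.of c, ?_⟩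
  change submatrixHom _ ((Matrix.of c) ⊗ₖ (1 : Op L t)) = _
  congr 1
  ext ⟨a, u⟩ ⟨b, v⟩
  have := congrFun (congrFun (hc a b) u) v
  rw [Matrix.smul_apply, Matrix.of_apply] at this
  rw [this]; rfl

open Classical in
/-- Operators that act on the ancillas of the sites in `T` only. -/
theorem exists_ancilla_decomposition {T : Set (ZMod L)} {X : Op L (s × t)}
    (h : ∀ j ∉ T, ∀ B ∈ (supp {j} : StarSubalgebra ℂ (Op L t)), X * ancR s B = ancR s B * X) :
    ∃ Z : (T → t) → (T → t) → Op L s,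
      X = ∑ i, ∑ j, ancR s (embOp T (Matrix.single i j 1)) * ancL t (Z i j) ∧
      ∀ i j, ancL t (Z i j) = ∑ k, ancR s (embOp T (Matrix.single k i 1)) * X *
        ancR s (embOp T (Matrix.single j k 1)) := by
  obtain ⟨Z, hX, hc, hZ⟩ := FactorRep.exists_commutant_decomposition ((ancR s).comp (embOp T)) X
  have hZA : ∀ i j, ∃ A : Op L s, ancL t A = Z i j := by
    intro i j
    refine exists_ancL_of_commute fun l B hB => ?_
    by_cases hl : l ∈ T
    · obtain ⟨b, rfl⟩ := supp_mono (Set.singleton_subset_iff.2 hl) hB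
      exact (hc i j b).symm
    · have h1 : ∀ b, ancR s (embOp T b) * ancR s B = ancR s B * ancR s (embOp T b) := fun b => by
        rw [← map_mul, ← map_mul, supp_commute (Set.disjoint_singleton_right.2 hl)
          (embOp_mem T b) hB]
      rw [hZ, Finset.sum_mul, Finset.mul_sum]
      refine Finset.sum_congr rfl fun k _ => ?_
      simp only [StarAlgHom.comp_apply]
      rw [mul_assoc, h1, ← mul_assoc, mul_assoc _ X, h l hl B hB, ← mul_assoc, h1]
      simp only [mul_assoc]
  choose A hA using hZA
  refine ⟨A, ?_, fun i j => by rw [hA, hZ]; rfl⟩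
  simp only [hA]
  exact hX

/-- An operator on a site with its ancilla is a sum of products of ancilla matrix units and
operators on the site alone. The former do not evolve, the latter spread as under `U`. -/
theorem IsQCA.ancL {ξ : ℕ} {U : Op L s} (h : IsQCA ξ U) : IsQCA ξ (ancL t U) := by
  classical
  have hU := h.mul_conjTranspose
  have hU' : QCA.ancL t U * (QCA.ancL t U)ᴴ = 1 := by
    rw [ancL_conjTranspose, ← map_mul, hU, map_one]
  refine ⟨Matrix.mem_unitaryGroup_iff.2 hU', fun i A hA => ?_⟩
  rw [← mem_supp, ← nbr_singleton]
  rw [← mem_supp] at hA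
  obtain ⟨S, hS⟩ : ∃ S : Set (ZMod L), S = {i} := ⟨_, rfl⟩
  rw [← hS] at hA ⊢
  have hSn : S ⊆ nbr ξ S := fun j hj => ⟨j, hj, 0, by omega, by omega, by simp⟩
  obtain ⟨Z, hAZ, hZ⟩ := exists_ancilla_decomposition (T := S) (X := A) fun j hj B hB =>
    supp_commute (Set.disjoint_singleton_right.2 hj) hA (ancR_mem_supp hB)
  rw [hAZ]
  change evolveHom _ hU' _ ∈ _
  rw [map_sum]
  refine sum_mem fun k _ => ?_
  rw [map_sum]
  refine sum_mem fun l _ => ?_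
  rw [map_mul]
  refine mul_mem ?_ ?_
  · change evolve _ (ancR s _) ∈ _
    rw [evolve_ancR hU]
    exact supp_mono hSn (ancR_mem_supp (embOp_mem _ _))
  · change evolve _ (QCA.ancL t _) ∈ _
    rw [ancL_evolve]
    refine ancL_mem_supp (h.evolve_mem (mem_supp_of_ancL (t := t) ?_))
    rw [hZ]
    exact sum_mem fun m _ => mul_mem (mul_mem (ancR_mem_supp (embOp_mem _ _)) hA)
      (ancR_mem_supp (embOp_mem _ _))

end Ancilla

/-! ### Boundary representations with ancillas -/

section AncillaRep

variable {G : Type*} [Group G] {L : ℕ} [NeZero L] {s t : Type} [Fintype s] [DecidableEq s]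
  [Fintype t] [DecidableEq t] {μ : G →* Matrix.unitaryGroup s ℂ} {σ : G →* Matrix.unitaryGroup t ℂ}
  {ξ : ℕ} {U : Op L s}

/-- The tensor product of two unitary representations. -/
noncomputable def prodRep (μ : G →* Matrix.unitaryGroup s ℂ) (σ : G →* Matrix.unitaryGroup t ℂ) :
    G →* Matrix.unitaryGroup (s × t) ℂ :=
  MonoidHom.mk' (fun g => ⟨(μ g).val ⊗ₖ (σ g).val, Matrix.kronecker_mem_unitary (μ g).2 (σ g).2⟩)
    fun g h => Subtype.ext (by simp [Matrix.mul_kronecker_mul])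

/-- The tensor power of a unitary representation. -/
noncomputable def powRep (μ : G →* Matrix.unitaryGroup s ℂ) (k : ℕ) :
    G →* Matrix.unitaryGroup (Fin k → s) ℂ :=
  MonoidHom.mk' (fun g => ⟨tensorOp fun _ => (μ g).val, Matrix.mem_unitaryGroup_iff'.2 (by
      rw [Matrix.star_eq_conjTranspose, tensorOp_conjTranspose, tensorOp_mul, symm_unitary,
        tensorOp_one])⟩)
    fun g h => Subtype.ext (by simp [tensorOp_mul])

theorem ntr_powRep (k : ℕ) (g : G) : ntr (powRep μ k g).val = ntr (μ g).val ^ k := by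
  change ntr (tensorOp fun _ : Fin k => (μ g).val) = _
  rw [ntr_tensorOp]; simp

theorem ntr_kronecker {p q : Type*} [Fintype p] [Fintype q] (A : Matrix p p ℂ) (B : Matrix q q ℂ) :
    ntr (A ⊗ₖ B) = ntr A * ntr B := by
  simp only [ntr, Matrix.trace_kronecker, Fintype.card_prod, Nat.cast_mul]
  rw [mul_div_mul_comm]

theorem IsSymmetric.ancL (h : IsSymmetric (fun g => (μ g).val) U) :
    IsSymmetric (fun g => (prodRep μ σ g).val) (ancL t U) := by
  intro g
  change QCA.ancL t U * symOn ((μ g).val ⊗ₖ (σ g).val) _ = symOn ((μ g).val ⊗ₖ (σ g).val) _ * _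
  have h1 : U * symOn (μ g).val Set.univ = symOn (μ g).val Set.univ * U := h g
  rw [symOn_kronecker, ← mul_assoc, ← map_mul, h1, map_mul, mul_assoc, mul_assoc,
    ancL_commute_ancR]

variable [Nonempty s] [Nonempty t]

/-- The invariants of the boundary algebra of `U ⊗ 1`. -/
theorem right_ancL (h : IsQCA ξ U) {b c : ℤ} (hbc : c ≤ b) (hL : b - c + 2 * ξ ≤ L) {r : ℕ}
    {R : G → Op L s} (hR : FactorRep (symV L μ) (right ξ U b c) r R) :
    ∃ R' : G → Op L (s × t), FactorRep (symV L (prodRep μ σ)) (right ξ (ancL t U) b c)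
        (r * Fintype.card t ^ (b - c).toNat) R' ∧
      ∀ g, ntr (R' g) = ntr (R g) * ntr (σ g).val ^ (b - c).toNat := by
  classical
  have hU := h.mul_conjTranspose
  have hU' := h.symm.mul_conjTranspose
  obtain ⟨φ, ρ, hφ, hRφ, hV⟩ := id hR
  -- The set `[c, b)` is the intersection of the two segments that define `right`. The new boundary
  -- algebra is the old one tensored with all operators on the ancillas of this set.
  obtain ⟨S, hS⟩ : ∃ S : Set (ZMod L), S = seg L c b := ⟨_, rfl⟩
  have hS1 : S ⊆ seg L (c - ξ) b := hS ▸ seg_mono (by omega) le_rfl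
  have hS2 : S ⊆ seg L c (b + ξ) := hS ▸ seg_mono le_rfl (by omega)
  have hcardS : S.ncard = (b - c).toNat := by rw [hS, ncard_seg hbc (by omega)]
  obtain ⟨Φ, hΦ⟩ := exists_kroneckerLift ((ancL t).comp φ) ((ancR s).comp (embOp S))
    fun X Y => ancL_commute_ancR _ _
  have hcard : Fintype.card (Fin r × (S → t)) = r * Fintype.card t ^ (b - c).toNat := by
    rw [Fintype.card_prod, Fintype.card_fin, card_fun_set, hcardS]
  let e := Fintype.equivFinOfCardEq hcard
  let φ' := Φ.comp (submatrixHom e)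
  have hφ' : Set.range φ' = Set.range Φ := by
    ext X
    constructor
    · rintro ⟨x, rfl⟩; exact ⟨_, rfl⟩
    · rintro ⟨x, rfl⟩
      obtain ⟨y, rfl⟩ := submatrixHom_surjective e x
      exact ⟨y, rfl⟩
  let 𝓒 : StarSubalgebra ℂ (Op L (s × t)) := StarAlgHom.range Φ
  have h𝓒 : ∀ X, X ∈ 𝓒 ↔ X ∈ Set.range Φ := fun X => Iff.rfl
  have hC1 : ∀ X ∈ right ξ U b c, ancL t X ∈ 𝓒 := fun X hX => by
    rw [← hφ] at hX
    obtain ⟨x, rfl⟩ := hX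
    exact ⟨x ⊗ₖ 1, (hΦ x 1).trans (by rw [map_one, mul_one]; rfl)⟩
  have hC2 : ∀ E, ancR s (embOp S E) ∈ 𝓒 := fun E =>
    ⟨1 ⊗ₖ E, (hΦ 1 E).trans (by rw [map_one, one_mul]; rfl)⟩
  have hset : Set.range φ' = right ξ (ancL t U) b c := by
    rw [hφ']
    apply Set.Subset.antisymm
    · rintro _ ⟨x, rfl⟩
      refine kronecker_induction (P := fun x => Φ x ∈ right ξ (ancL t U) b c)
        (fun X Y hX hY => ?_) (fun X Y => ?_) x
      · rw [map_add]
        exact ⟨by rw [evolve_add]; exact add_mem hX.1 hY.1, add_mem hX.2 hY.2⟩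
      · have hX : φ X ∈ right ξ U b c := hφ ▸ ⟨X, rfl⟩
        rw [hΦ]
        refine ⟨?_, mul_mem (ancL_mem_supp hX.2) (supp_mono hS2 (ancR_mem_supp (embOp_mem S Y)))⟩
        rw [ancL_conjTranspose, evolve_mul (h.symm.ancL).mul_conjTranspose]
        refine mul_mem ?_ ?_
        · change evolve _ (ancL t _) ∈ _
          rw [ancL_evolve]
          exact ancL_mem_supp hX.1
        · change evolve _ (ancR s _) ∈ _
          rw [evolve_ancR hU']
          exact supp_mono hS1 (ancR_mem_supp (embOp_mem S Y))
    · rintro X ⟨hX1, hX2⟩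
      -- A site outside `S` misses the segment of `X` or that of its preimage. Since ancillas do not
      -- evolve, `X` acts trivially on the ancilla there in either case.
      obtain ⟨Z, hXZ, hZ⟩ := exists_ancilla_decomposition (T := S) (X := X) fun j hj B hB => by
        by_cases hj2 : j ∈ seg L c (b + ξ)
        · have hj1 : j ∉ seg L (c - ξ) b := by
            rintro ⟨k, hk1, hk2, rfl⟩
            obtain ⟨k', hk1', hk2', hkk⟩ := hj2
            have := eq_of_cast_eq hkk (by omega) (by omega)
            exact hj (hS ▸ mem_seg (by omega) (by omega))
          rw [ancL_conjTranspose] at hX1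
          refine commute_of_evolve (h.symm.ancL (t := t)).mul_conjTranspose ?_
          rw [evolve_ancR hU']
          exact supp_commute (Set.disjoint_singleton_right.2 hj1) hX1 (ancR_mem_supp hB)
        · exact supp_commute (Set.disjoint_singleton_right.2 hj2) hX2 (ancR_mem_supp hB)
      have hZr : ∀ i j, Z i j ∈ right ξ U b c := by
        intro i j
        refine ⟨mem_supp_of_ancL (t := t) ?_, mem_supp_of_ancL (t := t) ?_⟩
        · rw [← ancL_evolve, hZ]
          change evolveHom _ (h.symm.ancL (t := t)).mul_conjTranspose _ ∈ _
          rw [map_sum]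
          refine sum_mem fun k _ => ?_
          rw [map_mul, map_mul]
          have h1 : ∀ E, evolveHom _ (h.symm.ancL (t := t)).mul_conjTranspose
              (ancR s (embOp S E)) ∈ supp (seg L (c - ξ) b) := fun E => by
            change evolve _ _ ∈ _
            rw [evolve_ancR hU']
            exact supp_mono hS1 (ancR_mem_supp (embOp_mem S E))
          refine mul_mem (mul_mem (h1 _) ?_) (h1 _)
          change evolve (ancL t Uᴴ) X ∈ _
          rwa [← ancL_conjTranspose]
        · rw [hZ]
          have h1 : ∀ E, (ancR s (embOp S E) : Op L (s × t)) ∈ supp (seg L c (b + ξ)) := fun E =>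
            supp_mono hS2 (ancR_mem_supp (embOp_mem S E))
          exact sum_mem fun k _ => mul_mem (mul_mem (h1 _) hX2) (h1 _)
      rw [hXZ]
      change _ ∈ 𝓒
      exact sum_mem fun i _ => sum_mem fun j _ => mul_mem (hC2 _) (hC1 _ (hZr i j))
  let R' : G → Op L (s × t) := fun g => ancL t (R g) * ancR s (symOn (σ g).val S)
  have hRu : ∀ g, (R' g)ᴴ * R' g = 1 := fun g => by
    have h1 : (ancR s (symOn (σ g).val S) : Op L (s × t))ᴴ * ancR s (symOn (σ g).val S) = 1 := by
      rw [← Matrix.star_eq_conjTranspose, ← map_star, ← map_mul, Matrix.star_eq_conjTranspose,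
        symOn_unitary (symm_unitary σ g), map_one]
    have h2 : (ancL t (R g))ᴴ * ancL t (R g) = 1 := by
      rw [ancL_conjTranspose, ← map_mul, hR.unitary, map_one]
    simp only [R']
    rw [Matrix.conjTranspose_mul, mul_assoc, ← mul_assoc _ (ancL t (R g)), h2, one_mul, h1]
  obtain ⟨ρ', hρ'⟩ := exists_rep_of_mem_range φ' R' (fun g => by
      rw [hφ']
      obtain ⟨E, hE⟩ := symOn_mem_supp (s := t) (σ g).val S
      have hE' : embOp S E = symOn (σ g).val S := hE
      change _ ∈ 𝓒
      refine mul_mem (hC1 _ (hR.mem g)) ?_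
      rw [← hE']
      exact hC2 E) hRu (fun g k => by
      simp only [R']
      rw [hR.map_mul, map_mul, _root_.map_mul σ, Submonoid.coe_mul, ← symOn_mul, map_mul]
      rw [mul_assoc, ← mul_assoc (ancL t (R k)), ancL_commute_ancR]
      simp only [mul_assoc])
  refine ⟨R', ⟨φ', ρ', hset, hρ', fun g X hX => ?_⟩, fun g => ?_⟩
  · have hVS : symV L (prodRep μ σ) g = ancL t (symV L μ g) * ancR s (symV L σ g) :=
      symOn_kronecker _ _ _
    rw [← hset, hφ'] at hX
    obtain ⟨x, rfl⟩ := hX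
    rw [hVS]
    refine kronecker_induction (P := fun x => ancL t (symV L μ g) * ancR s (symV L σ g) * Φ x *
      (ancL t (symV L μ g) * ancR s (symV L σ g))ᴴ = R' g * Φ x * (R' g)ᴴ)
      (fun X Y hX hY => ?_) (fun X Y => ?_) x
    · rw [map_add, mul_add, add_mul, hX, hY, mul_add, add_mul]
    · have key : ∀ (A B : Op L s) (C D : Op L t), ancL t A * ancR s C * (ancL t B * ancR s D) *
          (ancL t A * ancR s C)ᴴ = ancL t (A * B * Aᴴ) * ancR s (C * D * Cᴴ) := by
        intro A B C D
        have h1 : (ancL t A * ancR s C : Op L (s × t))ᴴ = ancL t Aᴴ * ancR s Cᴴ := by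
          rw [ancL_commute_ancR, Matrix.conjTranspose_mul]
          simp only [← Matrix.star_eq_conjTranspose, map_star]
        rw [h1]
        simp only [ancL_mul_ancR, ← map_mul, ← Matrix.mul_kronecker_mul]
      rw [hΦ]
      simp only [R', StarAlgHom.comp_apply]
      rw [key, key, hV g _ (hφ ▸ ⟨X, rfl⟩)]
      congr 2
      exact symOn_univ_conj (symm_unitary σ g) (embOp_mem S Y)
  · have h1 : ntr (R' g) = ntr (R g ⊗ₖ symOn (σ g).val S) := by
      simp only [R']
      rw [ancL_mul_ancR]
      simp only [ntr, submatrixHom, Matrix.trace]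
      change (∑ i, (R g ⊗ₖ symOn (σ g).val S) (splitEquiv L s t i) (splitEquiv L s t i)) / _ = _
      rw [Equiv.sum_comp (splitEquiv L s t) fun i => (R g ⊗ₖ symOn (σ g).val S) i i,
        Fintype.card_congr (splitEquiv L s t)]
      rfl
    rw [h1, ntr_kronecker, ntr_symOn, hcardS]

/-- A symmetric circuit of the chain is a symmetric circuit of the chain with ancillas. -/
theorem IsSymmetricCircuit.ancL {D ℓ : ℕ} {W : Op L s}
    (h : IsSymmetricCircuit (fun g => (μ g).val) D ℓ W) :
    IsSymmetricCircuit (fun g => (prodRep μ σ g).val) D ℓ (ancL t W) := by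
  obtain ⟨layer, hlayer, rfl⟩ := h
  refine ⟨fun i => QCA.ancL t (layer i), fun i => ?_, ?_⟩
  · obtain ⟨m, start, len, gate, h1, h2, h3, h4⟩ := hlayer i
    refine ⟨m, start, len, fun j => QCA.ancL t (gate j), h1, h2, fun j => ⟨?_, ?_, ?_⟩, ?_⟩
    · rw [Matrix.mem_unitaryGroup_iff, ← map_star, ← map_mul,
        Matrix.mem_unitaryGroup_iff.1 (h3 j).1, map_one]
    · exact mem_supp.1 (ancL_mem_supp (mem_supp.2 (h3 j).2.1))
    · exact (h3 j).2.2.ancL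
    · change QCA.ancL t (layer i) = _
      rw [h4, map_list_prod, List.map_ofFn]; rfl
  · rw [map_list_prod, List.map_ofFn]; rfl

end AncillaRep

end QCA

namespace QCA

/-! ### Local gates from equal boundary data -/

section Gates

variable {G : Type*} [Group G] {L : ℕ} [NeZero L] {s : Type} [Fintype s] [DecidableEq s] [Nonempty s]

/-- Pairs of commuting factors with the same characters are intertwined by a local unitary. -/
theorem exists_intertwining_gate [Finite G] {J : Set (ZMod L)} {𝓑 𝓑' 𝓒 𝓒' : Set (Op L s)}
    {r l : ℕ} {V R R' K K' : G → Op L s} (hB : FactorRep V 𝓑 r R) (hB' : FactorRep V 𝓑' r R')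
    (hR : ∀ g, ntr (R g) = ntr (R' g)) (hC : FactorRep V 𝓒 l K) (hC' : FactorRep V 𝓒' l K')
    (hK : ∀ g, ntr (K g) = ntr (K' g))
    (hBJ : ∀ X ∈ 𝓑, X ∈ supp J) (hBJ' : ∀ X ∈ 𝓑', X ∈ supp J)
    (hCJ : ∀ X ∈ 𝓒, X ∈ supp J) (hCJ' : ∀ X ∈ 𝓒', X ∈ supp J)
    (hcomm : ∀ X ∈ 𝓑, ∀ Y ∈ 𝓒, X * Y = Y * X) (hcomm' : ∀ X ∈ 𝓑', ∀ Y ∈ 𝓒', X * Y = Y * X) :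
    ∃ Y : Op L s, Y ∈ supp J ∧ Y ∈ Matrix.unitaryGroup (ZMod L → s) ℂ ∧
      (∀ X ∈ 𝓑, Y * X * Yᴴ ∈ 𝓑') ∧ (∀ X ∈ 𝓒, Y * X * Yᴴ ∈ 𝓒') ∧
      (∀ g, Y * R g * Yᴴ = R' g) ∧ ∀ g, Y * K g * Yᴴ = K' g := by
  classical
  obtain ⟨φ, φ', ρ, hφ, hφ', hRρ, hRρ'⟩ := hB.exists_common_param hB' hR
  obtain ⟨ψ, ψ', κ, hψ, hψ', hKκ, hKκ'⟩ := hC.exists_common_param hC' hK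
  have mφ : ∀ X, φ X ∈ 𝓑 := fun X => hφ ▸ ⟨X, rfl⟩
  have mφ' : ∀ X, φ' X ∈ 𝓑' := fun X => hφ' ▸ ⟨X, rfl⟩
  have mψ : ∀ X, ψ X ∈ 𝓒 := fun X => hψ ▸ ⟨X, rfl⟩
  have mψ' : ∀ X, ψ' X ∈ 𝓒' := fun X => hψ' ▸ ⟨X, rfl⟩
  obtain ⟨Φ, hΦ⟩ := exists_kroneckerLift φ ψ fun X Y => hcomm _ (mφ X) _ (mψ Y)
  obtain ⟨Φ', hΦ'⟩ := exists_kroneckerLift φ' ψ' fun X Y => hcomm' _ (mφ' X) _ (mψ' Y)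
  have hJ : ∀ x, Φ x ∈ (supp J : StarSubalgebra ℂ (Op L s)) := fun x =>
    kronecker_induction (P := fun x => Φ x ∈ (supp J : StarSubalgebra ℂ (Op L s)))
      (fun X Y hX hY => by rw [map_add]; exact add_mem hX hY)
      (fun X Y => by rw [hΦ]; exact mul_mem (hBJ _ (mφ X)) (hCJ _ (mψ Y))) x
  have hJ' : ∀ x, Φ' x ∈ (supp J : StarSubalgebra ℂ (Op L s)) := fun x =>
    kronecker_induction (P := fun x => Φ' x ∈ (supp J : StarSubalgebra ℂ (Op L s)))
      (fun X Y hX hY => by rw [map_add]; exact add_mem hX hY)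
      (fun X Y => by rw [hΦ']; exact mul_mem (hBJ' _ (mφ' X)) (hCJ' _ (mψ' Y))) x
  obtain ⟨Ω, hΩ⟩ := exists_starAlgHom_lift (embOp J) (starAlgHom_injective _) Φ
    fun x => show ∃ y, embOp J y = Φ x from hJ x
  obtain ⟨Ω', hΩ'⟩ := exists_starAlgHom_lift (embOp J) (starAlgHom_injective _) Φ'
    fun x => show ∃ y, embOp J y = Φ' x from hJ' x
  -- Both pairs of factors represent the same Kronecker product on the sites of `J`, so a unitary on
  -- `J` conjugates one to the other. It maps `R` to `R'` and `K` to `K'` because these have common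
  -- coordinates.
  obtain ⟨y, hy1, hy2, hy⟩ := exists_unitary_conj Ω Ω'
  have hY2 : embOp J y * (embOp J y)ᴴ = 1 := by
    rw [← Matrix.star_eq_conjTranspose, ← map_star, ← map_mul, Matrix.star_eq_conjTranspose, hy2,
      map_one]
  have key : ∀ x, embOp J y * Φ x * (embOp J y)ᴴ = Φ' x := fun x => by
    rw [← hΩ, ← map_mul, hy, map_mul, hΩ', mul_assoc, hY2, mul_one]
  have kφ : ∀ x, embOp J y * φ x * (embOp J y)ᴴ = φ' x := fun x => by
    have := key (x ⊗ₖ 1)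
    rwa [hΦ, hΦ', map_one, map_one, mul_one, mul_one] at this
  have kψ : ∀ x, embOp J y * ψ x * (embOp J y)ᴴ = ψ' x := fun x => by
    have := key (1 ⊗ₖ x)
    rwa [hΦ, hΦ', map_one, map_one, one_mul, one_mul] at this
  refine ⟨embOp J y, embOp_mem J y, Matrix.mem_unitaryGroup_iff.2 hY2, fun X hX => ?_,
    fun X hX => ?_, fun g => ?_, fun g => ?_⟩
  · rw [← hφ] at hX
    obtain ⟨x, rfl⟩ := hX
    rw [kφ]; exact mφ' x
  · rw [← hψ] at hX
    obtain ⟨x, rfl⟩ := hX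
    rw [kψ]; exact mψ' x
  · rw [hRρ, hRρ', kφ]
  · rw [hKκ, hKκ', kψ]

/-- Conjugation with a product of unitaries with disjoint supports. -/
theorem list_prod_conj {ι : Type*} {S : ι → Set (ZMod L)} {V : ι → Op L s} {l : List ι}
    (hl : l.Nodup) (hV : ∀ i ∈ l, V i ∈ supp (S i))
    (hu : ∀ i ∈ l, V i ∈ Matrix.unitaryGroup (ZMod L → s) ℂ) {k : ι}
    (hdisj : ∀ i ∈ l, i ≠ k → Disjoint (S i) (S k)) {A : Op L s} (hA : A ∈ supp (S k)) :
    (k ∈ l → (l.map V).prod * A = V k * A * (V k)ᴴ * (l.map V).prod) ∧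
      (k ∉ l → (l.map V).prod * A = A * (l.map V).prod) := by
  induction l with
  | nil => simp
  | cons i l ih =>
    rw [List.nodup_cons] at hl
    obtain ⟨ih1, ih2⟩ := ih hl.2 (fun j hj => hV j (by simp [hj])) (fun j hj => hu j (by simp [hj]))
      (fun j hj => hdisj j (by simp [hj]))
    rw [List.map_cons, List.prod_cons]
    constructor
    · intro hk
      by_cases hik : i = k
      · subst hik
        have h1 : (V i)ᴴ * V i = 1 := Matrix.mem_unitaryGroup_iff'.1 (hu i (by simp))
        rw [mul_assoc, ih2 hl.1, ← mul_assoc, ← mul_assoc, mul_assoc _ (V i)ᴴ, h1, mul_one]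
      · have hkl : k ∈ l := by
          rcases List.mem_cons.1 hk with h | h
          · exact absurd h.symm hik
          · exact h
        have h1 : V k ∈ supp (S k) := hV k (by simp [hkl])
        have h2 : V i * (V k * A * (V k)ᴴ) = V k * A * (V k)ᴴ * V i :=
          supp_commute (hdisj i (by simp) hik) (hV i (by simp))
            (mul_mem (mul_mem h1 hA) (star_mem h1))
        rw [mul_assoc, ih1 hkl, ← mul_assoc, h2, mul_assoc]
    · intro hk
      rw [List.mem_cons, not_or] at hk
      have h2 : V i * A = A * V i :=
        supp_commute (hdisj i (by simp) (Ne.symm hk.1)) (hV i (by simp)) hA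
      rw [mul_assoc, ih2 hk.2, ← mul_assoc, h2, mul_assoc]

theorem isSymmetric_of_mem_supp {μ : G → Matrix s s ℂ} {S : Set (ZMod L)} {A : Op L s}
    (hA : A ∈ supp S) (h : ∀ g, A * symOn (μ g) S = symOn (μ g) S * A) : IsSymmetric μ A := by
  intro g
  have h1 : symOn (μ g) (Set.univ : Set (ZMod L)) = symOn (μ g) S * symOn (μ g) Sᶜ := by
    rw [symOn_union _ disjoint_compl_right, Set.union_compl_self]
  rw [h1, ← mul_assoc, h, mul_assoc, supp_commute_compl hA (symOn_mem_supp _ _), mul_assoc]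

theorem isSymmetricLayer_of_list {μ : G → Matrix s s ℂ} {ℓ n : ℕ} {x y : ℕ → ℤ} {V : ℕ → Op L s}
    (hxy : ∀ i < n, x i ≤ y i) (hℓ : ∀ i < n, y i ≤ x i + ℓ)
    (hdisj : ∀ i j, i < j → j < n → y i ≤ x j ∧ y j ≤ x i + L)
    (hV : ∀ i < n, V i ∈ supp (seg L (x i) (y i)))
    (hu : ∀ i < n, V i ∈ Matrix.unitaryGroup (ZMod L → s) ℂ)
    (hs : ∀ i < n, IsSymmetric μ (V i)) :
    IsSymmetricLayer μ ℓ ((List.range n).map V).prod := by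
  have harc : ∀ i < n, arc ((x i : ℤ) : ZMod L) (y i - x i).toNat = seg L (x i) (y i) :=
    fun i hi => by
      have := hxy i hi
      rw [arc_eq_seg]
      congr 1
      omega
  refine ⟨n, fun i => ((x i : ℤ) : ZMod L), fun i => (y i - x i).toNat, fun i => V i, fun i => ?_,
    fun i j hij => ?_, fun i => ⟨hu i i.2, ?_, hs i i.2⟩, ?_⟩
  · have := hℓ i i.2
    change (y i - x i).toNat ≤ ℓ
    omega
  · rw [harc i i.2, harc j j.2]
    rcases lt_or_gt_of_ne hij with h | h
    · obtain ⟨h1, h2⟩ := hdisj i j h j.2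
      exact seg_disjoint h1 h2
    · obtain ⟨h1, h2⟩ := hdisj j i h i.2
      exact (seg_disjoint h1 h2).symm
  · rw [harc i i.2]
    exact mem_supp.1 (hV i i.2)
  · rw [List.ofFn_eq_map, ← List.map_coe_finRange_eq_range, List.map_map]
    rfl

/-- An operator that commutes with all operators on the sets of a cover of the chain is a scalar. -/
theorem mem_supp_empty_of_commute {ι : Type*} {S : ι → Set (ZMod L)} (hS : ∀ x, ∃ i, x ∈ S i)
    {A : Op L s} (hA : ∀ i, ∀ B ∈ (supp (S i) : StarSubalgebra ℂ (Op L s)), A * B = B * A) :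
    A ∈ supp (∅ : Set (ZMod L)) :=
  mem_supp_of_commute fun x _ B hB => by
    obtain ⟨i, hi⟩ := hS x
    exact hA i B (supp_mono (Set.singleton_subset_iff.2 hi) hB)

end Gates

/-! ### Cutting the ring into blocks -/

section Blocks

/-- Cut points of the periodic chain into `n` blocks of lengths between `M` and `3 M`. -/
structure IsBlocking (L M n : ℕ) (c : ℕ → ℤ) : Prop where
  le_succ : ∀ j < n, c j + M ≤ c (j + 1)
  succ_le : ∀ j < n, c (j + 1) ≤ c j + 3 * M
  last : c n = c 0 + L

/-- All blocks have length `M` except the last, which absorbs the remainder of `L` modulo `2 * M`.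
The number of blocks is even so that even and odd blocks alternate around the ring. -/
theorem exists_isBlocking {L M : ℕ} (hM : 0 < M) (hL : 2 * M ≤ L) (c₀ : ℤ) :
    ∃ (p : ℕ) (c : ℕ → ℤ), 0 < p ∧ c 0 = c₀ ∧ IsBlocking L M (2 * p) c := by
  have h1 : 2 * M * (L / (2 * M)) + L % (2 * M) = L := Nat.div_add_mod L (2 * M)
  have h2 : L % (2 * M) < 2 * M := Nat.mod_lt _ (by omega)
  have h3 : 0 < L / (2 * M) := Nat.div_pos hL (by omega)
  set p := L / (2 * M) with hp
  refine ⟨p, fun j => if j < 2 * p then c₀ + j * M else c₀ + L, h3, by simp [h3],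
    fun j hj => ?_, fun j hj => ?_, by simp [h3]⟩
  · rw [if_pos hj]
    split_ifs with h
    · push_cast; linarith
    · have : j + 1 = 2 * p := by omega
      have h4 : ((j + 1 : ℕ) : ℤ) = 2 * p := by rw [this]; push_cast; ring
      push_cast at h4
      have h5 : (2 * M * p + (L % (2 * M) : ℕ) : ℤ) = L := by exact_mod_cast h1
      nlinarith
  · rw [if_pos hj]
    split_ifs with h
    · push_cast; linarith
    · have : j + 1 = 2 * p := by omega
      have h4 : ((j + 1 : ℕ) : ℤ) = 2 * p := by rw [this]; push_cast; ring
      push_cast at h4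
      have h5 : (2 * M * p + (L % (2 * M) : ℕ) : ℤ) = L := by exact_mod_cast h1
      have h6 : ((L % (2 * M) : ℕ) : ℤ) < 2 * M := by exact_mod_cast h2
      nlinarith

namespace IsBlocking

variable {L M n : ℕ} {c : ℕ → ℤ}

theorem add_le (h : IsBlocking L M n c) {i j : ℕ} (hij : i < j) (hj : j ≤ n) : c i + M ≤ c j := by
  induction j with
  | zero => omega
  | succ j ih =>
    have h1 := h.le_succ j (by omega)
    rcases Nat.lt_succ_iff_lt_or_eq.1 hij with h2 | rfl
    · have := ih h2 (by omega)
      omega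
    · exact h1

theorem succ_add_le (h : IsBlocking L M n c) {i j : ℕ} (hij : i < j) (hj : j < n) :
    c (j + 1) ≤ c i + L := by
  have h1 : c (j + 1) ≤ c n := by
    rcases (Nat.succ_le_of_lt hj).lt_or_eq with h2 | h2
    · have := h.add_le h2 le_rfl
      simp only [Nat.succ_eq_add_one] at this
      omega
    · rw [show j + 1 = n from h2]
  have h2 : c 0 ≤ c i := by
    rcases Nat.eq_zero_or_pos i with rfl | h3
    · exact le_rfl
    · have := h.add_le h3 (by omega)
      omega
  have := h.last
  omega

theorem exists_mem (h : IsBlocking L M n c) {x : ℤ} (h1 : c 0 ≤ x) (h2 : x < c 0 + L) :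
    ∃ j < n, c j ≤ x ∧ x < c (j + 1) := by
  have key : ∀ m, x < c m → ∃ j < m, c j ≤ x ∧ x < c (j + 1) := by
    intro m
    induction m with
    | zero => intro h3; omega
    | succ m ih =>
      intro h3
      rcases lt_or_ge x (c m) with h4 | h4
      · obtain ⟨j, hj, h5⟩ := ih h4
        exact ⟨j, by omega, h5⟩
      · exact ⟨m, by omega, h4, h3⟩
  exact key n (by rw [h.last]; exact h2)

end IsBlocking

end Blocks

end QCA

namespace QCA

/-! ### Construction of the circuit -/

section CircuitConstruction

variable {G : Type*} [Group G] {L : ℕ} [NeZero L] {s : Type} [Fintype s] [DecidableEq s]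
  [Nonempty s] {μ : G →* Matrix.unitaryGroup s ℂ} {K M n N : ℕ} {U U' : Op L s} {c : ℕ → ℤ}

/-- The boundary representations at the cuts of a blocking, transported from the first one. -/
theorem exists_cut_reps (h : IsQCA K U) (hsym : IsSymmetric (fun g => (μ g).val) U)
    (hc : IsBlocking L M n c) (hKN : K < N) (hL : N + 3 * M + 6 * K + 1 ≤ L) {r : ℕ}
    {R₀ : G → Op L s} (hR : FactorRep (symV L μ) (right K U (c 0 + N) (c 0)) r R₀) :
    ∃ R : ℕ → G → Op L s,
      (∀ j < n, FactorRep (symV L μ) (right K U (c j + N) (c j)) r (R j) ∧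
        ∀ g, ntr (R j g) = ntr (R₀ g)) ∧
      ∀ j, j + 1 < n → ∀ g, R (j + 1) g = (symOn (μ g).val (seg L (c j) (c (j + 1))))ᴴ * R j g *
        evolve U (symOn (μ g).val (seg L (c j + N) (c (j + 1) + N))) := by
  -- The phases are propagated from the first cut instead of being chosen at each one. The exact
  -- relation between neighbouring cuts is what makes the gates on the shifted blocks symmetric.
  let R : ℕ → G → Op L s := Nat.rec R₀ fun j Rj g =>
    (symOn (μ g).val (seg L (c j) (c (j + 1))))ᴴ * Rj g *
      evolve U (symOn (μ g).val (seg L (c j + N) (c (j + 1) + N)))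
  refine ⟨R, fun j => ?_, fun j _ g => rfl⟩
  induction j with
  | zero => exact fun _ => ⟨hR, fun g => rfl⟩
  | succ j ih =>
    intro hj
    obtain ⟨h1, h2⟩ := ih (by omega)
    have h3 := hc.le_succ j (by omega)
    have h4 := hc.succ_le j (by omega)
    obtain ⟨h5, h6⟩ := right_shift h hsym (by omega) (c (j + 1) - c j).toNat (by omega) h1
    have e1 : c j + ((c (j + 1) - c j).toNat : ℤ) = c (j + 1) := by omega
    have e2 : c j + N + ((c (j + 1) - c j).toNat : ℤ) = c (j + 1) + N := by omega
    rw [e1, e2] at h5 h6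
    exact ⟨h5, fun g => (h6 g).trans (h2 g)⟩

/-- Local symmetric unitaries that take the boundary algebras of `U` to those of `U'`. -/
theorem exists_block_gates [Finite G] (h : IsQCA K U) (h' : IsQCA K U')
    (hc : IsBlocking L M n c) (hKN : K < N) (hM : N + 2 * K + 1 ≤ M)
    (hL : N + 3 * M + 6 * K + 1 ≤ L) {r : ℕ} {R R' : ℕ → G → Op L s}
    (hR : ∀ j < n, FactorRep (symV L μ) (right K U (c j + N) (c j)) r (R j))
    (hR' : ∀ j < n, FactorRep (symV L μ) (right K U' (c j + N) (c j)) r (R' j))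
    (htr : ∀ j < n, ∀ g, ntr (R j g) = ntr (R' j g)) :
    ∃ Y : ℕ → Op L s, ∀ j < n, Y j ∈ supp (seg L (c j) (c (j + 1))) ∧
      Y j ∈ Matrix.unitaryGroup (ZMod L → s) ℂ ∧ IsSymmetric (fun g => (μ g).val) (Y j) ∧
      (∀ X ∈ right K U (c j + N) (c j), Y j * X * (Y j)ᴴ ∈ right K U' (c j + N) (c j)) ∧
      (∀ X ∈ left K U (c j + N) (c (j + 1)),
        Y j * X * (Y j)ᴴ ∈ left K U' (c j + N) (c (j + 1))) ∧
      (∀ g, Y j * R j g * (Y j)ᴴ = R' j g) ∧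
      ∀ g, (R j g)ᴴ * symOn (μ g).val (seg L (c j) (c (j + 1))) ∈
          left K U (c j + N) (c (j + 1)) ∧
        Y j * ((R j g)ᴴ * symOn (μ g).val (seg L (c j) (c (j + 1)))) * (Y j)ᴴ
          = (R' j g)ᴴ * symOn (μ g).val (seg L (c j) (c (j + 1))) := by
  suffices H : ∀ j, ∃ Y : Op L s, j < n → Y ∈ supp (seg L (c j) (c (j + 1))) ∧
      Y ∈ Matrix.unitaryGroup (ZMod L → s) ℂ ∧ IsSymmetric (fun g => (μ g).val) Y ∧
      (∀ X ∈ right K U (c j + N) (c j), Y * X * Yᴴ ∈ right K U' (c j + N) (c j)) ∧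
      (∀ X ∈ left K U (c j + N) (c (j + 1)), Y * X * Yᴴ ∈ left K U' (c j + N) (c (j + 1))) ∧
      (∀ g, Y * R j g * Yᴴ = R' j g) ∧
      ∀ g, (R j g)ᴴ * symOn (μ g).val (seg L (c j) (c (j + 1))) ∈
          left K U (c j + N) (c (j + 1)) ∧
        Y * ((R j g)ᴴ * symOn (μ g).val (seg L (c j) (c (j + 1)))) * Yᴴ
          = (R' j g)ᴴ * symOn (μ g).val (seg L (c j) (c (j + 1))) by
    choose Y hY using H
    exact ⟨Y, hY⟩
  intro j
  by_cases hj : j < n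
  swap
  · exact ⟨1, fun h => absurd h hj⟩
  have h3 := hc.le_succ j hj
  have h4 := hc.succ_le j hj
  -- For each of `U` and `U'`, the operators on the block factor into the right algebra at its left
  -- end and the left algebra at its right end. Dimension and character of the second factor follow
  -- from those of the first.
  obtain ⟨l, hl, hrl, htl⟩ := right_to_left_static (e := c (j + 1)) h (by omega) (by omega)
    (by omega) (hR j hj)
  obtain ⟨l', hl', hrl', htl'⟩ := right_to_left_static (e := c (j + 1)) h' (by omega) (by omega)
    (by omega) (hR' j hj)
  have hll : l' = l := Nat.eq_of_mul_eq_mul_left (hR j hj).rank_pos (hrl'.trans hrl.symm)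
  subst hll
  have htr' : ∀ g, ntr ((R j g)ᴴ * symOn (μ g).val (seg L (c j) (c (j + 1))))
      = ntr ((R' j g)ᴴ * symOn (μ g).val (seg L (c j) (c (j + 1)))) := by
    intro g
    by_cases hg : ntr (μ g).val = 0
    · rw [left_ntr_eq_zero h (by omega) hl hg, left_ntr_eq_zero h' (by omega) hl' hg]
    · have h5 := htl g
      rw [← htl' g, htr j hj g] at h5
      refine mul_left_cancel₀ (fun h0 => ?_) h5
      have h6 := htl' g
      rw [h0, zero_mul] at h6
      exact pow_ne_zero _ hg h6.symm
  have hsr : ∀ W : Op L s, ∀ X ∈ right K W (c j + N) (c j), X ∈ supp (seg L (c j) (c (j + 1))) :=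
    fun W X hX => supp_mono (seg_mono le_rfl (by omega)) hX.2
  have hsl : ∀ W : Op L s, ∀ X ∈ left K W (c j + N) (c (j + 1)),
      X ∈ supp (seg L (c j) (c (j + 1))) :=
    fun W X hX => supp_mono (seg_mono (by omega) le_rfl) hX.2
  obtain ⟨Y, hY1, hY2, hY3, hY4, hY5, hY6⟩ := exists_intertwining_gate (hR j hj) (hR' j hj)
    (htr j hj) hl hl' htr' (hsr U) (hsr U') (hsl U) (hsl U')
    (fun X hX Z hZ => right_left_commute h (by omega) hX hZ)
    (fun X hX Z hZ => right_left_commute h' (by omega) hX hZ)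
  have hYY : Yᴴ * Y = 1 := Matrix.mem_unitaryGroup_iff'.1 hY2
  refine ⟨Y, fun _ => ⟨hY1, hY2, isSymmetric_of_mem_supp hY1 fun g => ?_, hY3, hY4, hY5,
    fun g => ⟨hl.mem g, hY6 g⟩⟩⟩
  -- The symmetry operator of the block is `P g` times its partner in the left algebra. The gate
  -- carries this factorization for `U` to the one for `U'`, hence fixes the product.
  have e : ∀ {P : G → Op L s}, P g * (P g)ᴴ = 1 → symOn (μ g).val (seg L (c j) (c (j + 1)))
      = P g * ((P g)ᴴ * symOn (μ g).val (seg L (c j) (c (j + 1)))) := fun {P} hP => by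
    rw [← mul_assoc, hP, one_mul]
  conv_lhs => rw [e ((hR j hj).unitary' g)]
  conv_rhs => rw [e ((hR' j hj).unitary' g)]
  rw [← hY6 g, ← hY5 g]
  calc _ = Y * R j g * ((Yᴴ * Y) * ((R j g)ᴴ * symOn (μ g).val (seg L (c j) (c (j + 1)))) *
        (Yᴴ * Y)) := by rw [hYY, one_mul, mul_one]; simp only [mul_assoc]
    _ = _ := by simp only [mul_assoc]

/-- Evolved operators on a segment are combinations of products of elements of the two boundary
algebras. -/
theorem evolve_seg_induction (h : IsQCA K U) {a b e : ℤ} (h1 : a + K ≤ e)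
    (h2 : e + K ≤ b) (hL : b - a + 4 * K + 1 ≤ L) {r : ℕ} {V R : G → Op L s}
    (hR : FactorRep V (right K U b e) r R) {P : Op L s → Prop}
    (hadd : ∀ X Y, P X → P Y → P (X + Y)) (h0 : P 0)
    (hmul : ∀ X ∈ left K U a e, ∀ Y ∈ right K U b e, P (X * Y))
    {A : Op L s} (hA : A ∈ supp (seg L a b)) : P (evolve U A) := by
  have hU := h.mul_conjTranspose
  obtain ⟨φ, -, hφ, -⟩ := hR
  have mφ : ∀ x, φ x ∈ right K U b e := fun x => hφ ▸ ⟨x, rfl⟩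
  have hb := bal_eq_right (a := a) (e := b + K) h h1 h2 le_rfl (by omega)
  obtain ⟨Z, hAZ, hZc, hZ⟩ := FactorRep.exists_commutant_decomposition φ (evolve U A)
  -- The coefficients commute with the right algebra at `e`, so they are supported left of that cut.
  have hZl : ∀ i j, Z i j ∈ left K U a e := by
    intro i j
    have hs := splits_seg (L := L) h1 h2 hL
    rw [← bal_eq_left (b := b) (e := a - K) h h2 h1 (by omega) (by omega)]
    have hZI : evolve Uᴴ (Z i j) ∈ supp (seg L a b) := by
      have hm : ∀ x, evolve Uᴴ (φ x) ∈ supp (seg L a b) := fun x => by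
        have := mφ x
        rw [← hb] at this
        exact this.1
      rw [hZ]
      change evolveHom _ h.symm.mul_conjTranspose _ ∈ _
      rw [map_sum]
      refine sum_mem fun k _ => ?_
      rw [map_mul, map_mul]
      refine mul_mem (mul_mem (hm _) ?_) (hm _)
      change evolve Uᴴ (evolve U A) ∈ _
      rwa [evolve_symm_evolve hU]
    refine ⟨hZI, mem_supp_of_commute_bal h hs hZI fun Y hY => ?_⟩
    rw [hb, ← hφ] at hY
    obtain ⟨y, rfl⟩ := hY
    exact (hZc i j y).symm
  rw [hAZ]
  refine Finset.sum_induction _ P hadd h0 fun i _ => Finset.sum_induction _ P hadd h0 fun j _ => ?_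
  rw [hZc]
  exact hmul _ (hZl i j) _ (mφ _)

/-- A unitary that preserves the operators on `I` under conjugation acts on them as a local
unitary. -/
theorem exists_local_gate {T : Op L s} (hT : T * Tᴴ = 1) {I : Set (ZMod L)}
    (h : ∀ A ∈ (supp I : StarSubalgebra ℂ (Op L s)), evolve T A ∈ supp I) :
    ∃ X : Op L s, X ∈ supp I ∧ X ∈ Matrix.unitaryGroup (ZMod L → s) ℂ ∧
      ∀ A ∈ (supp I : StarSubalgebra ℂ (Op L s)), X * evolve T A = A * X := by
  classical
  obtain ⟨β, hβ⟩ := exists_starAlgHom_lift (embOp I) (starAlgHom_injective _)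
    ((evolveHom T hT).comp (embOp I)) fun x =>
      show ∃ y, embOp I y = evolve T (embOp I x) from h _ (embOp_mem I x)
  obtain ⟨x, -, hx, hxβ⟩ := exists_unitary_conj β (StarAlgHom.id ℂ _)
  refine ⟨embOp I x, embOp_mem I x, Matrix.mem_unitaryGroup_iff.2 ?_, ?_⟩
  · rw [← map_star, ← map_mul, Matrix.star_eq_conjTranspose, hx, map_one]
  · rintro _ ⟨a, rfl⟩
    change embOp I x * evolve T (embOp I a) = embOp I a * embOp I x
    have h1 : evolve T (embOp I a) = embOp I (β a) := (hβ a).symm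
    rw [h1, ← map_mul, hxβ, map_mul]
    rfl

theorem list_prod_mem_unitary {ι : Type*} {V : ι → Op L s} {l : List ι}
    (h : ∀ i ∈ l, V i ∈ Matrix.unitaryGroup (ZMod L → s) ℂ) :
    (l.map V).prod ∈ Matrix.unitaryGroup (ZMod L → s) ℂ :=
  list_prod_mem fun A hA => by
    obtain ⟨i, hi, rfl⟩ := List.mem_map.1 hA
    exact h i hi

theorem list_prod_isSymmetric {ι : Type*} {V : ι → Op L s} {l : List ι}
    (h : ∀ i ∈ l, IsSymmetric (fun g => (μ g).val) (V i)) :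
    IsSymmetric (fun g => (μ g).val) (l.map V).prod :=
  IsSymmetric.list_prod fun A hA => by
    obtain ⟨i, hi, rfl⟩ := List.mem_map.1 hA
    exact h i hi

/-- Symmetric QCA whose boundary algebras have the same invariants differ by a symmetric circuit of
depth four. -/
theorem isSymmetricCircuit_of_ntr_eq [Finite G] (h : IsQCA K U) (h' : IsQCA K U')
    (hsym : IsSymmetric (fun g => (μ g).val) U) (hsym' : IsSymmetric (fun g => (μ g).val) U')
    (hKN : K < N) (hM : N + 2 * K + 1 ≤ M) (hL : N + 5 * M + 6 * K + 1 ≤ L) {r : ℕ} {c₀ : ℤ}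
    {R₀ R₀' : G → Op L s} (hR₀ : FactorRep (symV L μ) (right K U (c₀ + N) c₀) r R₀)
    (hR₀' : FactorRep (symV L μ) (right K U' (c₀ + N) c₀) r R₀')
    (htr : ∀ g, ntr (R₀ g) = ntr (R₀' g)) :
    IsSymmetricCircuit (fun g => (μ g).val) 4 (3 * M + 2 * K) (U * U'ᴴ) := by
  obtain ⟨p, c, hp, rfl, hc⟩ := exists_isBlocking (L := L) (M := M) (by omega) (by omega) c₀
  obtain ⟨R, hR, hRs⟩ := exists_cut_reps h hsym hc hKN (by omega) hR₀
  obtain ⟨R', hR', hRs'⟩ := exists_cut_reps h' hsym' hc hKN (by omega) hR₀'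
  obtain ⟨Yg, hYg⟩ := exists_block_gates h h' hc hKN hM (by omega) (fun j hj => (hR j hj).1)
    (fun j hj => (hR' j hj).1)
    (fun j hj g => by rw [(hR j hj).2, (hR' j hj).2, htr])
  have hU := h.mul_conjTranspose
  have hU' := h'.mul_conjTranspose
  have hUt' := h'.conjTranspose_mul
  -- the product of all block gates
  set l₀ : List ℕ := (List.range p).map (2 * ·) with hl₀
  set l₁ : List ℕ := (List.range p).map (2 * · + 1) with hl₁
  have hmem : ∀ k, k ∈ l₀ ++ l₁ ↔ k < 2 * p := by
    intro k
    simp only [hl₀, hl₁, List.mem_append, List.mem_map, List.mem_range]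
    constructor
    · rintro (⟨i, hi, rfl⟩ | ⟨i, hi, rfl⟩) <;> omega
    · intro hk
      rcases Nat.even_or_odd' k with ⟨i, rfl | rfl⟩
      · exact Or.inl ⟨i, by omega, rfl⟩
      · exact Or.inr ⟨i, by omega, rfl⟩
  have hnodup : (l₀ ++ l₁).Nodup := by
    refine List.Nodup.append (List.Nodup.map (fun i j hij => ?_) List.nodup_range)
      (List.Nodup.map (fun i j hij => ?_) List.nodup_range) ?_
    · omega
    · omega
    · intro k hk hk'
      obtain ⟨i, -, rfl⟩ := List.mem_map.1 hk
      obtain ⟨j, -, hj⟩ := List.mem_map.1 hk'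
      omega
  have hJdisj : ∀ {b : ℕ → ℤ}, IsBlocking L M (2 * p) b → ∀ i < 2 * p, ∀ j < 2 * p, i ≠ j →
      Disjoint (seg L (b i) (b (i + 1))) (seg L (b j) (b (j + 1))) := by
    intro b hb
    have : ∀ i j, j < 2 * p → i < j →
        Disjoint (seg L (b i) (b (i + 1))) (seg L (b j) (b (j + 1))) := by
      intro i j hj hij
      refine seg_disjoint ?_ (hb.succ_add_le hij hj)
      rcases (Nat.succ_le_of_lt hij).lt_or_eq with h1 | h1
      · have := hb.add_le h1 hj.le
        simp only [Nat.succ_eq_add_one] at this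
        omega
      · rw [show i + 1 = j from h1]
    intro i hi j hj hij
    rcases lt_or_gt_of_ne hij with h1 | h1
    · exact this i j hj h1
    · exact (this j i hi h1).symm
  set Y : Op L s := ((l₀ ++ l₁).map Yg).prod with hY
  have hYu : Y ∈ Matrix.unitaryGroup (ZMod L → s) ℂ :=
    list_prod_mem_unitary fun i hi => (hYg i ((hmem i).1 hi)).2.1
  have hYY : Y * Yᴴ = 1 := Matrix.mem_unitaryGroup_iff.1 hYu
  have hYY' : Yᴴ * Y = 1 := Matrix.mem_unitaryGroup_iff'.1 hYu
  have hYYt : Yᴴ * Yᴴᴴ = 1 := by rw [Matrix.conjTranspose_conjTranspose, hYY']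
  have hYs : IsSymmetric (fun g => (μ g).val) Y :=
    list_prod_isSymmetric fun i hi => (hYg i ((hmem i).1 hi)).2.2.1
  have hYc : ∀ j < 2 * p, ∀ A ∈ (supp (seg L (c j) (c (j + 1))) : StarSubalgebra ℂ (Op L s)),
      evolve Yᴴ A = Yg j * A * (Yg j)ᴴ := by
    intro j hj A hA
    have h1 := (list_prod_conj (S := fun i => seg L (c i) (c (i + 1))) hnodup
      (fun i hi => (hYg i ((hmem i).1 hi)).1) (fun i hi => (hYg i ((hmem i).1 hi)).2.1)
      (fun i hi hij => hJdisj hc i ((hmem i).1 hi) j hj hij) hA).1 ((hmem j).2 hj)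
    rw [evolve, Matrix.conjTranspose_conjTranspose, hY, h1, ← hY, mul_assoc, hYY, mul_one]
  have hYl : ∀ j < 2 * p, ∀ X ∈ left K U (c j + N) (c (j + 1)),
      evolve Yᴴ X ∈ left K U' (c j + N) (c (j + 1)) := by
    intro j hj X hX
    have h3 := hc.le_succ j hj
    rw [hYc j hj X (supp_mono (seg_mono (by omega) le_rfl) hX.2)]
    exact (hYg j hj).2.2.2.2.1 X hX
  have hYr : ∀ j < 2 * p, ∀ X ∈ right K U (c j + N) (c j),
      evolve Yᴴ X ∈ right K U' (c j + N) (c j) := by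
    intro j hj X hX
    have h3 := hc.le_succ j hj
    rw [hYc j hj X (supp_mono (seg_mono le_rfl (by omega)) hX.2)]
    exact (hYg j hj).2.2.2.1 X hX
  -- The block after the last one is the first: the cut `c 0 + L` equals `c 0` on the ring.
  have hcyc : ∀ j < 2 * p, ∃ k < 2 * p, ∀ W : Op L s,
      right K W (c (j + 1) + N) (c (j + 1)) = right K W (c k + N) (c k) := by
    intro j hj
    rcases (Nat.succ_le_of_lt hj).lt_or_eq with h1 | h1
    · exact ⟨j + 1, h1, fun W => rfl⟩
    · refine ⟨0, by omega, fun W => ?_⟩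
      rw [show j + 1 = 2 * p from h1, hc.last]
      exact right_congr (by push_cast; simp) (by ring)
  -- the induced unitary is a product of gates on the shifted blocks
  set T : Op L s := U * Yᴴ * U'ᴴ with hT
  have hTT : T * Tᴴ = 1 := by
    rw [hT, Matrix.conjTranspose_mul, Matrix.conjTranspose_mul, Matrix.conjTranspose_conjTranspose,
      Matrix.conjTranspose_conjTranspose]
    calc _ = U * (Yᴴ * (U'ᴴ * U') * Y) * Uᴴ := by simp only [mul_assoc]
      _ = 1 := by rw [hUt', mul_one, hYY', mul_one, hU]
  have hTe : ∀ A, evolve T A = evolve U'ᴴ (evolve Yᴴ (evolve U A)) := fun A => by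
    rw [hT, evolve_comp, evolve_comp]
  have hTs : IsSymmetric (fun g => (μ g).val) T := (hsym.mul hYs.symm).mul hsym'.symm
  have hb : IsBlocking L M (2 * p) fun j => c j + N :=
    ⟨fun j hj => by have := hc.le_succ j hj; omega,
      fun j hj => by have := hc.succ_le j hj; omega,
      by have := hc.last; omega⟩
  -- Under `U`, the operators on a shifted block become products from a left algebra in block `j`
  -- and a right algebra in the next block. `Y` carries these to the algebras of `U'`, whose
  -- preimages lie in the shifted block again.
  have hTI : ∀ j < 2 * p, ∀ A ∈
      (supp (seg L (c j + N) (c (j + 1) + N)) : StarSubalgebra ℂ (Op L s)),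
      evolve T A ∈ supp (seg L (c j + N) (c (j + 1) + N)) := by
    intro j hj A hA
    have h3 := hc.le_succ j hj
    have h4 := hc.succ_le j hj
    obtain ⟨k, hk, hkr⟩ := hcyc j hj
    rw [hTe]
    refine evolve_seg_induction (P := fun X => evolve U'ᴴ (evolve Yᴴ X) ∈
        supp (seg L (c j + N) (c (j + 1) + N))) h (e := c (j + 1)) (by omega) (by omega) (by omega)
      ((hR k hk).1.congr_set (hkr U).symm) (fun X Z hX hZ => ?_) ?_ (fun X hX Z hZ => ?_) hA
    · simp only [evolve_add]
      exact add_mem hX hZ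
    · simp only [evolve, mul_zero, zero_mul]
      exact zero_mem _
    · simp only [evolve_mul hYYt, evolve_mul h'.symm.mul_conjTranspose]
      refine mul_mem ?_ ?_
      · exact supp_mono (seg_mono le_rfl (by omega)) (hYl j hj X hX).1
      · have h5 := hYr k hk Z (hkr U ▸ hZ)
        rw [← hkr] at h5
        exact supp_mono (seg_mono (by omega) le_rfl) h5.1
  have hX : ∀ j, ∃ X : Op L s, j < 2 * p → X ∈ supp (seg L (c j + N) (c (j + 1) + N)) ∧
      X ∈ Matrix.unitaryGroup (ZMod L → s) ℂ ∧
      ∀ A ∈ (supp (seg L (c j + N) (c (j + 1) + N)) : StarSubalgebra ℂ (Op L s)),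
        X * evolve T A = A * X := by
    intro j
    by_cases hj : j < 2 * p
    · obtain ⟨X, hX⟩ := exists_local_gate hTT (hTI j hj)
      exact ⟨X, fun _ => hX⟩
    · exact ⟨1, fun hj' => absurd hj' hj⟩
  choose X hX using hX
  have hXs : ∀ j, j + 1 < 2 * p → IsSymmetric (fun g => (μ g).val) (X j) := by
    intro j hj
    obtain ⟨hX1, -, hX3⟩ := hX j (by omega)
    refine isSymmetric_of_mem_supp hX1 fun g => ?_
    have hI := symOn_mem_supp (L := L) (μ g).val (seg L (c j + N) (c (j + 1) + N))
    rw [← hX3 _ hI]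
    congr 1
    -- The evolved symmetry of a shifted block is the left partner at one cut times the right
    -- representation at the next, for `U` and `U'` alike. `Y` matches the factors, so `T` fixes the
    -- symmetry of the shifted block.
    have key : ∀ {W : Op L s} {P : ℕ → G → Op L s}, P j g * (P j g)ᴴ = 1 → (P j g)ᴴ * P j g = 1 →
        P (j + 1) g = (symOn (μ g).val (seg L (c j) (c (j + 1))))ᴴ * P j g *
        evolve W (symOn (μ g).val (seg L (c j + N) (c (j + 1) + N))) →
        evolve W (symOn (μ g).val (seg L (c j + N) (c (j + 1) + N))) =
          ((P j g)ᴴ * symOn (μ g).val (seg L (c j) (c (j + 1)))) * P (j + 1) g := by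
      intro W P h1 h2 h3
      have h4 : symOn (μ g).val (seg L (c j) (c (j + 1))) *
          (symOn (μ g).val (seg L (c j) (c (j + 1))))ᴴ = 1 :=
        mul_eq_one_comm.1 (symOn_unitary (symm_unitary μ g) _)
      rw [h3, mul_assoc, ← mul_assoc (symOn _ _), ← mul_assoc (symOn _ _), h4, one_mul, ← mul_assoc,
        h2, one_mul]
    have hRj := (hR j (by omega)).1
    have hRj' := (hR' j (by omega)).1
    have h3 := hc.le_succ j (by omega)
    have h3' := hc.le_succ (j + 1) hj
    obtain ⟨-, -, -, -, -, -, hg⟩ := hYg j (by omega)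
    obtain ⟨-, -, -, -, -, hg', -⟩ := hYg (j + 1) hj
    rw [hTe, key (hRj.unitary' g) (hRj.unitary g) (hRs j hj g), evolve_mul hYYt,
      hYc j (by omega) _ (supp_mono (seg_mono (by omega) le_rfl) (hg g).1.2), (hg g).2,
      hYc (j + 1) hj _ (supp_mono (seg_mono le_rfl (by omega)) ((hR (j + 1) hj).1.mem g).2), hg',
      ← key (hRj'.unitary' g) (hRj'.unitary g) (hRs' j hj g), evolve_symm_evolve hU']
  set P : Op L s := ((List.range (2 * p)).map X).prod with hP
  have hPu : P ∈ Matrix.unitaryGroup (ZMod L → s) ℂ :=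
    list_prod_mem_unitary fun i hi => (hX i (List.mem_range.1 hi)).2.1
  have hPP : Pᴴ * P = 1 := Matrix.mem_unitaryGroup_iff'.1 hPu
  -- `P` and `T` act alike on the operators of every shifted block. The shifted blocks cover the
  -- ring, so `P * Tᴴ` is a scalar.
  have hPT : P * Tᴴ ∈ supp (∅ : Set (ZMod L)) := by
    refine mem_supp_empty_of_commute
      (S := fun j : Fin (2 * p) => seg L (c j + N) (c (j + 1) + N)) (fun x => ?_) fun j A hA => ?_
    · obtain ⟨k, hk1, hk2, rfl⟩ := exists_lift_seg x (c 0 + N)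
      obtain ⟨j, hj, h1, h2⟩ := hb.exists_mem hk1 hk2
      exact ⟨⟨j, hj⟩, mem_seg h1 h2⟩
    · have h1 := (list_prod_conj (S := fun i => seg L (c i + N) (c (i + 1) + N))
        List.nodup_range (fun i hi => (hX i (List.mem_range.1 hi)).1)
        (fun i hi => (hX i (List.mem_range.1 hi)).2.1)
        (fun i hi hij => hJdisj hb i (List.mem_range.1 hi) j j.2 hij) (hTI j j.2 A hA)).1
        (List.mem_range.2 j.2)
      obtain ⟨-, h2, h3⟩ := hX j j.2
      have h4 : X j * (X j)ᴴ = 1 := Matrix.mem_unitaryGroup_iff.1 h2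
      rw [← hP, h3 A hA, mul_assoc A, h4, mul_one] at h1
      rw [← mul_assoc, ← h1, evolve, mul_assoc, mul_assoc, mul_assoc (Tᴴ * A), hTT, mul_one]
  have hScal : T * Pᴴ ∈ supp (∅ : Set (ZMod L)) := by
    have h1 := star_mem hPT
    rwa [Matrix.star_eq_conjTranspose, Matrix.conjTranspose_mul,
      Matrix.conjTranspose_conjTranspose] at h1
  have hScals : IsSymmetric (fun g => (μ g).val) (T * Pᴴ) := fun g =>
    supp_commute (Set.empty_disjoint _) hScal (symOn_mem_supp _ _)
  have hTP : T = T * Pᴴ * P := by rw [mul_assoc, hPP, mul_one]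
  have hTu : T ∈ Matrix.unitaryGroup (ZMod L → s) ℂ := Matrix.mem_unitaryGroup_iff.2 hTT
  have hPs : IsSymmetric (fun g => (μ g).val) P := by
    have h1 : P = P * Tᴴ * T := by rw [mul_assoc, mul_eq_one_comm.1 hTT, mul_one]
    have h2 : IsSymmetric (fun g => (μ g).val) (P * Tᴴ) := fun g =>
      supp_commute (Set.empty_disjoint _) hPT (symOn_mem_supp _ _)
    rw [h1]
    exact h2.mul hTs
  -- The relation between neighbouring representations is available only before the last cut. The
  -- last gate is symmetric because it is the quotient of the symmetric operator `P` by the other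
  -- gates.
  have hXs' : ∀ j < 2 * p, IsSymmetric (fun g => (μ g).val) (X j) := by
    intro j hj
    by_cases h1 : j + 1 < 2 * p
    · exact hXs j h1
    · have h2 : 2 * p = j + 1 := by omega
      have h3 : IsSymmetric (fun g => (μ g).val) ((List.range j).map X).prod :=
        list_prod_isSymmetric fun i hi => hXs i (by have := List.mem_range.1 hi; omega)
      have h4 : ((List.range j).map X).prod ∈ Matrix.unitaryGroup (ZMod L → s) ℂ :=
        list_prod_mem_unitary fun i hi => (hX i (by have := List.mem_range.1 hi; omega)).2.1
      have h5 : P = ((List.range j).map X).prod * X j := by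
        rw [hP, h2, List.range_succ, List.map_append, List.prod_append]
        simp
      have h6 : X j = (((List.range j).map X).prod)ᴴ * P := by
        have h7 : (((List.range j).map X).prod)ᴴ * ((List.range j).map X).prod = 1 :=
          Matrix.mem_unitaryGroup_iff'.1 h4
        rw [h5, ← mul_assoc, h7, one_mul]
      rw [h6]
      exact h3.symm.mul hPs
  -- assembling the circuit
  have hev : ∀ l : List ℕ, evolve U'ᴴ (l.map Yg).prod
      = (l.map fun i => evolve U'ᴴ (Yg i)).prod := fun l => by
    change evolveHom U'ᴴ h'.symm.mul_conjTranspose _ = _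
    rw [map_list_prod, List.map_map]; rfl
  have hgate : ∀ j < 2 * p, evolve U'ᴴ (Yg j) ∈ supp (seg L (c j - K) (c (j + 1) + K)) ∧
      evolve U'ᴴ (Yg j) ∈ Matrix.unitaryGroup (ZMod L → s) ℂ ∧
      IsSymmetric (fun g => (μ g).val) (evolve U'ᴴ (Yg j)) := by
    intro j hj
    obtain ⟨h1, h2, h3, -⟩ := hYg j hj
    refine ⟨supp_mono (nbr_seg_subset K _ _) (h'.symm.evolve_mem h1),
      mul_mem (mul_mem (Unitary.star_mem h'.symm.1) h2) h'.symm.1, ?_⟩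
    rw [evolve, Matrix.conjTranspose_conjTranspose]
    exact (hsym'.mul h3).mul hsym'.symm
  -- This is `U * U'ᴴ = T * (U' * Y * U'ᴴ)`. The conjugated block gates extend `K` sites into the
  -- neighbouring blocks, so even and odd blocks form separate layers.
  have hfin : U * U'ᴴ = T * Pᴴ * P * (((List.range p).map fun i => evolve U'ᴴ (Yg (2 * i))).prod *
      ((List.range p).map fun i => evolve U'ᴴ (Yg (2 * i + 1))).prod) := by
    have h1 : evolve U'ᴴ Y = ((List.range p).map fun i => evolve U'ᴴ (Yg (2 * i))).prod *
      ((List.range p).map fun i => evolve U'ᴴ (Yg (2 * i + 1))).prod := by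
      rw [hY, hev, List.map_append, List.prod_append, hl₀, hl₁, List.map_map, List.map_map]
      rfl
    rw [← hTP, ← h1, evolve, Matrix.conjTranspose_conjTranspose, hT]
    calc U * U'ᴴ = U * (Yᴴ * ((U'ᴴ * U') * Y)) * U'ᴴ := by rw [hUt', one_mul, hYY', mul_one]
      _ = _ := by simp only [mul_assoc]
  refine ⟨![T * Pᴴ, P, ((List.range p).map fun i => evolve U'ᴴ (Yg (2 * i))).prod,
    ((List.range p).map fun i => evolve U'ᴴ (Yg (2 * i + 1))).prod], ?_, ?_⟩
  swap
  · rw [hfin]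
    simp [List.ofFn_succ, mul_assoc]
  -- The scalar `T * Pᴴ` is a gate on an interval of length zero.
  have l1 : IsSymmetricLayer (fun g => (μ g).val) (3 * M + 2 * K) (T * Pᴴ) := by
    have := isSymmetricLayer_of_list (L := L) (μ := fun g => (μ g).val) (ℓ := 3 * M + 2 * K) (n := 1)
      (x := fun _ => 0) (y := fun _ => 0) (V := fun _ => T * Pᴴ) (fun _ _ => le_rfl)
      (fun _ _ => by positivity) (fun i j h1 h2 => by omega)
      (fun _ _ => supp_mono (Set.empty_subset _) hScal)
      (fun _ _ => mul_mem hTu (Unitary.star_mem hPu)) (fun _ _ => hScals)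
    simpa using this
  have l2 : IsSymmetricLayer (fun g => (μ g).val) (3 * M + 2 * K) P := by
    refine isSymmetricLayer_of_list (x := fun j => c j + N) (y := fun j => c (j + 1) + N)
      (fun i hi => ?_) (fun i hi => ?_) (fun i j hij hj => ⟨?_, hb.succ_add_le hij hj⟩)
      (fun i hi => (hX i hi).1) (fun i hi => (hX i hi).2.1) hXs'
    · have := hc.le_succ i hi; omega
    · have := hc.succ_le i hi; push_cast; omega
    · rcases (Nat.succ_le_of_lt hij).lt_or_eq with h1 | h1
      · have := hb.add_le h1 hj.le
        simp only [Nat.succ_eq_add_one] at this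
        omega
      · rw [show i + 1 = j from h1]
  have l3 : IsSymmetricLayer (fun g => (μ g).val) (3 * M + 2 * K)
      ((List.range p).map fun i => evolve U'ᴴ (Yg (2 * i))).prod := by
    refine isSymmetricLayer_of_list (x := fun i => c (2 * i) - K) (y := fun i => c (2 * i + 1) + K)
      (fun i hi => ?_) (fun i hi => ?_) (fun i j hij hj => ⟨?_, ?_⟩)
      (fun i hi => (hgate (2 * i) (by omega)).1) (fun i hi => (hgate (2 * i) (by omega)).2.1)
      (fun i hi => (hgate (2 * i) (by omega)).2.2)
    · have := hc.le_succ (2 * i) (by omega); omega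
    · have := hc.succ_le (2 * i) (by omega); push_cast; omega
    · have := hc.add_le (i := 2 * i + 1) (j := 2 * j) (by omega) (by omega)
      omega
    · have h1 := hc.succ_add_le (i := 2 * i) (j := 2 * j + 1) (by omega) (by omega)
      have h2 := hc.le_succ (2 * j + 1) (by omega)
      omega
  have l4 : IsSymmetricLayer (fun g => (μ g).val) (3 * M + 2 * K)
      ((List.range p).map fun i => evolve U'ᴴ (Yg (2 * i + 1))).prod := by
    refine isSymmetricLayer_of_list (x := fun i => c (2 * i + 1) - K)
      (y := fun i => c (2 * i + 1 + 1) + K)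
      (fun i hi => ?_) (fun i hi => ?_) (fun i j hij hj => ⟨?_, ?_⟩)
      (fun i hi => (hgate (2 * i + 1) (by omega)).1)
      (fun i hi => (hgate (2 * i + 1) (by omega)).2.1)
      (fun i hi => (hgate (2 * i + 1) (by omega)).2.2)
    · have := hc.le_succ (2 * i + 1) (by omega); omega
    · have := hc.succ_le (2 * i + 1) (by omega); push_cast; omega
    · have := hc.add_le (i := 2 * i + 1 + 1) (j := 2 * j + 1) (by omega) (by omega)
      omega
    · have h1 := hc.succ_add_le (i := 2 * i) (j := 2 * j + 1) (by omega) (by omega)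
      have h2 := hc.le_succ (2 * i) (by omega)
      omega
  intro t
  fin_cases t
  · exact l1
  · exact l2
  · exact l3
  · exact l4

end CircuitConstruction

end QCA

namespace QCA

/-! ### From the given representations to boundary data -/

section Characters

variable {G : Type*} [Group G]

/-- Representations with the same dimension and the same character up to `u` are equivalent. -/
theorem equivUpTo_of_ntr [Finite G] {p q : Type} [Fintype p] [Fintype q] [DecidableEq p]
    [DecidableEq q] (A : G →* Matrix.unitaryGroup p ℂ) (B : G →* Matrix.unitaryGroup q ℂ)
    (u : G →* Circle) (hcard : Fintype.card p = Fintype.card q)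
    (h : ∀ g, ntr (A g).val = u g * ntr (B g).val) :
    EquivUpTo u (fun g => (A g).val) fun g => (B g).val := by
  have hu : ∀ g, star (u g : ℂ) * u g = 1 := fun g => by
    rw [Complex.star_def, Complex.conj_mul', Circle.norm_coe]; simp
  let B' : G →* Matrix.unitaryGroup q ℂ := MonoidHom.mk'
    (fun g => ⟨(u g : ℂ) • (B g).val, Matrix.mem_unitaryGroup_iff'.2 (by
      rw [star_smul, smul_mul_assoc, mul_smul_comm, Matrix.mem_unitaryGroup_iff'.1 (B g).2,
        smul_smul, hu, one_smul])⟩)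
    fun g k => Subtype.ext (by simp [smul_smul, mul_comm])
  rcases isEmpty_or_nonempty p with hp | hp
  · have hq : IsEmpty q := by
      rw [← Fintype.card_eq_zero_iff, ← hcard]; exact Fintype.card_eq_zero
    exact ⟨0, Subsingleton.elim _ _, Subsingleton.elim _ _, fun g => Subsingleton.elim _ _⟩
  have hp0 : (Fintype.card p : ℂ) ≠ 0 := by exact_mod_cast Fintype.card_ne_zero
  obtain ⟨T, h1, h2, h3⟩ := exists_unitary_intertwiner A B' fun g => by
    have h4 : ntr (A g).val = ntr (B' g).val := by
      rw [h g, show (B' g).val = (u g : ℂ) • (B g).val from rfl, ntr_smul]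
    rw [ntr, ntr, ← hcard] at h4
    exact (div_left_inj' hp0).1 h4
  refine ⟨T, h2, h1, fun g => (h3 g).trans ?_⟩
  rw [show (B' g).val = (u g : ℂ) • (B g).val from rfl, Matrix.mul_smul]

theorem EquivUpTo.card_eq {p q : Type} [Fintype p] [Fintype q] [DecidableEq p] [DecidableEq q]
    {u : G →* Circle} {A : G → Matrix p p ℂ} {B : G → Matrix q q ℂ} (h : EquivUpTo u A B) :
    Fintype.card p = Fintype.card q := by
  obtain ⟨T, h1, h2, -⟩ := h
  have h3 := Matrix.trace_mul_comm T Tᴴ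
  rw [h1, h2, Matrix.trace_one, Matrix.trace_one] at h3
  exact_mod_cast h3

theorem EquivUpTo.ntr_eq {p q : Type} [Fintype p] [Fintype q] [DecidableEq p] [DecidableEq q]
    {u : G →* Circle} {A : G → Matrix p p ℂ} {B : G → Matrix q q ℂ} (h : EquivUpTo u A B) (g : G) :
    ntr (A g) = u g * ntr (B g) := by
  have hc := h.card_eq
  obtain ⟨T, h1, h2, h3⟩ := h
  have h4 : A g = (u g : ℂ) • (T * B g * Tᴴ) := by
    rw [← Matrix.smul_mul, ← h3, Matrix.mul_assoc, h1, mul_one]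
  rw [h4, ntr_smul, ntr, ntr, hc, Matrix.trace_mul_comm, ← Matrix.mul_assoc, h2, one_mul]

end Characters

section RightRep

variable {G : Type*} [Group G] {L : ℕ} [NeZero L] {s : Type} [Fintype s] [DecidableEq s]
  [Nonempty s] {μ : G →* Matrix.unitaryGroup s ℂ} {ξ n : ℕ} {U : Op L s}

omit [NeZero L] in
theorem arc_interval (c : ℤ) (n : ℕ) :
    arc ((c : ZMod L) - (n : ZMod L)) (2 * n) = seg L (c - n) (c + n) := by
  have : ((c : ZMod L) - (n : ZMod L)) = ((c - n : ℤ) : ZMod L) := by push_cast; rfl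
  rw [this, arc_eq_seg]
  congr 1
  push_cast; ring

omit [NeZero L] in
theorem arc_right (c : ℤ) (n ξ : ℕ) :
    arc (c : ZMod L) (n + ξ) = seg L c (c + n + ξ) := by
  rw [arc_eq_seg]
  congr 1
  push_cast; ring

omit [NeZero L] in
theorem arc_left (c : ℤ) (n ξ : ℕ) :
    arc ((c : ZMod L) - ((n + ξ : ℕ) : ZMod L)) (n + ξ) = seg L (c - n - ξ) c := by
  have : ((c : ZMod L) - ((n + ξ : ℕ) : ZMod L)) = ((c - n - ξ : ℤ) : ZMod L) := by
    push_cast; ring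
  rw [this, arc_eq_seg]
  congr 1
  push_cast; ring

theorem rightSet_eq (hU : U * Uᴴ = 1) (I P : Set (ZMod L)) :
    {B | (∃ A : Op L s, SupportedOn I A ∧ B = evolve U A) ∧ SupportedOn P B} = bal U I P := by
  ext B
  refine and_congr ⟨?_, fun hB => ⟨_, mem_supp.1 hB, (evolve_evolve_symm hU B).symm⟩⟩ mem_supp.symm
  rintro ⟨A, hA, rfl⟩
  rw [evolve_symm_evolve hU]
  exact mem_supp.2 hA

/-- The factor `lam g` is supported left of the cut and commutes with the boundary algebra, so `φ (ρ
g)` alone implements the symmetry there. -/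
theorem IsRightRep.factorRep (h : IsQCA ξ U) (hsym : IsSymmetric (fun g => (μ g).val) U)
    (hn : ξ < n) (hL : 2 * n + 2 * ξ ≤ L) {c : ℤ} {r : ℕ}
    {ρ : G →* Matrix.unitaryGroup (Fin r) ℂ}
    (hρ : IsRightRep (fun g => (μ g).val) ξ n U (c : ZMod L) ρ) :
    ∃ R : G → Op L s, FactorRep (symV L μ) (right ξ U (c + n) c) r R ∧
      ∀ g, ntr (R g) = ntr (ρ g).val := by
  have hU := h.mul_conjTranspose
  obtain ⟨φ, hφ, lam, hlam⟩ := hρ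
  rw [arc_interval, arc_right, rightSet_eq hU,
    bal_eq_right h (by omega) (by omega) (by omega) (by omega)] at hφ
  simp only [arc_interval, arc_left] at hlam
  have hb := bal_eq_right (a := c - n) (b := c + n) (c := c) (e := c + n + ξ) h (by omega)
    (by omega) (by omega) (by omega)
  have hφu : ∀ g, φ (ρ g).val * (φ (ρ g).val)ᴴ = 1 := fun g => by
    rw [← Matrix.star_eq_conjTranspose, ← map_star, ← map_mul,
      Matrix.mem_unitaryGroup_iff.1 (ρ g).2, map_one]
  refine ⟨fun g => φ (ρ g).val, ⟨φ, ρ, hφ, fun g => rfl, fun g X hX => ?_⟩, fun g =>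
    ntr_map φ (ρ g).val⟩
  obtain ⟨hl1, hl2⟩ := hlam g
  set u := evolve U (symOn (μ g).val (seg L (c - n) (c + n))) with hu
  have huu : u * uᴴ = 1 := by
    rw [hu, ← evolve_conjTranspose, ← evolve_mul hU, mul_eq_one_comm.1
      (symOn_unitary (symm_unitary μ g) _)]
    exact map_one (evolveHom U hU)
  have hl : lam g * (lam g)ᴴ = 1 := by
    have h1 : lam g = u * (φ (ρ g).val)ᴴ := by rw [hl2, mul_assoc, hφu, mul_one]
    have h2 : (φ (ρ g).val)ᴴ * φ (ρ g).val = 1 := mul_eq_one_comm.1 (hφu g)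
    rw [h1, Matrix.conjTranspose_mul, Matrix.conjTranspose_conjTranspose]
    calc u * (φ (ρ g).val)ᴴ * (φ (ρ g).val * uᴴ)
        = u * ((φ (ρ g).val)ᴴ * φ (ρ g).val) * uᴴ := by simp only [mul_assoc]
      _ = 1 := by rw [h2, mul_one, huu]
  have hX' : X ∈ bal U (seg L (c - n) (c + n)) (seg L c (c + n + ξ)) := hb ▸ hX
  have hconj : symV L μ g * X * (symV L μ g)ᴴ = u * X * uᴴ := by
    rw [← evolve_evolve_symm hU X, hsym.evolve_conj, symV,
      symOn_univ_conj (symm_unitary μ g) hX'.1, evolve_mul hU, evolve_mul hU,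
      evolve_conjTranspose]
  have hρX : ∀ W ∈ right ξ U (c + n) c, lam g * W = W * lam g := fun W hW => by
    rw [← hb] at hW
    exact supp_commute (seg_disjoint le_rfl (by omega)) (mem_supp.2 hl1) hW.2
  have hm : φ (ρ g).val * X * (φ (ρ g).val)ᴴ ∈ right ξ U (c + n) c := by
    rw [← hφ] at hX ⊢
    obtain ⟨x, rfl⟩ := hX
    exact ⟨(ρ g).val * x * star (ρ g).val, by
      rw [map_mul, map_mul, map_star, Matrix.star_eq_conjTranspose]⟩
  rw [hconj, hl2, Matrix.conjTranspose_mul]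
  calc lam g * φ (ρ g).val * X * ((φ (ρ g).val)ᴴ * (lam g)ᴴ)
      = lam g * (φ (ρ g).val * X * (φ (ρ g).val)ᴴ) * (lam g)ᴴ := by simp only [mul_assoc]
    _ = _ := by rw [hρX _ hm, mul_assoc, hl, mul_one]

/-- The boundary representation of a wide boundary algebra at a fixed position. -/
theorem IsRightRep.exists_wide (h : IsQCA ξ U) (hsym : IsSymmetric (fun g => (μ g).val) U)
    (hn : ξ < n) {c : ZMod L} {r : ℕ} {ρ : G →* Matrix.unitaryGroup (Fin r) ℂ}
    (hρ : IsRightRep (fun g => (μ g).val) ξ n U c ρ) {K N : ℕ} (hK : ξ ≤ K) (hKN : K < N)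
    (hN : n ≤ N) (hL : 2 * N + 6 * K + 2 ≤ L) :
    ∃ R : G → Op L s, FactorRep (symV L μ) (right K U (0 + N) 0) (r * Fintype.card s ^ (N - n)) R ∧
      ∀ g, ntr (R g) = ntr (ρ g).val * ntr (μ g).val ^ (N - n) := by
  obtain ⟨k, -, -, rfl⟩ := exists_lift_seg c 0
  obtain ⟨R, hR, htr⟩ := hρ.factorRep h hsym hn (by omega)
  -- Bringing the boundary algebra to width `N`, position `0` and spreading length `K` makes
  -- different QCA, intervals and positions comparable.
  obtain ⟨R₁, hR₁, htr₁⟩ := right_widen h (by omega) (N - n) (by omega) hR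
  obtain ⟨R₂, hR₂, htr₂⟩ := right_translate (b' := 0 + N) (c' := 0) h hsym (by omega) (by omega)
    (by omega) hR₁
  refine ⟨R₂, hR₂.congr_set (right_mono_spread h hK (by omega) (by omega)).symm, fun g => ?_⟩
  rw [htr₂, htr₁, htr]

theorem IsRightRep.ntr_eq_zero (h : IsQCA ξ U) (hsym : IsSymmetric (fun g => (μ g).val) U)
    (hn : ξ < n) (hL : 2 * n + 2 * ξ ≤ L) {c : ZMod L} {r : ℕ}
    {ρ : G →* Matrix.unitaryGroup (Fin r) ℂ}
    (hρ : IsRightRep (fun g => (μ g).val) ξ n U c ρ) {g : G} (hg : ntr (μ g).val = 0) :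
    ntr (ρ g).val = 0 := by
  obtain ⟨k, -, -, rfl⟩ := exists_lift_seg c 0
  obtain ⟨R, hR, htr⟩ := hρ.factorRep h hsym hn hL
  rw [← htr, right_ntr_eq_zero h (by omega) hR hg]

omit [Nonempty s] in
theorem isQCA_one : IsQCA 0 (1 : Op L s) :=
  ⟨one_mem _, fun i A hA => by
    have : arc (i - ((0 : ℕ) : ZMod L)) (2 * 0 + 1) = {i} := by
      ext x; simp [arc]
    rw [this]
    simpa [evolve] using hA⟩

/-- The boundary algebra of the trivial QCA. -/
theorem exists_right_one (K N : ℕ) (hL : N + 2 * K ≤ L) :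
    ∃ R : G → Op L s, FactorRep (symV L μ) (right K 1 (0 + N) 0) (Fintype.card s ^ N) R ∧
      ∀ g, ntr (R g) = ntr (μ g).val ^ N := by
  classical
  obtain ⟨S, hS⟩ : ∃ S : Set (ZMod L), S = seg L 0 (0 + N) := ⟨_, rfl⟩
  have hN : S.ncard = N := by rw [hS, ncard_seg (by omega) (by omega)]; omega
  have hcard : Fintype.card (S → s) = Fintype.card s ^ N := by rw [card_fun_set, hN]
  let e := Fintype.equivFinOfCardEq hcard
  let φ : Matrix (Fin _) (Fin _) ℂ →⋆ₐ[ℂ] Op L s := (embOp S).comp (submatrixHom e)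
  have hφ : ∀ X, X ∈ Set.range φ ↔ X ∈ supp S := by
    intro X
    constructor
    · rintro ⟨x, rfl⟩; exact embOp_mem _ _
    · rintro ⟨x, rfl⟩
      obtain ⟨y, rfl⟩ := submatrixHom_surjective e x
      exact ⟨y, rfl⟩
  have hset : Set.range φ = right K 1 (0 + N) 0 := by
    ext X
    rw [hφ]
    have h1 : evolve (1 : Op L s)ᴴ X = X := by simp [evolve]
    constructor
    · intro hX
      refine ⟨?_, supp_mono (hS ▸ seg_mono le_rfl (by omega)) hX⟩
      rw [h1]
      exact supp_mono (hS ▸ seg_mono (by omega) le_rfl) hX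
    · rintro ⟨hX1, hX2⟩
      rw [h1] at hX1
      refine supp_mono ?_ (mem_supp_inter hX1 hX2)
      rintro _ ⟨⟨k, hk1, hk2, rfl⟩, ⟨k', hk1', hk2', hkk⟩⟩
      have := eq_of_cast_eq hkk (by omega) (by omega)
      exact hS ▸ mem_seg (by omega) (by omega)
  obtain ⟨ρ, hρ⟩ := exists_rep_of_mem_range φ (fun g => symOn (μ g).val S)
    (fun g => (hφ _).2 (symOn_mem_supp _ _)) (fun g => symOn_unitary (symm_unitary μ g) _)
    (fun g k => by rw [symOn_mul, _root_.map_mul μ]; rfl)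
  refine ⟨_, ⟨φ, ρ, hset, hρ, fun g X hX => ?_⟩, fun g => by rw [ntr_symOn, hN]⟩
  exact symOn_univ_conj (symm_unitary μ g) ((hφ X).1 (hset ▸ hX))

end RightRep

/-! ### Existence for cyclic groups -/

section Cyclic

variable {G : Type*} [Group G] {m : Type*} [Fintype m] [DecidableEq m] [Nonempty m]

/-- An action of a finite cyclic group on a full matrix algebra comes from a representation. -/
theorem exists_rep_of_isCyclic [Finite G] [IsCyclic G] {r : ℕ}
    (φ : Matrix (Fin r) (Fin r) ℂ →⋆ₐ[ℂ] Matrix m m ℂ) (V : G → Matrix m m ℂ)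
    (hV1 : V 1 = 1) (hVmul : ∀ g h, V (g * h) = V g * V h) (hVu : ∀ g, V g * (V g)ᴴ = 1)
    (hVφ : ∀ g x, V g * φ x * (V g)ᴴ ∈ Set.range φ) :
    ∃ ρ : G →* Matrix.unitaryGroup (Fin r) ℂ, ∀ g x,
      V g * φ x * (V g)ᴴ = φ (ρ g).val * φ x * (φ (ρ g).val)ᴴ := by
  classical
  have hinj := starAlgHom_injective φ
  obtain ⟨g₀, hg₀⟩ := IsCyclic.exists_generator (α := G)
  have hV' : (V g₀)ᴴ * V g₀ = 1 := mul_eq_one_comm.1 (hVu g₀)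
  let conjHom : Matrix m m ℂ →⋆ₐ[ℂ] Matrix m m ℂ :=
    { toFun := fun X => V g₀ * X * (V g₀)ᴴ
      map_one' := by rw [mul_one, hVu]
      map_mul' := fun X Y => by
        calc V g₀ * (X * Y) * (V g₀)ᴴ = V g₀ * X * ((V g₀)ᴴ * V g₀) * Y * (V g₀)ᴴ := by
              rw [hV', mul_one]; simp only [mul_assoc]
          _ = _ := by simp only [mul_assoc]
      map_zero' := by simp
      map_add' := fun X Y => by simp [mul_add, add_mul]
      commutes' := fun a => by
        rw [Algebra.algebraMap_eq_smul_one, mul_smul_comm, mul_one, smul_mul_assoc, hVu]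
      map_star' := fun X => by
        simp [Matrix.star_eq_conjTranspose, Matrix.conjTranspose_mul, mul_assoc] }
  obtain ⟨β, hβ⟩ := exists_starAlgHom_lift φ hinj (conjHom.comp φ) fun x => hVφ g₀ x
  obtain ⟨T, hT1, hT2, hT⟩ := exists_unitary_conj (StarAlgHom.id ℂ _) β
  have hTconj : ∀ x, V g₀ * φ x * (V g₀)ᴴ = φ (T * x * Tᴴ) := fun x => by
    have h1 : T * x = β x * T := hT x
    have h2 : φ (β x) = V g₀ * φ x * (V g₀)ᴴ := hβ x
    rw [h1, mul_assoc (β x), hT2, mul_one, h2]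
  have hpow : ∀ k : ℕ, ∀ x, V (g₀ ^ k) * φ x * (V (g₀ ^ k))ᴴ = φ (T ^ k * x * (T ^ k)ᴴ) := by
    intro k
    induction k with
    | zero => intro x; simp [hV1]
    | succ k ih =>
      intro x
      rw [pow_succ', hVmul, Matrix.conjTranspose_mul, pow_succ', Matrix.conjTranspose_mul]
      calc V g₀ * V (g₀ ^ k) * φ x * ((V (g₀ ^ k))ᴴ * (V g₀)ᴴ)
          = V g₀ * (V (g₀ ^ k) * φ x * (V (g₀ ^ k))ᴴ) * (V g₀)ᴴ := by simp only [mul_assoc]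
        _ = _ := by rw [ih, hTconj]; simp only [mul_assoc]
  have hTu : T ∈ Matrix.unitaryGroup (Fin r) ℂ := Matrix.mem_unitaryGroup_iff.2 hT2
  have hTku : ∀ k : ℕ, (T ^ k)ᴴ * T ^ k = 1 := fun k =>
    Matrix.mem_unitaryGroup_iff'.1 (pow_mem hTu k)
  set N := orderOf g₀ with hN
  have hN0 : 0 < N := orderOf_pos g₀
  -- Since `g₀ ^ N = 1`, the power `T ^ N` is central and hence a scalar `a`. Multiplying `T` by an
  -- `N`-th root of `a⁻¹` removes the obstruction to a linear representation.
  have hTN : ∀ x, T ^ N * x = x * T ^ N := by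
    intro x
    have h1 := hpow N x
    rw [hN, pow_orderOf_eq_one, hV1, Matrix.conjTranspose_one, one_mul, mul_one, ← hN] at h1
    have h2 := hinj h1
    conv_rhs => rw [h2]
    rw [mul_assoc, hTku, mul_one]
  have : Nonempty (Fin r) := nonempty_of_starAlgHom φ
  obtain ⟨a, ha⟩ : T ^ N ∈ Set.range (Matrix.scalar (Fin r)) := by
    rw [Matrix.mem_range_scalar_iff_commute_single']
    exact fun i j => (hTN _).symm
  have ha' : T ^ N = a • (1 : Matrix (Fin r) (Fin r) ℂ) := by
    rw [← ha]
    ext i j; simp [Matrix.scalar_apply, Matrix.diagonal_apply, Matrix.one_apply]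
  have hanorm : ‖a‖ = 1 := norm_eq_one_of_smul_unitary (hTku N) (by simp) ha'
  have ha0 : a ≠ 0 := fun h => by rw [h, norm_zero] at hanorm; exact zero_ne_one hanorm
  obtain ⟨z, hz⟩ := IsAlgClosed.exists_pow_nat_eq a⁻¹ hN0
  have hznorm : ‖z‖ = 1 := by
    have h1 : ‖z‖ ^ N = 1 := by rw [← norm_pow, hz, norm_inv, hanorm, inv_one]
    exact (pow_eq_one_iff_of_nonneg (norm_nonneg z) hN0.ne').1 h1
  have hzz : star z * z = 1 := by
    rw [Complex.star_def, Complex.conj_mul', hznorm]; simp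
  let T' : Matrix.unitaryGroup (Fin r) ℂ := ⟨z • T, Matrix.mem_unitaryGroup_iff'.2 (by
    rw [star_smul, smul_mul_assoc, mul_smul_comm, Matrix.star_eq_conjTranspose, hT1, smul_smul, hzz,
      one_smul])⟩
  have hT'N : T' ^ N = 1 := by
    refine Subtype.ext ?_
    change (z • T) ^ N = 1
    rw [smul_pow, hz, ha', smul_smul, inv_mul_cancel₀ ha0, one_smul]
  let ρ : G →* Matrix.unitaryGroup (Fin r) ℂ :=
    monoidHomOfForallMemZpowers hg₀ (orderOf_dvd_of_pow_eq_one hT'N)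
  have hρ : ρ g₀ = T' := monoidHomOfForallMemZpowers_apply_gen _ _
  refine ⟨ρ, fun g x => ?_⟩
  obtain ⟨k, hk⟩ := (mem_powers_iff_mem_zpowers (x := g₀)).2 (hg₀ g)
  have hk' : g₀ ^ k = g := hk
  subst hk'
  rw [hpow, map_pow, hρ]
  change _ = φ ((z • T) ^ k) * _ * (φ ((z • T) ^ k))ᴴ
  rw [← Matrix.star_eq_conjTranspose (φ _), ← map_star, ← map_mul, ← map_mul]
  congr 1
  rw [smul_pow, star_smul, smul_mul_assoc, smul_mul_assoc, mul_smul_comm, smul_smul, star_pow,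
    ← mul_pow, mul_comm z, hzz, one_pow, one_smul, Matrix.star_eq_conjTranspose]

end Cyclic

section Existence

variable {G : Type*} [Group G] {L : ℕ} [NeZero L] {s : Type} [Fintype s] [DecidableEq s]
  [Nonempty s] {μ : G →* Matrix.unitaryGroup s ℂ} {ξ n : ℕ} {U : Op L s}

/-- For cyclic groups, the boundary representations exist. -/
theorem exists_isRightRep_of_isCyclic [Finite G] [IsCyclic G] (h : IsQCA ξ U)
    (hsym : IsSymmetric (fun g => (μ g).val) U) (hn : ξ < n) (hL : 2 * n + 4 * ξ + 1 ≤ L)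
    (c : ZMod L) : ∃ (r : ℕ) (ρ : G →* Matrix.unitaryGroup (Fin r) ℂ),
      IsRightRep (fun g => (μ g).val) ξ n U c ρ := by
  obtain ⟨k, -, -, rfl⟩ := exists_lift_seg c 0
  have hU := h.mul_conjTranspose
  have hU' := h.symm.mul_conjTranspose
  obtain ⟨I, hI⟩ : ∃ I : Set (ZMod L), I = seg L (k - n) (k + n) := ⟨_, rfl⟩
  obtain ⟨P, hP⟩ : ∃ P : Set (ZMod L), P = seg L k (k + n + ξ) := ⟨_, rfl⟩
  obtain ⟨Q, hQ⟩ : ∃ Q : Set (ZMod L), Q = seg L (k - n - ξ) k := ⟨_, rfl⟩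
  have hs : Splits ξ I P Q := by
    rw [hI, hP, hQ]
    exact splits_seg (by omega) (by omega) (by omega)
  let 𝓑 : StarSubalgebra ℂ (Op L s) := (supp I).comap (evolveHom Uᴴ hU') ⊓ supp P
  have h𝓑 : ∀ X, X ∈ 𝓑 ↔ X ∈ bal U I P := fun X => by
    rw [StarSubalgebra.mem_inf]; rfl
  -- A central element is supported on `P` and, commuting with the algebra, also on the disjoint set
  -- `Q`; so it is a scalar.
  obtain ⟨r, φ, hφ⟩ := exists_starAlgHom_range_eq 𝓑 (by
    intro X hX hXc
    have h1 := (h𝓑 X).1 hX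
    have h2 : X ∈ supp Q := mem_supp_of_commute_bal h hs h1.1 fun Y hY => hXc Y ((h𝓑 Y).2 hY)
    have h3 := mem_supp_inter h1.2 h2
    rw [hs.disjoint.inter_eq] at h3
    exact eq_smul_one_of_mem_supp_empty h3)
  have hφB : ∀ X, X ∈ Set.range φ ↔ X ∈ bal U I P := fun X => by rw [hφ]; exact h𝓑 X
  have hbal : ∀ x, φ x ∈ bal U I P := fun x => (hφB _).1 ⟨x, rfl⟩
  have hVbal : ∀ g, ∀ X ∈ bal U I P, symV L μ g * X * (symV L μ g)ᴴ ∈ bal U I P := by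
    intro g X hX
    refine ⟨?_, symOn_conj_mem (symm_unitary μ g) hX.2⟩
    rw [← hsym.symm.evolve_conj]
    exact symOn_conj_mem (symm_unitary μ g) hX.1
  obtain ⟨ρ, hρ⟩ := exists_rep_of_isCyclic φ (symV L μ)
    (by rw [symV, map_one]; exact symOn_one _)
    (fun g g' => by rw [symV, symV, symV, symOn_mul, map_mul μ]; rfl) symV_unitary'
    (fun g x => (hφB _).2 (hVbal g _ (hbal x)))
  refine ⟨r, ρ, φ, ?_, fun g => evolve U (symOn (μ g).val I) * (φ (ρ g).val)ᴴ, fun g => ?_⟩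
  · rw [arc_interval, arc_right, rightSet_eq hU, ← hI, ← hP]
    exact Set.ext hφB
  have hφu : (φ (ρ g).val)ᴴ * φ (ρ g).val = 1 := by
    rw [← Matrix.star_eq_conjTranspose, ← map_star, ← map_mul,
      Matrix.mem_unitaryGroup_iff'.1 (ρ g).2, map_one]
  rw [arc_left, arc_interval, ← hQ, ← hI]
  -- The evolved symmetry of the interval and `φ (ρ g)` act alike on the right algebra. Their
  -- quotient commutes with it and is therefore supported on the left half.
  refine ⟨mem_supp.1 (mem_supp_of_commute_bal h hs ?_ fun X hX => ?_), ?_⟩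
  · rw [evolve_mul hU', evolve_symm_evolve hU, evolve_conjTranspose]
    exact mul_mem (symOn_mem_supp _ _) (star_mem (hbal _).1)
  · set u := evolve U (symOn (μ g).val I) with hu
    have hφH : ∃ y, φ y = (φ (ρ g).val)ᴴ * X * φ (ρ g).val := by
      obtain ⟨x, rfl⟩ := (hφB X).2 hX
      exact ⟨star (ρ g).val * x * (ρ g).val, by
        rw [map_mul, map_mul, map_star, Matrix.star_eq_conjTranspose]⟩
    obtain ⟨y, hy⟩ := hφH
    have h1 : u * φ y * uᴴ = X := by
      have h2 : symV L μ g * φ y * (symV L μ g)ᴴ = u * φ y * uᴴ := by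
        rw [← evolve_evolve_symm hU (φ y), hsym.evolve_conj, symV,
          symOn_univ_conj (symm_unitary μ g) (hbal y).1, evolve_mul hU, evolve_mul hU,
          evolve_conjTranspose]
      rw [← h2, hρ, hy]
      calc _ = φ (ρ g).val * (φ (ρ g).val)ᴴ * X * (φ (ρ g).val * (φ (ρ g).val)ᴴ) := by
            simp only [mul_assoc]
        _ = X := by rw [mul_eq_one_comm.1 hφu, one_mul, mul_one]
    have huu : uᴴ * u = 1 := by
      rw [hu, ← evolve_conjTranspose, ← evolve_mul hU, symOn_unitary (symm_unitary μ g)]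
      exact map_one (evolveHom U hU)
    conv_rhs => rw [← h1, hy]
    calc u * (φ (ρ g).val)ᴴ * X = u * ((φ (ρ g).val)ᴴ * X * (φ (ρ g).val * (φ (ρ g).val)ᴴ)) := by
          rw [mul_eq_one_comm.1 hφu, mul_one, mul_assoc]
      _ = u * ((φ (ρ g).val)ᴴ * X * φ (ρ g).val) * (uᴴ * u) * (φ (ρ g).val)ᴴ := by
          rw [huu, mul_one]; simp only [mul_assoc]
      _ = _ := by beta_reduce; rw [← hu]; simp only [mul_assoc]
  · rw [mul_assoc, hφu, mul_one]

end Existence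

end QCA

namespace QCA

/-! ### The classification at a fixed system size -/

section Classification

variable {G : Type*} [Group G] [Finite G] {L : ℕ} [NeZero L] {s : Type} [Fintype s] [DecidableEq s]
  [Nonempty s] {μ : G →* Matrix.unitaryGroup s ℂ} {ξ ξ' n n' r r' : ℕ} {U U' : Op L s}
  {c c' : ZMod L} {ρ : G →* Matrix.unitaryGroup (Fin r) ℂ} {ρ' : G →* Matrix.unitaryGroup (Fin r') ℂ}

/-- Two QCA that differ by a circuit with ancillas have boundary representations that differ by
on-site representations. -/
theorem differByOnsite_of_circuit (h : IsQCA ξ U) (hsym : IsSymmetric (fun g => (μ g).val) U)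
    (hn : ξ < n) (hρ : IsRightRep (fun g => (μ g).val) ξ n U c ρ) (h' : IsQCA ξ' U')
    (hsym' : IsSymmetric (fun g => (μ g).val) U') (hn' : ξ' < n')
    (hρ' : IsRightRep (fun g => (μ g).val) ξ' n' U' c' ρ') {k D ℓ : ℕ} {W : Op L (s × (Fin k → s))}
    (hW : IsSymmetricCircuit (tensorCopies (fun g => (μ g).val) (fun g => (μ g).val) k) D ℓ W)
    (hWU : withAncilla (Fin k → s) U = W * withAncilla (Fin k → s) U') {K N : ℕ}
    (hK : ξ + ξ' + D * ℓ ≤ K) (hKN : K < N) (hnN : n ≤ N) (hnN' : n' ≤ N)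
    (hL : 2 * N + 6 * K + 2 * ℓ + 2 ≤ L) :
    DifferByOnsite (fun g => (μ g).val) n n' (fun g => (ρ g).val) fun g => (ρ' g).val := by
  have hDl : 0 ≤ D * ℓ := Nat.zero_le _
  obtain ⟨R, hR, htr⟩ := hρ.exists_wide h hsym hn (K := K) (N := N) (by omega) hKN hnN (by omega)
  obtain ⟨R', hR', htr'⟩ := hρ'.exists_wide h' hsym' hn' (K := K) (N := N) (by omega) hKN hnN'
    (by omega)
  obtain ⟨S, hS, hStr⟩ := right_ancL (σ := powRep μ k) (h.mono (ζ := K) (by omega)) (by omega)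
    (by omega) hR
  obtain ⟨S', hS', hStr'⟩ := right_ancL (σ := powRep μ k) (h'.mono (ζ := K) (by omega)) (by omega)
    (by omega) hR'
  -- The representation `prodRep μ (powRep μ k)` unfolds to `tensorCopies`, so `hW` applies as it
  -- stands.
  obtain ⟨S₁, hS₁, hStr₁⟩ := right_circuit (μ := prodRep μ (powRep μ k)) hW
    (h'.ancL (t := Fin k → s)) hsym'.ancL (ξ := K) (by omega) (by omega) (by omega) hS'
  rw [withAncilla_eq, withAncilla_eq] at hWU
  rw [← hWU] at hS₁
  obtain ⟨hr, u, hu⟩ := hS.unique hS₁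
  have e : ((0 : ℤ) + N - 0).toNat = N := by omega
  rw [e] at hr hStr hStr'
  -- The `N - n` copies come from widening the boundary algebra to `N` sites, the `k * N` copies
  -- from the ancillas of these sites.
  refine ⟨u, N - n + k * N, N - n' + k * N, by omega, ?_⟩
  refine equivUpTo_of_ntr (prodRep ρ (powRep μ (N - n + k * N)))
    (prodRep ρ' (powRep μ (N - n' + k * N))) u ?_ fun g => ?_
  · simp only [Fintype.card_prod, Fintype.card_fin, Fintype.card_fun] at hr ⊢
    rw [pow_add, pow_mul, ← mul_assoc, hr, pow_add, pow_mul, ← mul_assoc]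
  · have h1 : ∀ {q : ℕ} (σ : G →* Matrix.unitaryGroup (Fin q) ℂ) (a : ℕ),
        ntr (prodRep σ (powRep μ a) g).val = ntr (σ g).val * ntr (μ g).val ^ a := fun σ a => by
      rw [← ntr_powRep]
      exact ntr_kronecker _ _
    have h2 := congrArg ntr (hu g)
    rw [ntr_smul, hStr, hStr₁, hStr', htr, htr', ntr_powRep] at h2
    rw [h1, h1, pow_add, pow_mul, ← mul_assoc, h2, pow_add, pow_mul]
    ring

/-- Two QCA with boundary representations that differ by on-site representations differ by a
circuit. -/
theorem isSymmetricCircuit_of_differByOnsite (h : IsQCA ξ U)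
    (hsym : IsSymmetric (fun g => (μ g).val) U) (hn : ξ < n)
    (hρ : IsRightRep (fun g => (μ g).val) ξ n U c ρ) (h' : IsQCA ξ' U')
    (hsym' : IsSymmetric (fun g => (μ g).val) U') (hn' : ξ' < n')
    (hρ' : IsRightRep (fun g => (μ g).val) ξ' n' U' c' ρ')
    (hd : DifferByOnsite (fun g => (μ g).val) n n' (fun g => (ρ g).val) fun g => (ρ' g).val)
    {K N M : ℕ} (hK : ξ ≤ K) (hK' : ξ' ≤ K) (hKN : K < N) (hnN : n < N) (hnN' : n' < N)
    (hM : N + 2 * K + 1 ≤ M) (hL : 2 * N + 5 * M + 6 * K + 2 ≤ L) :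
    IsSymmetricCircuit (fun g => (μ g).val) 4 (3 * M + 2 * K) (U * U'ᴴ) := by
  obtain ⟨R, hR, htr⟩ := hρ.exists_wide h hsym hn hK hKN hnN.le (by omega)
  obtain ⟨R', hR', htr'⟩ := hρ'.exists_wide h' hsym' hn' hK' hKN hnN'.le (by omega)
  obtain ⟨u, a, b, hab, hE⟩ := hd
  have hs : 0 < Fintype.card s := Fintype.card_pos
  have hcard := hE.card_eq
  simp only [Fintype.card_prod, Fintype.card_fin, Fintype.card_fun] at hcard
  have hr : r * Fintype.card s ^ (N - n) = r' * Fintype.card s ^ (N - n') := by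
    refine Nat.eq_of_mul_eq_mul_right (pow_pos hs (n + a)) ?_
    calc r * Fintype.card s ^ (N - n) * Fintype.card s ^ (n + a)
        = r * Fintype.card s ^ a * Fintype.card s ^ N := by
          rw [mul_assoc, mul_assoc, ← pow_add, ← pow_add]; congr 2; omega
      _ = r' * Fintype.card s ^ (N - n') * Fintype.card s ^ (n + a) := by
          rw [hcard, mul_assoc, mul_assoc, ← pow_add, ← pow_add]; congr 2; omega
  rw [hr] at hR
  refine isSymmetricCircuit_of_ntr_eq (h.mono hK) (h'.mono hK') hsym hsym' hKN hM (by omega) hR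
    (hR'.twist u) fun g => ?_
  rw [ntr_smul, htr, htr']
  -- The strict inequalities `n < N` and `n' < N` provide a factor `ntr (μ g)` on both sides.
  by_cases hg : ntr (μ g).val = 0
  · rw [hg, zero_pow (by omega), zero_pow (by omega), mul_zero, mul_zero, mul_zero]
  · have h1 : ntr (ρ g).val * ntr (μ g).val ^ a = u g * (ntr (ρ' g).val * ntr (μ g).val ^ b) := by
      have h2 := hE.ntr_eq g
      simp only [tensorCopies, ntr_kronecker, ntr_tensorOp, Finset.prod_const, Finset.card_univ,
        Fintype.card_fin] at h2
      exact h2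
    refine mul_right_cancel₀ (pow_ne_zero (n + a) hg) ?_
    calc ntr (ρ g).val * ntr (μ g).val ^ (N - n) * ntr (μ g).val ^ (n + a)
        = ntr (ρ g).val * ntr (μ g).val ^ a * ntr (μ g).val ^ N := by
          rw [mul_assoc, mul_assoc, ← pow_add, ← pow_add]; congr 2; omega
      _ = u g * (ntr (ρ' g).val * (ntr (μ g).val ^ b * ntr (μ g).val ^ N)) := by
          rw [h1]; simp only [mul_assoc]
      _ = _ := by
          rw [mul_assoc, mul_assoc, ← pow_add, ← pow_add]; congr 3; omega

/-- The boundary representation of a circuit is on-site. -/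
theorem equivUpTo_of_isSymmetricCircuit (h : IsQCA ξ U)
    (hsym : IsSymmetric (fun g => (μ g).val) U) (hn : ξ < n)
    (hρ : IsRightRep (fun g => (μ g).val) ξ n U c ρ) {D ℓ : ℕ}
    (hW : IsSymmetricCircuit (fun g => (μ g).val) D ℓ U) {K N : ℕ}
    (hK : ξ + D * ℓ ≤ K) (hKN : K < N) (hnN : n ≤ N) (hL : 2 * N + 6 * K + 2 * ℓ + 2 ≤ L) :
    ∃ u : G →* Circle, EquivUpTo u (fun g => (ρ g).val)
      fun g => tensorOp fun _ : Fin n => (μ g).val := by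
  have hDl : 0 ≤ D * ℓ := Nat.zero_le _
  obtain ⟨R, hR, htr⟩ := hρ.exists_wide h hsym hn (K := K) (N := N) (by omega) hKN hnN (by omega)
  obtain ⟨R', hR', htr'⟩ := exists_right_one (L := L) (μ := μ) K N (by omega)
  obtain ⟨R₁, hR₁, htr₁⟩ := right_circuit hW isQCA_one IsSymmetric.one (ξ := K) (by omega)
    (by omega) (by omega) hR'
  rw [mul_one] at hR₁
  obtain ⟨hr, u, hu⟩ := hR.unique hR₁
  have hs : 0 < Fintype.card s := Fintype.card_pos
  refine ⟨u, equivUpTo_of_ntr ρ (powRep μ n) u ?_ fun g => ?_⟩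
  · simp only [Fintype.card_fin, Fintype.card_fun]
    refine Nat.eq_of_mul_eq_mul_right (pow_pos hs (N - n)) ?_
    rw [hr, ← pow_add]
    congr 1; omega
  · rw [ntr_powRep]
    -- The widening factor has to be cancelled here; where it may vanish, the vanishing of the
    -- character of `ρ` is used instead.
    by_cases hg : ntr (μ g).val = 0
    · rw [hρ.ntr_eq_zero h hsym hn (by omega) hg, hg, zero_pow (by omega), mul_zero]
    · have h2 := congrArg ntr (hu g)
      rw [ntr_smul, htr₁, htr', htr] at h2
      refine mul_right_cancel₀ (pow_ne_zero (N - n) hg) ?_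
      rw [h2, mul_assoc, ← pow_add]
      congr 2; omega

/-- A QCA with an on-site boundary representation is a circuit. -/
theorem isSymmetricCircuit_of_equivUpTo (h : IsQCA ξ U)
    (hsym : IsSymmetric (fun g => (μ g).val) U) (hn : ξ < n)
    (hρ : IsRightRep (fun g => (μ g).val) ξ n U c ρ) {u : G →* Circle}
    (hE : EquivUpTo u (fun g => (ρ g).val) fun g => tensorOp fun _ : Fin n => (μ g).val)
    {N M : ℕ} (hnN : n ≤ N) (hM : N + 2 * ξ + 1 ≤ M) (hL : 2 * N + 5 * M + 6 * ξ + 2 ≤ L) :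
    IsSymmetricCircuit (fun g => (μ g).val) 4 (3 * M + 2 * ξ) U := by
  obtain ⟨R, hR, htr⟩ := hρ.exists_wide h hsym hn (K := ξ) (N := N) le_rfl (by omega) hnN (by omega)
  obtain ⟨R', hR', htr'⟩ := exists_right_one (L := L) (μ := μ) ξ N (by omega)
  have hcard := hE.card_eq
  simp only [Fintype.card_fin, Fintype.card_fun] at hcard
  have hr : r * Fintype.card s ^ (N - n) = Fintype.card s ^ N := by
    rw [hcard, ← pow_add]; congr 1; omega
  rw [hr] at hR
  -- Comparison with the identity QCA, whose boundary representation is on-site.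
  have := isSymmetricCircuit_of_ntr_eq h (isQCA_one.mono (Nat.zero_le ξ)) hsym IsSymmetric.one
    (by omega) hM (by omega) hR (hR'.twist u) fun g => by
      rw [ntr_smul, htr, htr', hE.ntr_eq, ntr_tensorOp]
      simp only [Finset.prod_const, Finset.card_univ, Fintype.card_fin]
      rw [mul_assoc, ← pow_add]
      congr 2; omega
  rwa [Matrix.conjTranspose_one, mul_one] at this

end Classification

end QCA

end

theorem theorem1 {G : Type*} [Group G] [Finite G] {d : ℕ} (hd : 0 < d)
    (μ : G →* Matrix.unitaryGroup (Fin d) ℂ) {ξ n : ℕ} (hn : ξ < n)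
    (U : ∀ L : ℕ+, QCA.Op L (Fin d))
    (hU : ∀ L, QCA.IsQCA ξ (U L) ∧ QCA.IsSymmetric (fun g => (μ g).val) (U L)) :
    -- for cyclic `G`, the representation `R_g` exists
    (IsCyclic G → ∀ᶠ L : ℕ+ in Filter.atTop, ∀ c : ZMod L,
      ∃ (r : ℕ) (ρ : G →* Matrix.unitaryGroup (Fin r) ℂ),
        QCA.IsRightRep (fun g => (μ g).val) ξ n (U L) c ρ) ∧
    ∀ (c : ∀ L : ℕ+, ZMod L) (r : ℕ+ → ℕ) (ρ : ∀ L, G →* Matrix.unitaryGroup (Fin (r L)) ℂ),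
      (∀ᶠ L : ℕ+ in Filter.atTop,
        QCA.IsRightRep (fun g => (μ g).val) ξ n (U L) (c L) (ρ L)) →
      -- the classification
      (∀ {ξ' n' : ℕ}, ξ' < n' → ∀ U' : ∀ L : ℕ+, QCA.Op L (Fin d),
        (∀ L, QCA.IsQCA ξ' (U' L) ∧ QCA.IsSymmetric (fun g => (μ g).val) (U' L)) →
        ∀ (c' : ∀ L : ℕ+, ZMod L) (r' : ℕ+ → ℕ)
          (ρ' : ∀ L, G →* Matrix.unitaryGroup (Fin (r' L)) ℂ),
        (∀ᶠ L : ℕ+ in Filter.atTop,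
          QCA.IsRightRep (fun g => (μ g).val) ξ' n' (U' L) (c' L) (ρ' L)) →
        (QCA.StronglyEquivalent (fun g => (μ g).val) U U' ↔
          ∀ᶠ L : ℕ+ in Filter.atTop,
            QCA.DifferByOnsite (fun g => (μ g).val) n n'
              (fun g => (ρ L g).val) (fun g => (ρ' L g).val))) ∧
      -- the trivial class
      (QCA.IsSymmetricFDQC (fun g => (μ g).val) U ↔
        ∀ᶠ L : ℕ+ in Filter.atTop, ∃ u : G →* Circle,
          QCA.EquivUpTo u (fun g => (ρ L g).val)
            (fun g => QCA.tensorOp fun _ : Fin n => (μ g).val)) := by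
  have : Nonempty (Fin d) := ⟨⟨0, hd⟩⟩
  have large : ∀ B : ℕ, ∀ᶠ L : ℕ+ in Filter.atTop, B ≤ (L : ℕ) := fun B => by
    filter_upwards [Filter.eventually_ge_atTop (⟨B + 1, Nat.succ_pos B⟩ : ℕ+)] with L hL
    have : B + 1 ≤ (L : ℕ) := hL
    omega
  refine ⟨fun hG => ?_, fun c r ρ hρ => ⟨?_, ⟨?_, ?_⟩⟩⟩
  · filter_upwards [large (2 * n + 4 * ξ + 1)] with L hL c
    exact QCA.exists_isRightRep_of_isCyclic (hU L).1 (hU L).2 hn hL c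
  · intro ξ' n' hn' U' hU' c' r' ρ' hρ'
    constructor
    · rintro ⟨k, W, ⟨D, ℓ, hW⟩, hWU⟩
      filter_upwards [hρ, hρ', hW, hWU, large (2 * (ξ + ξ' + D * ℓ + 1 + n + n') +
        6 * (ξ + ξ' + D * ℓ) + 2 * ℓ + 2)] with L hρ hρ' hW hWU hL
      exact QCA.differByOnsite_of_circuit (hU L).1 (hU L).2 hn hρ (hU' L).1 (hU' L).2 hn' hρ' hW hWU
        le_rfl (by omega) (by omega) (by omega) hL
    · intro hd
      set K := ξ + ξ' with hK
      set N := K + 1 + n + n' with hN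
      -- No ancillas are needed in this direction: the QCA already differ by a circuit on the
      -- original chain, here written with empty ancilla registers.
      refine ⟨0, fun L => QCA.ancL (Fin 0 → Fin d) (U L * (U' L)ᴴ),
        ⟨4, 3 * (N + 2 * K + 1) + 2 * K, ?_⟩, .of_forall fun L => ?_⟩
      · filter_upwards [hρ, hρ', hd, large (2 * N + 5 * (N + 2 * K + 1) + 6 * K + 2)] with
          L hρ hρ' hd hL
        exact (QCA.isSymmetricCircuit_of_differByOnsite (hU L).1 (hU L).2 hn hρ (hU' L).1 (hU' L).2
          hn' hρ' hd (by omega) (by omega) (by omega) (by omega) (by omega) le_rfl hL).ancL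
          (σ := QCA.powRep μ 0)
      · rw [QCA.withAncilla_eq, QCA.withAncilla_eq, ← map_mul, mul_assoc,
          (hU' L).1.conjTranspose_mul, mul_one]
  · rintro ⟨D, ℓ, hW⟩
    filter_upwards [hρ, hW, large (2 * (ξ + D * ℓ + 1 + n) + 6 * (ξ + D * ℓ) + 2 * ℓ + 2)] with
      L hρ hW hL
    exact QCA.equivUpTo_of_isSymmetricCircuit (hU L).1 (hU L).2 hn hρ hW le_rfl (by omega)
      (by omega) hL
  · intro hE
    refine ⟨4, 3 * (n + 2 * ξ + 1) + 2 * ξ, ?_⟩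
    filter_upwards [hρ, hE, large (2 * n + 5 * (n + 2 * ξ + 1) + 6 * ξ + 2)] with L hρ hE hL
    obtain ⟨u, hE⟩ := hE
    exact QCA.isSymmetricCircuit_of_equivUpTo (hU L).1 (hU L).2 hn hρ hE le_rfl le_rfl hL
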